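/- Let $\mathfrak g$ be the real 6-dimensional Lie algebra underlying the complex Heisenberg Lie algebra of strictly upper triangular complex $3\times3$ matrices (the Lie algebra of the Iwasawa manifold). With $z_1=A_{12}$, $z_2=A_{23}$, $z_3=A_{13}$ for $A\in\mathfrak g$, let $e^1,\dots,e^6$ be the real basis of $\mathfrak g^*$ given by $e^1+ie^2=z_1$, $e^3+ie^4=z_2$, $e^5+ie^6=-z_3$, and let $g=\sum_{i=1}^6 e^i\otimes e^i$. Let $J_0$ be multiplication by $i$ on $\mathfrak g$. Let $\mathcal C^+(\mathfrak g)\subset\mathrm{End}_{\mathbb R}(\mathfrak g)$, with the subspace topology, be the set of $J$ with $J^2=-1$ and $[JX,JY]=[X,Y]+J[JX,Y]+J[X,JY]$ for all $X,Y\in\mathfrak g$ that induce the same orientation of $\mathfrak g$ as $J_0$, and let $\mathcal C^+(\mathfrak g,g)$ be the subset of those that are $g$-orthogonal. Let $\mathbb D=\langle e^1,e^2,e^3,e^4\rangle=\ker(d:\mathfrak g^*\to\bigwedge^2\mathfrak g^*)$. If the action of $J$ on $\mathfrak g^*$ preserves $\mathbb D$, write $\widehat J$ for the induced endomorphism of $\mathbb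 D$; orient $\mathbb D$ by $\widehat{J_0}$. Let $\mathcal C_+$ (respectively $\mathcal C_-$) be the set of $J\in\mathcal C^+(\mathfrak g)$ that preserve $\mathbb D$ and for which $\widehat J$ induces the positive (respectively negative) orientation of $\mathbb D$. Let $\mathcal Z$ be the set of all $g$-orthogonal $J$ with $J^2=-1$ (not assumed integrable) that induce the same orientation of $\mathfrak g$ as $J_0$, preserve $\mathbb D$, and have $\widehat J$ negatively oriented. Then: 1. $\mathcal C^+(\mathfrak g)$ has the same homotopy type as $\mathcal C^+(\mathfrak g,g)$. 2. $\mathcal C^+(\mathfrak g,g)=\{J_0\}\cup\mathcal Z$, where $J_0\notin\mathcal Z$ and $\mathcal Z$ is homeomorphic to the sphere $S^2$. Moreover $\mathcal C^+(\mathfrak g)$ is homotopy equivalent to the disjoint union of a point and $S^2$. 3. $\mathcal C^+(\mathfrak g)$ is the disjoint union of $\mathcal C_+$ and $\mathcal C_-$, where $J_0\in\mathcal C_+$; the sets $\mathcal C_+$ and $\mathcal C_-$ are the connected components of $\mathcal C^+(\mathfrak g)$; $\mathcal C_+$ is contractible, and $\mathcal C_-$ is homotopy equivalent to $S^2$. 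-/

import Mathlib

open scoped ContinuousMap

noncomputable section

namespace Iwasawa

attribute [local instance] LieRing.ofAssociativeRing

/-- The Lie algebra of the complex Heisenberg group: strictly upper triangular complex `3 × 3`
matrices with the commutator bracket, regarded as a real (6-dimensional) Lie algebra. -/
def heis : LieSubalgebra ℝ (Matrix (Fin 3) (Fin 3) ℂ) where
  carrier := {A | ∀ i j, j ≤ i → A i j = 0}
  add_mem' := by
    intro A B hA hB i j h
    simp [hA i j h, hB i j h]
  zero_mem' := by
    intro i j _
    rfl
  smul_mem' := by
    intro c A hA i j h
    simp [hA i j h]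
  lie_mem' := by
    intro A B hA hB i j h
    have key : ∀ A B : Matrix (Fin 3) (Fin 3) ℂ, (∀ i j, j ≤ i → A i j = 0) →
        (∀ i j, j ≤ i → B i j = 0) → (A * B) i j = 0 := by
      intro A B hA hB
      rw [Matrix.mul_apply]
      refine Finset.sum_eq_zero fun k _ => ?_
      rcases le_total k i with hk | hk
      · rw [hA i k hk, zero_mul]
      · rw [hB k j (h.trans hk), mul_zero]
    rw [Ring.lie_def, Matrix.sub_apply, key A B hA hB, key B A hB hA, sub_zero]

/-- Addition and subtraction of `heis` are continuous for the topology of entries. -/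
instance : IsTopologicalAddGroup heis where
  continuous_add :=
    ((continuous_subtype_val.comp continuous_fst).add
      (continuous_subtype_val.comp continuous_snd)).subtype_mk _
  continuous_neg := continuous_subtype_val.neg.subtype_mk _

/-- Multiplication by real scalars is continuous on `heis`. -/
instance : ContinuousSMul ℝ heis where
  continuous_smul :=
    (continuous_fst.smul (continuous_subtype_val.comp continuous_snd)).subtype_mk _

/-- Real linear endomorphisms of the Lie algebra (all of them are continuous), with the usual
topology of this finite-dimensional vector space. -/
abbrev EndHeis : Type := heis →L[ℝ] heis

/-- The standard complex structure: multiplication by `i`. -/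
def J₀ : EndHeis where
  toFun A := ⟨Complex.I • A.1, fun i j h => by
    have h0 : A.1 i j = 0 := A.2 i j h
    simp [h0]⟩
  map_add' A B := by
    apply Subtype.ext
    exact smul_add _ _ _
  map_smul' c A := by
    apply Subtype.ext
    exact smul_comm _ _ _
  cont := (continuous_subtype_val.const_smul Complex.I).subtype_mk _

/-! The real coframe is determined by `ω¹ = dz₁ = e¹ + i e²`, `ω² = dz₂ = e³ + i e⁴`,
`ω³ = -dz₃ + z₁ dz₂ = e⁵ + i e⁶`, evaluated at the identity, where the coordinates are
`z₁ = A 0 1`, `z₂ = A 1 2`, `z₃ = A 0 2`. -/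

/-- The left-invariant real 1-forms `e¹, …, e⁶`. -/
def coframe (A : heis) : Fin 6 → ℝ :=
  ![(A.1 0 1).re, (A.1 0 1).im, (A.1 1 2).re, (A.1 1 2).im, (-A.1 0 2).re, (-A.1 0 2).im]

/-- The inner product `g = ∑ eⁱ ⊗ eⁱ`. -/
def metric (A B : heis) : ℝ := ∑ i, coframe A i * coframe B i

/-- `J` is `g`-orthogonal. -/
def IsOrthogonal (J : EndHeis) : Prop := ∀ A B, metric (J A) (J B) = metric A B

/-- `J` is an almost complex structure on the Lie algebra. -/
def IsAlmostComplex (J : EndHeis) : Prop := ∀ A, J (J A) = -A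

/-- Integrability (vanishing of the Nijenhuis tensor). -/
def IsIntegrable (J : EndHeis) : Prop :=
  ∀ A B, ⁅J A, J B⁆ = ⁅A, B⁆ + J ⁅J A, B⁆ + J ⁅A, J B⁆

section Orientation

variable {V : Type*} [AddCommGroup V] [Module ℝ V]

/-- A real basis of the form `(v₁, J v₁, …, vₙ, J vₙ)` (with the lexicographic order of the
indices). All such bases define the same orientation, the one induced by the complex
structure `J`. -/
def IsAdapted {n : ℕ} (J : V →ₗ[ℝ] V) (b : Module.Basis (Fin n × Fin 2) ℝ V) : Prop :=
  ∀ k, b (k, 1) = J (b (k, 0))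

/-- The complex structures `J`, `K` on a space of real dimension `2 n` induce the same
orientation. -/
def SameOrientation (n : ℕ) (J K : V →ₗ[ℝ] V) : Prop :=
  ∃ b c : Module.Basis (Fin n × Fin 2) ℝ V,
    IsAdapted J b ∧ IsAdapted K c ∧ b.orientation = c.orientation

/-- The complex structures `J`, `K` on a space of real dimension `2 n` induce opposite
orientations. -/
def OppositeOrientation (n : ℕ) (J K : V →ₗ[ℝ] V) : Prop :=
  ∃ b c : Module.Basis (Fin n × Fin 2) ℝ V,
    IsAdapted J b ∧ IsAdapted K c ∧ b.orientation = -c.orientation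

end Orientation

/-- `𝔻 = ker (d : 𝔤* → ⋀² 𝔤*)`, where `dα (A, B) = -α ⁅A, B⁆`. -/
def closedForms : Submodule ℝ (Module.Dual ℝ heis) where
  carrier := {α | ∀ A B : heis, α ⁅A, B⁆ = 0}
  add_mem' := by
    intro α β hα hβ A B
    simp [hα A B, hβ A B]
  zero_mem' := by
    intro A B
    rfl
  smul_mem' := by
    intro c α hα A B
    simp [hα A B]

/-- `K` is the endomorphism `Ĵ` of `𝔻` obtained by restricting the action `α ↦ α ∘ J` on `𝔤*`;
it exists if and only if `𝔻` is `J`-invariant, and is then unique. (The opposite sign convention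
for the action of `J` on 1-forms yields the same orientation of the 4-dimensional space `𝔻`.) -/
def IsHat (J : EndHeis) (K : closedForms →ₗ[ℝ] closedForms) : Prop :=
  ∀ (α : closedForms) (A : heis), (K α).1 A = α.1 (J A)

/-- `Ĵ` exists and induces the same orientation of `𝔻` as `Ĵ₀`. -/
def HatPositive (J : EndHeis) : Prop :=
  ∃ K K₀ : closedForms →ₗ[ℝ] closedForms, IsHat J K ∧ IsHat J₀ K₀ ∧ SameOrientation (V := closedForms) 2 K K₀

/-- `Ĵ` exists and induces the orientation of `𝔻` opposite to that of `Ĵ₀`. -/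
def HatNegative (J : EndHeis) : Prop :=
  ∃ K K₀ : closedForms →ₗ[ℝ] closedForms, IsHat J K ∧ IsHat J₀ K₀ ∧ OppositeOrientation (V := closedForms) 2 K K₀

/-- `𝒞⁺(𝔤)`: (integrable) left-invariant complex structures inducing the same orientation as
`J₀`. -/
def complexStructures : Set EndHeis :=
  {J | IsAlmostComplex J ∧ IsIntegrable J ∧ SameOrientation 3 (J : heis →ₗ[ℝ] heis) J₀}

/-- `𝒞⁺(𝔤, g)`: the `g`-orthogonal elements of `𝒞⁺(𝔤)`. -/
def orthogonalStructures : Set EndHeis := {J | J ∈ complexStructures ∧ IsOrthogonal J}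

/-- `𝒞₊`. -/
def cPlus : Set EndHeis := {J | J ∈ complexStructures ∧ HatPositive J}

/-- `𝒞₋`. -/
def cMinus : Set EndHeis := {J | J ∈ complexStructures ∧ HatNegative J}

/-- All positively oriented `g`-orthogonal almost complex structures `J` (no integrability is
required) such that `Ĵ` is negatively oriented. -/
def negativeOrthogonal : Set EndHeis :=
  {J | IsAlmostComplex J ∧ SameOrientation 3 (J : heis →ₗ[ℝ] heis) J₀ ∧ IsOrthogonal J ∧
    HatNegative J}

/-- The unit sphere in `ℝ³`. -/
abbrev TwoSphere : Type := Metric.sphere (0 : EuclideanSpace ℝ (Fin 3)) 1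

end Iwasawa

end

/-!
The Lie algebra is `ℂ² × ℂ` with bracket the complex area form of the quotient `ℂ²` by the centre
`ℂ`. An integrable `J` preserves the centre, because the bracket with a vector outside the centre is
onto the centre. So `J` is block triangular: it induces a complex structure `a` on the quotient, a
complex structure `c` on the centre, and has an off-diagonal block `r`; integrability (`IntPair`)
involves only `a` and `c`.

Two real invariants decide everything: the complex-linear part of `c` is `i x` with `|x| ≥ 1`, and
the complex-linear part `L` of `a` has trace `2 i ξ`. The `(2,0)`-part of the integrability
condition gives `det L = 1 - 2 x ξ` (`IntPair.detC_eq_real`). The sign of `x` is the orientation of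
`c`, and the sign of `x ξ` is the orientation of `a`, where `x ξ = 0` counts as negative
(`IntPair.orientation`). Hence positive total orientation leaves the two families `x > 0`, `ξ > 0`
and `x < 0`, `ξ ≥ 0`, which are `cPlus` and `cMinus`. As `x` never vanishes, they are separated.

After scaling `r` to zero, both families are deformed by Cayley transforms. A complex structure `J`
for which `J + K` and `1 + μ` are invertible is `(1 + μ) K (1 + μ)⁻¹` for a unique `μ` anticommuting
with `K`, and `t μ`, for `0 ≤ t ≤ 1`, gives a path from `K` to `J`. This path exists as soon as
`(1 + t) K + (1 - t) J` is invertible for all such `t`, which `isUnit_interpolate` derives from a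
quadratic equation satisfied by `K J + J K`; on the quotient, this comes from the Cayley-Hamilton
equation of `L`.

* For `cPlus`, one takes `K = i` on both factors. With Cayley transforms `μ` of `a` and `ν` of `c`,
  integrability says that the area form satisfies `area (μ u) (μ v) = ν (area u v)`, so it survives
  the scaling `(t μ, t² ν)`, which contracts `cPlus` to `J₀` (`IntPair.cayley_iPlane`).
* For `cMinus`, one takes for `K` the normalized trace-free part of `L`. As `K` preserves the area
  form infinitesimally, integrability is linear in `μ` (`IntPair.cayley_of_trace_zero`), so it
  survives the scaling. This deforms `cMinus` to the pairs `(a, c)` with `a` complex linear and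
  trace free, for which integrability is automatic. Finally the self-adjoint part of `a` is scaled
  away and `c` is moved to `-i`. What remains are the trace-free skew-Hermitian `a` with `a² = -1`,
  which form a two-sphere (`unitaryBlocksHomeomorph`).

On the orthogonal side, `r = 0`, `c = ± i`, and the orthogonal complex structures of `ℂ² = ℝ⁴` form
two spheres (`isometry_cases`). The negatively oriented sphere is the one above; on the other sphere
integrability with `c = i` leaves only `a = i`.
-/

noncomputable section

namespace Iwasawa

/-! ### Deformations, disjoint unions and connected components -/

section Topology

open Set Topology

/-- A set `X` that is deformed within itself into a subset `Y`, whose points end up where they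
started, is homotopy equivalent to `Y`. -/
theorem homotopyEquiv_of_deformation {E : Type*} [TopologicalSpace E] {X Y : Set E} (hYX : Y ⊆ X)
    (H : ℝ × E → E) (hH : ContinuousOn H (Icc 0 1 ×ˢ X))
    (hX : ∀ t ∈ Icc (0 : ℝ) 1, ∀ x ∈ X, H (t, x) ∈ X) (h1 : ∀ x ∈ X, H (1, x) = x)
    (h0 : ∀ x ∈ X, H (0, x) ∈ Y) (hY : ∀ y ∈ Y, H (0, y) = y) : Nonempty (X ≃ₕ Y) := by
  have hc : Continuous fun p : unitInterval × X => H (p.1, p.2) :=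
    hH.comp_continuous (by fun_prop) fun p => ⟨p.1.2, p.2.2⟩
  have hr : Continuous fun x : X => H (0, x) :=
    hc.comp (Continuous.prodMk (continuous_const (y := (0 : unitInterval))) continuous_id)
  refine ⟨⟨⟨fun x => ⟨H (0, x), h0 x x.2⟩, hr.subtype_mk _⟩,
    ⟨inclusion hYX, continuous_inclusion hYX⟩, ⟨⟨⟨fun p => ⟨H (p.1, p.2), hX _ p.1.2 _ p.2.2⟩,
      hc.subtype_mk _⟩, fun x => rfl, fun x => Subtype.ext (h1 x x.2)⟩⟩, ?_⟩⟩
  convert ContinuousMap.Homotopic.refl (ContinuousMap.id Y) using 1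
  ext y
  exact hY y y.2

/-- Homotopies on the two summands give a homotopy on the disjoint union. -/
theorem homotopic_sum {X X' : Type*} [TopologicalSpace X] [TopologicalSpace X']
    {f f' : C(X, X)} {g g' : C(X', X')} (hf : f.Homotopic f') (hg : g.Homotopic g')
    {h h' : C(X ⊕ X', X ⊕ X')} (hl : ∀ x, h (Sum.inl x) = Sum.inl (f x))
    (hr : ∀ x, h (Sum.inr x) = Sum.inr (g x)) (hl' : ∀ x, h' (Sum.inl x) = Sum.inl (f' x))
    (hr' : ∀ x, h' (Sum.inr x) = Sum.inr (g' x)) : h.Homotopic h' := by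
  obtain ⟨F⟩ := hf
  obtain ⟨G⟩ := hg
  refine ⟨⟨⟨fun p => Sum.map F G (Homeomorph.prodSumDistrib p), ?_⟩, ?_, ?_⟩⟩
  · exact (F.continuous.sumMap G.continuous).comp (Homeomorph.continuous _)
  · rintro (x | x)
    · exact (congrArg Sum.inl (F.map_zero_left x)).trans (hl x).symm
    · exact (congrArg Sum.inr (G.map_zero_left x)).trans (hr x).symm
  · rintro (x | x)
    · exact (congrArg Sum.inl (F.map_one_left x)).trans (hl' x).symm
    · exact (congrArg Sum.inr (G.map_one_left x)).trans (hr' x).symm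

/-- The disjoint union of two homotopy equivalences. -/
def sumHomotopyEquiv {X Y X' Y' : Type*} [TopologicalSpace X] [TopologicalSpace Y]
    [TopologicalSpace X'] [TopologicalSpace Y'] (e : X ≃ₕ Y) (e' : X' ≃ₕ Y') :
    X ⊕ X' ≃ₕ Y ⊕ Y' where
  toFun := ⟨Sum.map e e', e.continuous.sumMap e'.continuous⟩
  invFun := ⟨Sum.map e.symm e'.symm, e.symm.continuous.sumMap e'.symm.continuous⟩
  left_inv := homotopic_sum e.left_inv e'.left_inv (fun _ => rfl) (fun _ => rfl) (fun _ => rfl)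
    (fun _ => rfl)
  right_inv := homotopic_sum e.right_inv e'.right_inv (fun _ => rfl) (fun _ => rfl)
    (fun _ => rfl) (fun _ => rfl)

/-- Two sets on which a continuous function is positive and negative, respectively, are
topologically disjoint. -/
theorem nonempty_homeomorph_sum {E : Type*} [TopologicalSpace E] {A B : Set E} (f : E → ℝ)
    (hf : Continuous f) (hA : ∀ x ∈ A, 0 < f x) (hB : ∀ x ∈ B, f x < 0) :
    Nonempty (A ⊕ B ≃ₜ (A ∪ B : Set E)) := by
  let g : A ⊕ B → (A ∪ B : Set E) :=
    Sum.elim (inclusion subset_union_left) (inclusion subset_union_right)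
  have hg : Continuous g := (continuous_inclusion _).sumElim (continuous_inclusion _)
  have hbij : Function.Bijective g := by
    constructor
    · rintro (x | x) (y | y) h
      · exact congrArg Sum.inl (inclusion_injective subset_union_left h)
      · have h' : (x : E) = y := congrArg Subtype.val h
        exact absurd (hB y y.2) (h' ▸ (hA x x.2).not_gt)
      · have h' : (x : E) = y := congrArg Subtype.val h
        exact absurd (hB x x.2) (h' ▸ (hA y y.2).not_gt)
      · exact congrArg Sum.inr (inclusion_injective subset_union_right h)
    · rintro ⟨x, hx | hx⟩
      · exact ⟨Sum.inl ⟨x, hx⟩, rfl⟩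
      · exact ⟨Sum.inr ⟨x, hx⟩, rfl⟩
  have hop : IsOpenMap g := by
    refine isOpenMap_sum.2 ⟨?_, ?_⟩
    · refine (IsOpenEmbedding.inclusion subset_union_left ?_).isOpenMap
      have : ((fun x : (A ∪ B : Set E) => (x : E)) ⁻¹' A) =
          (fun x : (A ∪ B : Set E) => f x) ⁻¹' Ioi 0 := by
        ext ⟨x, hx⟩
        exact ⟨fun h => hA x h, fun h => hx.resolve_right fun h' => (hB x h').not_gt h⟩
      refine this ▸ ?_
      exact isOpen_Ioi.preimage (hf.comp continuous_subtype_val)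
    · refine (IsOpenEmbedding.inclusion subset_union_right ?_).isOpenMap
      have : ((fun x : (A ∪ B : Set E) => (x : E)) ⁻¹' B) =
          (fun x : (A ∪ B : Set E) => f x) ⁻¹' Iio 0 := by
        ext ⟨x, hx⟩
        exact ⟨fun h => hB x h, fun h => hx.resolve_left fun h' => (hA x h').not_gt h⟩
      refine this ▸ ?_
      exact isOpen_Iio.preimage (hf.comp continuous_subtype_val)
  exact ⟨(Equiv.ofBijective g hbij).toHomeomorphOfContinuousOpen hg hop⟩

/-- Path connectedness is invariant under homotopy equivalence. -/
theorem pathConnectedSpace_of_homotopyEquiv {X Y : Type*} [TopologicalSpace X]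
    [TopologicalSpace Y] (e : X ≃ₕ Y) [PathConnectedSpace Y] : PathConnectedSpace X := by
  obtain ⟨F⟩ := e.left_inv
  have hj : ∀ x, Joined (e.symm (e x)) x := fun x =>
    ⟨⟨⟨fun t => F (t, x), by fun_prop⟩, F.map_zero_left x, F.map_one_left x⟩⟩
  refine ⟨⟨e.symm (Classical.arbitrary Y)⟩, fun x y => ?_⟩
  refine ((hj x).symm.trans ?_).trans (hj y)
  exact (PathConnectedSpace.joined (e x) (e y)).map e.symm.continuous

/-- If a continuous function is positive on the connected set `A` and negative on `B`, then `A` is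
a connected component of `A ∪ B`. -/
theorem connectedComponentIn_union {E : Type*} [TopologicalSpace E] {A B : Set E} (f : E → ℝ)
    (hf : Continuous f) (hA : ∀ x ∈ A, 0 < f x) (hB : ∀ x ∈ B, f x < 0)
    (hc : IsPreconnected A) {x : E} (hx : x ∈ A) : connectedComponentIn (A ∪ B) x = A := by
  refine Subset.antisymm (fun y hy => ?_) (hc.subset_connectedComponentIn hx subset_union_left)
  have h := isPreconnected_connectedComponentIn.subset_left_of_subset_union
    (u := f ⁻¹' Ioi 0) (v := f ⁻¹' Iio 0) (isOpen_Ioi.preimage hf)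
    (isOpen_Iio.preimage hf) ?_ ?_ ⟨x, mem_connectedComponentIn (Or.inl hx), hA x hx⟩ hy
  · exact (connectedComponentIn_subset _ _ hy).resolve_right fun h' => (hB y h').not_gt h
  · exact Set.disjoint_left.2 fun z h1 h2 =>
      lt_asymm (mem_Ioi.1 (mem_preimage.1 h1)) (mem_Iio.1 (mem_preimage.1 h2))
  · exact (connectedComponentIn_subset _ _).trans
      (union_subset_union (fun z hz => hA z hz) fun z hz => hB z hz)

end Topology

/-! ### Relative orientation of complex structures -/

section RelativeOrientation

variable {E F : Type*} [AddCommGroup E] [Module ℝ E] [AddCommGroup F] [Module ℝ F]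

/-- The complex structures `J` and `K` are conjugate under a linear automorphism of positive
determinant. -/
def SameOr (J K : E →ₗ[ℝ] E) : Prop :=
  ∃ φ : E ≃ₗ[ℝ] E, (∀ v, φ (J v) = K (φ v)) ∧ 0 < LinearMap.det (φ : E →ₗ[ℝ] E)

/-- The complex structures `J` and `K` are conjugate under a linear automorphism of negative
determinant. -/
def OppOr (J K : E →ₗ[ℝ] E) : Prop :=
  ∃ φ : E ≃ₗ[ℝ] E, (∀ v, φ (J v) = K (φ v)) ∧ LinearMap.det (φ : E →ₗ[ℝ] E) < 0

theorem SameOr.refl (J : E →ₗ[ℝ] E) : SameOr J J :=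
  ⟨LinearEquiv.refl ℝ E, fun _ => rfl, by simp⟩

theorem det_symm_mul_det (φ : E ≃ₗ[ℝ] E) :
    LinearMap.det (φ.symm : E →ₗ[ℝ] E) * LinearMap.det (φ : E →ₗ[ℝ] E) = 1 := by
  rw [← LinearMap.det_comp]; simp

theorem SameOr.symm {J K : E →ₗ[ℝ] E} : SameOr J K → SameOr K J := by
  rintro ⟨φ, h, hd⟩
  refine ⟨φ.symm, fun v => ?_, ?_⟩
  · rw [LinearEquiv.symm_apply_eq, h, LinearEquiv.apply_symm_apply]
  · have := det_symm_mul_det φ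
    exact pos_of_mul_pos_left (by rw [this]; norm_num) hd.le

theorem OppOr.symm {J K : E →ₗ[ℝ] E} : OppOr J K → OppOr K J := by
  rintro ⟨φ, h, hd⟩
  refine ⟨φ.symm, fun v => ?_, ?_⟩
  · rw [LinearEquiv.symm_apply_eq, h, LinearEquiv.apply_symm_apply]
  · have := det_symm_mul_det φ
    by_contra h0
    nlinarith [not_lt.1 h0]

theorem det_trans (φ ψ : E ≃ₗ[ℝ] E) : LinearMap.det ((φ.trans ψ : E ≃ₗ[ℝ] E) : E →ₗ[ℝ] E) =
    LinearMap.det (ψ : E →ₗ[ℝ] E) * LinearMap.det (φ : E →ₗ[ℝ] E) := by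
  rw [← LinearMap.det_comp]; rfl

theorem SameOr.trans {J K L : E →ₗ[ℝ] E} : SameOr J K → SameOr K L → SameOr J L := by
  rintro ⟨φ, h, hd⟩ ⟨ψ, h', hd'⟩
  exact ⟨φ.trans ψ, fun v => by simp [h, h'], by rw [det_trans]; exact mul_pos hd' hd⟩

theorem SameOr.trans_opp {J K L : E →ₗ[ℝ] E} : SameOr J K → OppOr K L → OppOr J L := by
  rintro ⟨φ, h, hd⟩ ⟨ψ, h', hd'⟩
  exact ⟨φ.trans ψ, fun v => by simp [h, h'], by
    rw [det_trans]; exact mul_neg_of_neg_of_pos hd' hd⟩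

theorem OppOr.trans {J K L : E →ₗ[ℝ] E} : OppOr J K → OppOr K L → SameOr J L := by
  rintro ⟨φ, h, hd⟩ ⟨ψ, h', hd'⟩
  exact ⟨φ.trans ψ, fun v => by simp [h, h'], by
    rw [det_trans]; exact mul_pos_of_neg_of_neg hd' hd⟩

/-- The complex vector space structure on `E` in which `i` acts as `J`. -/
abbrev complexModule (J : E →ₗ[ℝ] E) (hJ : ∀ v, J (J v) = -v) : Module ℂ E :=
  Module.compHom E (Complex.lift ⟨(J : Module.End ℝ E), by ext v; simpa using hJ v⟩ :
    ℂ →ₐ[ℝ] Module.End ℝ E).toRingHom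

theorem complexModule_smul (J : E →ₗ[ℝ] E) (hJ : ∀ v, J (J v) = -v) (z : ℂ) (v : E) :
    letI := complexModule J hJ
    z • v = z.re • v + z.im • J v := by
  change (Complex.lift ⟨(J : Module.End ℝ E), _⟩ : ℂ →ₐ[ℝ] Module.End ℝ E) z v = _
  rw [Complex.lift_apply, Complex.liftAux_apply]
  simp [Algebra.algebraMap_eq_smul_one]

theorem complexModule_isScalarTower (J : E →ₗ[ℝ] E) (hJ : ∀ v, J (J v) = -v) :
    letI := complexModule J hJ
    IsScalarTower ℝ ℂ E := by
  let := complexModule J hJ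
  refine ⟨fun x z v => ?_⟩
  rw [complexModule_smul, complexModule_smul]
  simp [smul_add, smul_smul]

/-- An automorphism commuting with a complex structure preserves orientation: its determinant is
the squared modulus of its complex determinant. -/
theorem det_pos_of_commute (J : E →ₗ[ℝ] E) (hJ : ∀ v, J (J v) = -v)
    (φ : E ≃ₗ[ℝ] E) (h : ∀ v, φ (J v) = J (φ v)) : 0 < LinearMap.det (φ : E →ₗ[ℝ] E) := by
  let := complexModule J hJ
  have := complexModule_isScalarTower J hJ
  let ψ : E →ₗ[ℂ] E :=
    { toFun := φ
      map_add' := φ.map_add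
      map_smul' := fun z v => by
        simp only [complexModule_smul, RingHom.id_apply, map_add, map_smul, h] }
  have h1 : (φ : E →ₗ[ℝ] E) = ψ.restrictScalars ℝ := rfl
  have h2 : LinearMap.det (φ : E →ₗ[ℝ] E) ≠ 0 := (LinearEquiv.isUnit_det' φ).ne_zero
  have h3 : LinearMap.det (φ : E →ₗ[ℝ] E) = Complex.normSq (LinearMap.det ψ) := by
    rw [h1, LinearMap.det_restrictScalars, Algebra.norm_complex_apply]
  exact lt_of_le_of_ne (by rw [h3]; exact Complex.normSq_nonneg _) (Ne.symm h2)

/-- The sign of the determinant of a conjugation is well defined. -/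
theorem SameOr.not_oppOr {J K : E →ₗ[ℝ] E} (hJ : ∀ v, J (J v) = -v) (h : SameOr J K) :
    ¬ OppOr J K := by
  intro h'
  obtain ⟨φ, hφ, hd⟩ := h.trans_opp h'.symm
  exact (det_pos_of_commute J hJ φ hφ).not_gt hd

theorem exists_isAdapted [FiniteDimensional ℝ E] {n : ℕ} (hn : Module.finrank ℝ E = n * 2)
    (J : E →ₗ[ℝ] E) (hJ : ∀ v, J (J v) = -v) :
    ∃ b : Module.Basis (Fin n × Fin 2) ℝ E, IsAdapted J b := by
  let := complexModule J hJ
  have := complexModule_isScalarTower J hJ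
  have : Module.Finite ℂ E := Module.Finite.of_restrictScalars_finite ℝ ℂ E
  have hc : Module.finrank ℂ E = n := by
    have := Module.finrank_mul_finrank ℝ ℂ E
    rw [Complex.finrank_real_complex] at this
    omega
  let c : Module.Basis (Fin n) ℂ E := Module.finBasisOfFinrankEq ℂ E hc
  refine ⟨Complex.basisOneI.smulTower' c, fun k => ?_⟩
  rw [Module.Basis.smulTower'_apply, Module.Basis.smulTower'_apply]
  simp [complexModule_smul]

theorem IsAdapted.apply_one {n : ℕ} {J : E →ₗ[ℝ] E} (hJ : ∀ v, J (J v) = -v)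
    {b : Module.Basis (Fin n × Fin 2) ℝ E} (hb : IsAdapted J b) (k : Fin n) :
    J (b (k, 1)) = - b (k, 0) := by
  rw [hb k, hJ]

theorem IsAdapted.intertwine {n : ℕ} {J K : E →ₗ[ℝ] E} (hJ : ∀ v, J (J v) = -v)
    (hK : ∀ v, K (K v) = -v) {b c : Module.Basis (Fin n × Fin 2) ℝ E} (hb : IsAdapted J b)
    (hc : IsAdapted K c) (v : E) :
    b.equiv c (Equiv.refl _) (J v) = K (b.equiv c (Equiv.refl _) v) := by
  let φ := b.equiv c (Equiv.refl _)
  suffices h : (φ : E →ₗ[ℝ] E) ∘ₗ J = K ∘ₗ (φ : E →ₗ[ℝ] E) from LinearMap.congr_fun h v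
  refine b.ext fun ⟨k, i⟩ => ?_
  have hφ : ∀ j, φ (b j) = c j := fun j => by simp [φ]
  fin_cases i
  · simpa [hφ, ← hb k] using hc k
  · simp [hφ, hb.apply_one hJ, hc.apply_one hK]

theorem map_equiv_refl {n : ℕ} (b c : Module.Basis (Fin n × Fin 2) ℝ E) :
    b.map (b.equiv c (Equiv.refl _)) = c := by
  ext j; simp

theorem sameOrientation_iff [FiniteDimensional ℝ E] {n : ℕ} (hn : Module.finrank ℝ E = n * 2)
    {J K : E →ₗ[ℝ] E} (hJ : ∀ v, J (J v) = -v) (hK : ∀ v, K (K v) = -v) :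
    SameOrientation n J K ↔ SameOr J K := by
  constructor
  · rintro ⟨b, c, hb, hc, h⟩
    refine ⟨b.equiv c (Equiv.refl _), hb.intertwine hJ hK hc, ?_⟩
    rw [← b.orientation_comp_linearEquiv_eq_iff_det_pos, map_equiv_refl, h]
  · rintro ⟨φ, h, hd⟩
    obtain ⟨b, hb⟩ := exists_isAdapted hn J hJ
    refine ⟨b, b.map φ, hb, fun k => ?_, ?_⟩
    · simp [hb k, h]
    · exact ((b.orientation_comp_linearEquiv_eq_iff_det_pos φ).2 hd).symm

theorem oppositeOrientation_iff [FiniteDimensional ℝ E] {n : ℕ}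
    (hn : Module.finrank ℝ E = n * 2)
    {J K : E →ₗ[ℝ] E} (hJ : ∀ v, J (J v) = -v) (hK : ∀ v, K (K v) = -v) :
    OppositeOrientation n J K ↔ OppOr J K := by
  constructor
  · rintro ⟨b, c, hb, hc, h⟩
    refine ⟨b.equiv c (Equiv.refl _), hb.intertwine hJ hK hc, ?_⟩
    rw [← b.orientation_comp_linearEquiv_eq_neg_iff_det_neg, map_equiv_refl, h]
    exact (neg_neg c.orientation).symm
  · rintro ⟨φ, h, hd⟩
    obtain ⟨b, hb⟩ := exists_isAdapted hn J hJ
    refine ⟨b, b.map φ, hb, fun k => ?_, ?_⟩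
    · simp [hb k, h]
    · rw [(b.orientation_comp_linearEquiv_eq_neg_iff_det_neg φ).2 hd]
      exact (neg_neg b.orientation).symm

/-- Any two complex structures are conjugate; the conjugation has a nonzero determinant. -/
theorem sameOr_or_oppOr [FiniteDimensional ℝ E] {n : ℕ} (hn : Module.finrank ℝ E = n * 2)
    {J K : E →ₗ[ℝ] E} (hJ : ∀ v, J (J v) = -v) (hK : ∀ v, K (K v) = -v) :
    SameOr J K ∨ OppOr J K := by
  obtain ⟨b, hb⟩ := exists_isAdapted hn J hJ
  obtain ⟨c, hc⟩ := exists_isAdapted hn K hK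
  rcases (LinearEquiv.isUnit_det' (b.equiv c (Equiv.refl _))).ne_zero.lt_or_gt with h | h
  · exact Or.inr ⟨_, hb.intertwine hJ hK hc, h⟩
  · exact Or.inl ⟨_, hb.intertwine hJ hK hc, h⟩

theorem trace_eq_zero [FiniteDimensional ℝ E] {n : ℕ} (hn : Module.finrank ℝ E = n * 2)
    (J : E →ₗ[ℝ] E) (hJ : ∀ v, J (J v) = -v) : LinearMap.trace ℝ E J = 0 := by
  obtain ⟨b, hb⟩ := exists_isAdapted hn J hJ
  rw [LinearMap.trace_eq_matrix_trace ℝ b, Matrix.trace]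
  refine Finset.sum_eq_zero fun ⟨k, i⟩ _ => ?_
  rw [Matrix.diag_apply, LinearMap.toMatrix_apply]
  fin_cases i
  · simp [← hb k]
  · simp [hb.apply_one hJ]

theorem SameOr.map (e : E ≃ₗ[ℝ] F) {J K : E →ₗ[ℝ] E} {J' K' : F →ₗ[ℝ] F}
    (hJ : ∀ v, e (J v) = J' (e v)) (hK : ∀ v, e (K v) = K' (e v)) (h : SameOr J K) :
    SameOr J' K' := by
  obtain ⟨φ, hφ, hd⟩ := h
  refine ⟨(e.symm.trans φ).trans e, fun v => ?_, ?_⟩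
  · obtain ⟨v, rfl⟩ := e.surjective v
    simp [← hJ, ← hK, hφ]
  · rwa [← LinearMap.det_conj _ e] at hd

theorem OppOr.map (e : E ≃ₗ[ℝ] F) {J K : E →ₗ[ℝ] E} {J' K' : F →ₗ[ℝ] F}
    (hJ : ∀ v, e (J v) = J' (e v)) (hK : ∀ v, e (K v) = K' (e v)) (h : OppOr J K) :
    OppOr J' K' := by
  obtain ⟨φ, hφ, hd⟩ := h
  refine ⟨(e.symm.trans φ).trans e, fun v => ?_, ?_⟩
  · obtain ⟨v, rfl⟩ := e.surjective v
    simp [← hJ, ← hK, hφ]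
  · rwa [← LinearMap.det_conj _ e] at hd

theorem SameOr.dualMap [FiniteDimensional ℝ E] {J K : E →ₗ[ℝ] E} (h : SameOr J K) :
    SameOr J.dualMap K.dualMap := by
  obtain ⟨φ, hφ, hd⟩ := h.symm
  refine ⟨φ.dualMap, fun α => ?_, ?_⟩
  · ext v; simp [hφ]
  · rwa [← LinearMap.det_dualMap] at hd

theorem OppOr.dualMap [FiniteDimensional ℝ E] {J K : E →ₗ[ℝ] E} (h : OppOr J K) :
    OppOr J.dualMap K.dualMap := by
  obtain ⟨φ, hφ, hd⟩ := h.symm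
  refine ⟨φ.dualMap, fun α => ?_, ?_⟩
  · ext v; simp [hφ]
  · rwa [← LinearMap.det_dualMap] at hd

section Prod

variable [FiniteDimensional ℝ E] [FiniteDimensional ℝ F] {J K : E →ₗ[ℝ] E} {J' K' : F →ₗ[ℝ] F}

theorem det_prodCongr (φ : E ≃ₗ[ℝ] E) (ψ : F ≃ₗ[ℝ] F) :
    LinearMap.det ((φ.prodCongr ψ : (E × F) ≃ₗ[ℝ] (E × F)) : (E × F) →ₗ[ℝ] (E × F)) =
      LinearMap.det (φ : E →ₗ[ℝ] E) * LinearMap.det (ψ : F →ₗ[ℝ] F) := by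
  rw [← LinearMap.det_prodMap]; rfl

theorem SameOr.prodMap (h : SameOr J K) (h' : SameOr J' K') :
    SameOr (J.prodMap J') (K.prodMap K') := by
  obtain ⟨φ, hφ, hd⟩ := h
  obtain ⟨ψ, hψ, hd'⟩ := h'
  exact ⟨φ.prodCongr ψ, fun v => by simp [hφ, hψ], by rw [det_prodCongr]; exact mul_pos hd hd'⟩

theorem SameOr.prodMap_opp (h : SameOr J K) (h' : OppOr J' K') :
    OppOr (J.prodMap J') (K.prodMap K') := by
  obtain ⟨φ, hφ, hd⟩ := h
  obtain ⟨ψ, hψ, hd'⟩ := h'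
  exact ⟨φ.prodCongr ψ, fun v => by simp [hφ, hψ], by
    rw [det_prodCongr]; exact mul_neg_of_pos_of_neg hd hd'⟩

theorem OppOr.prodMap_same (h : OppOr J K) (h' : SameOr J' K') :
    OppOr (J.prodMap J') (K.prodMap K') := by
  obtain ⟨φ, hφ, hd⟩ := h
  obtain ⟨ψ, hψ, hd'⟩ := h'
  exact ⟨φ.prodCongr ψ, fun v => by simp [hφ, hψ], by
    rw [det_prodCongr]; exact mul_neg_of_neg_of_pos hd hd'⟩

theorem OppOr.prodMap (h : OppOr J K) (h' : OppOr J' K') :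
    SameOr (J.prodMap J') (K.prodMap K') := by
  obtain ⟨φ, hφ, hd⟩ := h
  obtain ⟨ψ, hψ, hd'⟩ := h'
  exact ⟨φ.prodCongr ψ, fun v => by simp [hφ, hψ], by
    rw [det_prodCongr]; exact mul_pos_of_neg_of_neg hd hd'⟩

end Prod

end RelativeOrientation

/-! ### Orientation is constant along paths -/

section Paths

variable {E : Type*} [NormedAddCommGroup E] [NormedSpace ℝ E] [FiniteDimensional ℝ E]

/-- Near a complex structure `J`, the operator `1 - K J` is close to `2` and conjugates `J` into
`K`. -/
theorem eventually_sameOr (J : E →L[ℝ] E) (hJ : ∀ v, J (J v) = -v) :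
    ∀ᶠ K : E →L[ℝ] E in nhds J, (∀ v, K (K v) = -v) → SameOr (J : E →ₗ[ℝ] E) K := by
  let f : (E →L[ℝ] E) → ℝ := fun K => (1 - K.comp J).det
  have hf : Continuous f := ContinuousLinearMap.continuous_det.comp
    (continuous_const.sub (continuous_id.clm_comp continuous_const))
  have h1 : 0 < f J := by
    have : (1 - J.comp J : E →L[ℝ] E) = (2 : ℝ) • 1 := by
      ext v; simp [hJ, two_smul]
    simp only [f, this, ContinuousLinearMap.det]
    simp
  filter_upwards [hf.continuousAt.eventually (lt_mem_nhds h1)] with K hK hK2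
  refine ⟨LinearMap.equivOfDetNeZero (1 - K.comp J : E →L[ℝ] E).toLinearMap hK.ne',
    fun v => ?_, hK⟩
  change (1 - K.comp J) (J v) = K ((1 - K.comp J) v)
  simp [hJ, hK2]
  abel

/-- The orientation is constant on a connected set of complex structures. -/
theorem sameOr_of_isPreconnected {S : Set (E →L[ℝ] E)} (hS : IsPreconnected S)
    (h : ∀ J ∈ S, ∀ v, J (J v) = -v) {J K : E →L[ℝ] E} (hJ : J ∈ S) (hK : K ∈ S) :
    SameOr (J : E →ₗ[ℝ] E) K := by
  refine hS.induction₂ (fun J K => SameOr (J : E →ₗ[ℝ] E) K) ?_ ?_ ?_ hJ hK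
  · intro J hJ
    filter_upwards [mem_nhdsWithin_of_mem_nhds (eventually_sameOr J (h J hJ)),
      self_mem_nhdsWithin] with K hK hKS
    exact hK (h K hKS)
  · intro J K L _ _ _ h1 h2
    exact h1.trans h2
  · intro J K _ _ h1
    exact h1.symm

theorem sameOr_of_path {f : ℝ → (E →L[ℝ] E)} (hf : ContinuousOn f (Set.Icc 0 1))
    (h : ∀ t ∈ Set.Icc (0 : ℝ) 1, ∀ v, f t (f t v) = -v) {s t : ℝ}
    (hs : s ∈ Set.Icc (0 : ℝ) 1) (ht : t ∈ Set.Icc (0 : ℝ) 1) :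
    SameOr (f s : E →ₗ[ℝ] E) (f t) := by
  refine sameOr_of_isPreconnected (isPreconnected_Icc.image f hf) ?_ ⟨s, hs, rfl⟩ ⟨t, ht, rfl⟩
  rintro _ ⟨r, hr, rfl⟩
  exact h r hr

end Paths

/-! ### Cayley transforms of complex structures -/

section Cayley

variable {R : Type*} [NormedRing R]

/-- The Cayley transform of `J` with respect to `K`: the operator `μ`, anticommuting with `K`,
for which `J = (1 + μ) K (1 + μ)⁻¹`. -/
def cayley (K J : R) : R := Ring.inverse (J + K) * (K - J)

variable {K J : R}

theorem mul_cayley (h : IsUnit (J + K)) : (J + K) * cayley K J = K - J := by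
  rw [cayley, ← mul_assoc, Ring.mul_inverse_cancel _ h, one_mul]

theorem cayley_mul (hK : K * K = -1) (hJ : J * J = -1) (h : IsUnit (J + K)) :
    cayley K J * K = -(K * cayley K J) := by
  have h1 := mul_cayley h
  have h2 : (J + K) * (cayley K J * K + K * cayley K J) = 0 := by
    have h3 : (J + K) * K = J * (J + K) := by rw [add_mul, mul_add, hK, hJ, add_comm]
    rw [mul_add, ← mul_assoc, ← mul_assoc, h1, h3, mul_assoc, h1, sub_mul, mul_sub, hK, hJ]
    abel
  exact eq_neg_of_add_eq_zero_left ((h.mul_right_eq_zero).1 h2)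

theorem cayley_self (K : R) : cayley K K = 0 := by simp [cayley]

variable [NormedAlgebra ℝ R]

/-- The path `(1 + t μ) K (1 + t μ)⁻¹` from `K` to `J`, where `μ` is the Cayley transform. -/
def cayleyPath (K J : R) (t : ℝ) : R :=
  (1 + t • cayley K J) * K * Ring.inverse (1 + t • cayley K J)

theorem mul_one_add_cayley (hK : K * K = -1) (hJ : J * J = -1) (h : IsUnit (J + K)) :
    J * (1 + cayley K J) = (1 + cayley K J) * K := by
  have h1 := mul_cayley h
  refine h.mul_left_cancel ?_
  have h3 : (J + K) * J = K * (J + K) := by rw [add_mul, mul_add, hK, hJ, add_comm]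
  have h4 : (J + K) * (1 + cayley K J) = (2 : ℝ) • K := by
    rw [mul_add, mul_one, h1, two_smul]; abel
  rw [← mul_assoc, ← mul_assoc, h3, mul_assoc, h4]
  simp

theorem cayleyPath_self {t : ℝ} : cayleyPath K K t = K := by
  simp [cayleyPath, cayley_self]

theorem cayleyPath_zero : cayleyPath K J 0 = K := by simp [cayleyPath]

/-- If the symmetrised product `X = - (K J + J K) / 2` satisfies `X² = τ X - δ` with `0 < τ` and
`-1 < δ`, then the operators `(1 + t) K + (1 - t) J` are invertible for `0 ≤ t ≤ 1`. -/
theorem isUnit_interpolate (hK : K * K = -1) (hJ : J * J = -1) {X : R}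
    (hX : K * J + J * K = -((2 : ℝ) • X))
    {τ δ : ℝ} (hX2 : X * X = τ • X - δ • 1) (hτ : 0 < τ) (hδ : 0 < 1 + δ) {t : ℝ}
    (ht : t ∈ Set.Icc (0 : ℝ) 1) : IsUnit ((1 + t) • K + (1 - t) • J) := by
  obtain ⟨ht0, ht1⟩ := ht
  have h1 : ((1 + t) • K + (1 - t) • J) * ((1 + t) • K + (1 - t) • J) =
      (-2 : ℝ) • ((1 + t ^ 2) • (1 : R) + (1 - t ^ 2) • X) := by
    have : ((1 + t) • K + (1 - t) • J) * ((1 + t) • K + (1 - t) • J) =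
      (1 + t) ^ 2 • (K * K) + (1 - t) ^ 2 • (J * J) + (1 - t ^ 2) • (K * J + J * K) := by
      simp only [add_mul, mul_add, smul_mul_smul_comm, smul_add]
      module
    rw [this, hK, hJ, hX]
    module
  have hd : 0 < (1 + t ^ 2) ^ 2 + (1 + t ^ 2) * (1 - t ^ 2) * τ + (1 - t ^ 2) ^ 2 * δ := by
    have h2 : 0 ≤ 1 - t ^ 2 := by nlinarith
    have h3 : (1 + t ^ 2) ^ 2 = 4 * t ^ 2 + (1 - t ^ 2) ^ 2 := by ring
    rw [h3]
    rcases h2.eq_or_lt with h | h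
    · rw [← h]; nlinarith
    · have := mul_pos (mul_pos (by positivity : 0 < 1 + t ^ 2) h) hτ
      have := mul_pos (pow_pos h 2) hδ
      nlinarith [sq_nonneg t]
  have h2 : ((1 + t ^ 2) • (1 : R) + (1 - t ^ 2) • X) *
      ((1 + t ^ 2 + (1 - t ^ 2) * τ) • (1 : R) - (1 - t ^ 2) • X) =
      ((1 + t ^ 2) ^ 2 + (1 + t ^ 2) * (1 - t ^ 2) * τ + (1 - t ^ 2) ^ 2 * δ) • (1 : R) := by
    simp only [add_mul, mul_sub, smul_mul_smul_comm, one_mul, mul_one, hX2]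
    module
  have h3 : ((1 + t ^ 2 + (1 - t ^ 2) * τ) • (1 : R) - (1 - t ^ 2) • X) *
      ((1 + t ^ 2) • (1 : R) + (1 - t ^ 2) • X) =
      ((1 + t ^ 2) ^ 2 + (1 + t ^ 2) * (1 - t ^ 2) * τ + (1 - t ^ 2) ^ 2 * δ) • (1 : R) := by
    simp only [sub_mul, mul_add, smul_mul_smul_comm, one_mul, mul_one, hX2]
    module
  have hu : IsUnit ((1 + t ^ 2) • (1 : R) + (1 - t ^ 2) • X) := by
    refine ⟨⟨_, ((1 + t ^ 2) ^ 2 + (1 + t ^ 2) * (1 - t ^ 2) * τ + (1 - t ^ 2) ^ 2 * δ)⁻¹ •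
      ((1 + t ^ 2 + (1 - t ^ 2) * τ) • (1 : R) - (1 - t ^ 2) • X), ?_, ?_⟩, rfl⟩
    · rw [mul_smul_comm, h2, smul_smul, inv_mul_cancel₀ hd.ne', one_smul]
    · rw [smul_mul_assoc, h3, smul_smul, inv_mul_cancel₀ hd.ne', one_smul]
  refine (isUnit_pow_iff two_ne_zero).1 ?_
  rw [pow_two, h1]
  exact (hu.smul (Units.mk0 (-2 : ℝ) (by norm_num)))

theorem isUnit_one_add_smul_cayley
    (h : ∀ t ∈ Set.Icc (0 : ℝ) 1, IsUnit ((1 + t) • K + (1 - t) • J)) {t : ℝ}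
    (ht : t ∈ Set.Icc (0 : ℝ) 1) : IsUnit (1 + t • cayley K J) := by
  have h0 : IsUnit (J + K) := by
    have := h 0 ⟨le_rfl, zero_le_one⟩
    simpa [add_comm] using this
  have h1 : (J + K) * (1 + t • cayley K J) = (1 + t) • K + (1 - t) • J := by
    rw [mul_add, mul_smul_comm, mul_cayley h0, mul_one]
    module
  have h2 := h t ht
  rw [← h1] at h2
  exact (Units.isUnit_units_mul h0.unit _).1 h2

theorem cayleyPath_mul {t : ℝ} (h : IsUnit (1 + t • cayley K J)) :
    cayleyPath K J t * (1 + t • cayley K J) = (1 + t • cayley K J) * K := by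
  rw [cayleyPath, mul_assoc, Ring.inverse_mul_cancel _ h, mul_one]

theorem cayleyPath_sq (hK : K * K = -1) {t : ℝ} (h : IsUnit (1 + t • cayley K J)) :
    cayleyPath K J t * cayleyPath K J t = -1 := by
  refine h.mul_right_cancel ?_
  rw [mul_assoc, cayleyPath_mul h, ← mul_assoc, cayleyPath_mul h, mul_assoc, hK]
  simp

theorem cayleyPath_one (hK : K * K = -1) (hJ : J * J = -1) (h : IsUnit (J + K))
    (h' : IsUnit (1 + cayley K J)) : cayleyPath K J 1 = J := by
  rw [cayleyPath, one_smul, ← mul_one_add_cayley hK hJ h, mul_assoc,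
    Ring.mul_inverse_cancel _ h', mul_one]

/-- The Cayley path depends continuously on all its data. -/
theorem continuousOn_cayleyPath [CompleteSpace R] {Y : Type*} [TopologicalSpace Y] {S : Set Y}
    {k j : Y → R} {τ : Y → ℝ} (hk : ContinuousOn k S) (hj : ContinuousOn j S)
    (hτ : ContinuousOn τ S) (h1 : ∀ y ∈ S, IsUnit (j y + k y))
    (h2 : ∀ y ∈ S, IsUnit (1 + τ y • cayley (k y) (j y))) :
    ContinuousOn (fun y => cayleyPath (k y) (j y) (τ y)) S := by
  have hinv : ∀ {f : Y → R}, ContinuousOn f S → (∀ y ∈ S, IsUnit (f y)) →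
      ContinuousOn (fun y => Ring.inverse (f y)) S := by
    intro f hf hu y hy
    obtain ⟨u, hu⟩ := hu y hy
    refine ContinuousAt.comp_continuousWithinAt (f := f) (g := Ring.inverse) ?_ (hf y hy)
    rw [← hu]
    exact NormedRing.inverse_continuousAt u
  have hc : ContinuousOn (fun y => cayley (k y) (j y)) S :=
    (hinv (hj.add hk) h1).mul (hk.sub hj)
  have hφ : ContinuousOn (fun y => 1 + τ y • cayley (k y) (j y)) S :=
    continuousOn_const.add (hτ.smul hc)
  exact (hφ.mul hk).mul (hinv hφ h2)

end Cayley

/-! ### Complex structures on the quotient and on the centre, and integrability -/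

section Plane

/-- The complex plane `ℂ²`, which is the quotient of `heis` by its centre. -/
abbrev Plane : Type := ℂ × ℂ

/-- The normed algebra of endomorphisms of a real normed space. Going through a general normed
space pins down the instances used for `ℂ` and `ℂ²`. -/
abbrev Endo (E : Type) [NormedAddCommGroup E] [NormedSpace ℝ E] : Type := E →L[ℝ] E

/-- Real-linear endomorphisms of `ℂ²`. -/
abbrev EndPlane : Type := Endo Plane

/-- Real-linear endomorphisms of `ℂ`, the centre of `heis`. -/
abbrev EndLine : Type := Endo ℂ

/-- Multiplication by `i` on `ℂ²`. -/
def iPlane : EndPlane := Complex.I • (1 : EndPlane)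

/-- Multiplication by `i` on `ℂ`. -/
def iLine : EndLine := Complex.I • (1 : EndLine)

@[simp] theorem iPlane_apply (u : Plane) : iPlane u = (Complex.I * u.1, Complex.I * u.2) := rfl

@[simp] theorem iLine_apply (w : ℂ) : iLine w = Complex.I * w := rfl

theorem iPlane_sq : iPlane * iPlane = -1 := by
  refine ContinuousLinearMap.ext fun u => ?_
  simp [← mul_assoc, Prod.ext_iff]

theorem iLine_sq : iLine * iLine = -1 := by
  refine ContinuousLinearMap.ext fun u => ?_
  simp [← mul_assoc]

/-- The determinant form on `ℂ²`, which is the bracket of `heis` modulo the centre. -/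
def area (u v : Plane) : ℂ := u.1 * v.2 - v.1 * u.2

/-- The integrability condition for the complex structures induced on the quotient by the centre
and on the centre. -/
def IntPair (a : EndPlane) (c : EndLine) : Prop :=
  ∀ u v, area (a u) (a v) = area u v + c (area (a u) v) + c (area u (a v))

/-- The complex-linear part of a real-linear endomorphism. -/
def linPart (a : EndPlane) : EndPlane := (1 / 2 : ℝ) • (a - iPlane * a * iPlane)

/-- The complex trace of the complex-linear part. -/
def trC (a : EndPlane) : ℂ := (linPart a (1, 0)).1 + (linPart a (0, 1)).2

/-- The complex determinant of the complex-linear part. -/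
def detC (a : EndPlane) : ℂ := area (linPart a (1, 0)) (linPart a (0, 1))

/-- The complex trace of the complex-linear part of `c`, an endomorphism of a complex line. -/
def trLine (c : EndLine) : ℂ := (c 1 - Complex.I * c Complex.I) / 2

theorem coeffs_line (c : EndLine) :
    ∃ α β : ℂ, trLine c = α ∧ ∀ w, c w = α * w + β * (starRingEnd ℂ) w := by
  refine ⟨_, (c 1 + Complex.I * c Complex.I) / 2, rfl, fun w => ?_⟩
  obtain ⟨x, y, rfl⟩ : ∃ x y : ℝ, w = x + y * Complex.I := ⟨w.re, w.im, by simp⟩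
  have h : (x + y * Complex.I : ℂ) = x • (1 : ℂ) + y • Complex.I := by simp
  have h1 : (starRingEnd ℂ) (x + y * Complex.I) = x - y * Complex.I := by
    apply Complex.ext <;> simp
  conv_lhs => rw [h]
  rw [map_add, map_smul, map_smul, trLine, h1, Complex.real_smul, Complex.real_smul]
  linear_combination ((y : ℂ) * c Complex.I) * Complex.I_sq

theorem coeffs_plane (a : EndPlane) : ∃ a₁₁ a₁₂ a₂₁ a₂₂ b₁₁ b₁₂ b₂₁ b₂₂ : ℂ,
    ∀ u : Plane, a u =
      (a₁₁ * u.1 + a₁₂ * u.2 + b₁₁ * (starRingEnd ℂ) u.1 + b₁₂ * (starRingEnd ℂ) u.2,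
       a₂₁ * u.1 + a₂₂ * u.2 + b₂₁ * (starRingEnd ℂ) u.1 + b₂₂ * (starRingEnd ℂ) u.2) := by
  let f : (i j : Fin 2) → EndLine := fun i j =>
    (![ContinuousLinearMap.fst ℝ ℂ ℂ, ContinuousLinearMap.snd ℝ ℂ ℂ] i).comp
      (a.comp (![ContinuousLinearMap.inl ℝ ℂ ℂ, ContinuousLinearMap.inr ℝ ℂ ℂ] j))
  choose α β _ h using fun i j => coeffs_line (f i j)
  refine ⟨α 0 0, α 0 1, α 1 0, α 1 1, β 0 0, β 0 1, β 1 0, β 1 1, fun u => ?_⟩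
  have hu : u = (u.1, 0) + (0, u.2) := by simp
  have h00 := h 0 0 u.1
  have h01 := h 0 1 u.2
  have h10 := h 1 0 u.1
  have h11 := h 1 1 u.2
  simp only [f, Matrix.cons_val_zero, Matrix.cons_val_one, ContinuousLinearMap.comp_apply,
    ContinuousLinearMap.inl_apply, ContinuousLinearMap.inr_apply, ContinuousLinearMap.coe_fst',
    ContinuousLinearMap.coe_snd'] at h00 h01 h10 h11
  have : a u = a (u.1, 0) + a (0, u.2) := by rw [← map_add, ← hu]
  rw [this]
  refine Prod.ext ?_ ?_
  · simp only [Prod.fst_add, h00, h01]; ring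
  · simp only [Prod.snd_add, h10, h11]; ring

theorem linPart_coeffs {a : EndPlane} {a₁₁ a₁₂ a₂₁ a₂₂ b₁₁ b₁₂ b₂₁ b₂₂ : ℂ}
    (h : ∀ u : Plane, a u =
      (a₁₁ * u.1 + a₁₂ * u.2 + b₁₁ * (starRingEnd ℂ) u.1 + b₁₂ * (starRingEnd ℂ) u.2,
       a₂₁ * u.1 + a₂₂ * u.2 + b₂₁ * (starRingEnd ℂ) u.1 + b₂₂ * (starRingEnd ℂ) u.2)) (u : Plane) :
    linPart a u = (a₁₁ * u.1 + a₁₂ * u.2, a₂₁ * u.1 + a₂₂ * u.2) := by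
  simp only [linPart, smul_apply, sub_apply,
    mul_apply_eq_comp, h, iPlane_apply, map_mul, Complex.conj_I]
  have hI := Complex.I_sq
  refine Prod.ext ?_ ?_
  · simp only [Prod.smul_fst, Prod.fst_sub, Complex.real_smul]
    push_cast
    linear_combination (-(1/2) * (a₁₁ * u.1 + a₁₂ * u.2) + (1/2) * (b₁₁ * (starRingEnd ℂ) u.1 +
      b₁₂ * (starRingEnd ℂ) u.2)) * hI
  · simp only [Prod.smul_snd, Prod.snd_sub, Complex.real_smul]
    push_cast
    linear_combination (-(1/2) * (a₂₁ * u.1 + a₂₂ * u.2) + (1/2) * (b₂₁ * (starRingEnd ℂ) u.1 +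
      b₂₂ * (starRingEnd ℂ) u.2)) * hI

theorem trace_eq_re (a : EndPlane) : LinearMap.trace ℝ Plane a = 2 * (trC a).re := by
  obtain ⟨a₁₁, a₁₂, a₂₁, a₂₂, b₁₁, b₁₂, b₂₁, b₂₂, h⟩ := coeffs_plane a
  rw [LinearMap.trace_eq_matrix_trace ℝ (Complex.basisOneI.prod Complex.basisOneI),
    Matrix.trace, trC, linPart_coeffs h, linPart_coeffs h]
  simp [Fintype.sum_sum_type, LinearMap.toMatrix_apply, h]
  ring

theorem trC_re {a : EndPlane} (ha : a * a = -1) : (trC a).re = 0 := by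
  have h := trace_eq_zero (n := 2) (E := Plane) (by simp [Complex.finrank_real_complex])
    (a : Plane →ₗ[ℝ] Plane) fun v => by simpa using DFunLike.congr_fun ha v
  rw [trace_eq_re] at h
  linarith

theorem linPart_of_commute {a : EndPlane} (h : a * iPlane = iPlane * a) : linPart a = a := by
  rw [linPart, ← h, mul_assoc, iPlane_sq, mul_neg_one, sub_neg_eq_add, ← two_smul ℝ a,
    smul_smul]
  norm_num

theorem linPart_commute (a : EndPlane) : linPart a * iPlane = iPlane * linPart a := by
  rw [linPart, Algebra.smul_mul_assoc, Algebra.mul_smul_comm, sub_mul, mul_sub,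
    mul_assoc _ iPlane iPlane, iPlane_sq, ← mul_assoc, ← mul_assoc, iPlane_sq, mul_neg_one,
    neg_one_mul, sub_neg_eq_add, neg_mul, sub_neg_eq_add, add_comm]

/-- The Cayley-Hamilton theorem for complex-linear endomorphisms of `ℂ²`. -/
theorem apply_apply_of_commute {a : EndPlane} (h : a * iPlane = iPlane * a) (u : Plane) :
    a (a u) = trC a • a u - detC a • u := by
  obtain ⟨a₁₁, a₁₂, a₂₁, a₂₂, b₁₁, b₁₂, b₂₁, b₂₂, hc⟩ := coeffs_plane a
  have hl := linPart_coeffs hc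
  have ha : ∀ u, a u = _ := fun u => (DFunLike.congr_fun (linPart_of_commute h) u).symm.trans (hl u)
  simp only [trC, detC, area, hl, ha]
  refine Prod.ext ?_ ?_
  · simp; ring
  · simp; ring

/-- A complex structure on `ℂ` is `w ↦ i x w + β w̄` with `x² = 1 + |β|²`. -/
theorem trLine_of_sq {c : EndLine} (hc : c * c = -1) :
    ∃ (x : ℝ) (β : ℂ), trLine c = x * Complex.I ∧ x ^ 2 = 1 + Complex.normSq β ∧
      ∀ w, c w = x * Complex.I * w + β * (starRingEnd ℂ) w := by
  obtain ⟨α, β, h, hc'⟩ := coeffs_line c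
  have h1 := DFunLike.congr_fun hc 1
  have h2 := DFunLike.congr_fun hc Complex.I
  simp only [mul_apply_eq_comp, hc', neg_apply,
    one_apply_eq_self, map_add, map_mul, map_neg, map_one, mul_one, Complex.conj_I] at h1 h2
  have h3 : α * α + β * (starRingEnd ℂ) β = -1 := by
    have hI := Complex.I_sq
    linear_combination (1/2) * h1 - (1/2) * Complex.I * h2 + (1/2) * (α * α - α * β -
      β * (starRingEnd ℂ) α + β * (starRingEnd ℂ) β + 1) * hI
  rw [Complex.mul_conj] at h3
  have hre := congrArg Complex.re h3
  have him := congrArg Complex.im h3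
  simp at hre him
  have hβ := Complex.normSq_nonneg β
  have h0 : α.re = 0 := by
    have : α.im ≠ 0 := by rintro h; rw [h] at hre; nlinarith
    have : α.re * α.im = 0 := by linarith
    exact (mul_eq_zero.1 this).resolve_right ‹_›
  have hα : α = α.im * Complex.I := by apply Complex.ext <;> simp [h0]
  refine ⟨α.im, β, by rw [h, ← hα], ?_, fun w => by rw [hc', ← hα]⟩
  rw [h0] at hre
  linarith

/-- The `(2,0)`-part of the integrability condition. -/
theorem IntPair.detC_eq {a : EndPlane} {c : EndLine} (h : IntPair a c) :
    detC a = 1 + trLine c * trC a := by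
  obtain ⟨a₁₁, a₁₂, a₂₁, a₂₂, b₁₁, b₁₂, b₂₁, b₂₂, ha⟩ := coeffs_plane a
  obtain ⟨α, β, hα, hc⟩ := coeffs_line c
  have hl := linPart_coeffs ha
  -- evaluating on these pairs separates the bilinear from the sesquilinear terms
  have h1 := h (1, 0) (0, 1)
  have h2 := h (Complex.I, 0) (0, Complex.I)
  have h3 := h (Complex.I, 0) (0, 1)
  have h4 := h (1, 0) (0, Complex.I)
  have hI := Complex.I_sq
  simp only [trC, detC, area, hl, ha, hα, hc, map_add, map_sub, map_mul, map_one, map_zero,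
    Complex.conj_I] at h1 h2 h3 h4 ⊢
  grind

theorem area_apply_of_commute {a : EndPlane} (h : a * iPlane = iPlane * a) (u v : Plane) :
    area (a u) (a v) = detC a * area u v ∧ area (a u) v + area u (a v) = trC a * area u v := by
  obtain ⟨a₁₁, a₁₂, a₂₁, a₂₂, b₁₁, b₁₂, b₂₁, b₂₂, hc⟩ := coeffs_plane a
  have hl := linPart_coeffs hc
  have ha : ∀ u, a u = _ := fun u => (DFunLike.congr_fun (linPart_of_commute h) u).symm.trans (hl u)
  simp only [trC, detC, area, hl, ha]
  constructor <;> ring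

theorem area_add_smul (u u' v v' : Plane) (t s : ℝ) :
    area (u + t • u') (v + s • v') =
      area u v + s * area u v' + t * area u' v + t * s * area u' v' := by
  simp only [area, Prod.fst_add, Prod.snd_add, Prod.smul_fst, Prod.smul_snd, Complex.real_smul]
  ring

theorem one_add_smul_apply {μ : EndPlane} (t : ℝ) (u : Plane) :
    (1 + t • μ) u = u + t • μ u := rfl

theorem one_add_smul_mul_apply {K μ : EndPlane} (hμ : μ * K = -(K * μ)) (t : ℝ) (u : Plane) :
    (1 + t • μ) (K u) = K u + (-t) • K (μ u) := by
  have h : μ (K u) = -K (μ u) := DFunLike.congr_fun hμ u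
  rw [one_add_smul_apply, h, smul_neg, neg_smul]

/-- The integrability condition for a conjugate `φ K φ⁻¹`, pulled back along `φ`. -/
theorem intPair_iff_of_mul_eq {J K φ : EndPlane} {c : EndLine} (hJ : J * φ = φ * K)
    (hφ : IsUnit φ) : IntPair J c ↔ ∀ u v, area (φ (K u)) (φ (K v)) =
      area (φ u) (φ v) + c (area (φ (K u)) (φ v) + area (φ u) (φ (K v))) := by
  have hJ' : ∀ u, J (φ u) = φ (K u) := DFunLike.congr_fun hJ
  constructor
  · intro h u v
    rw [← hJ', ← hJ', h, map_add, add_assoc]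
  · intro h u v
    obtain ⟨ψ, rfl⟩ := hφ
    have hs : ∀ w, (ψ : EndPlane) (((ψ⁻¹ : EndPlaneˣ) : EndPlane) w) = w :=
      DFunLike.congr_fun (Units.mul_inv ψ)
    have := h (((ψ⁻¹ : EndPlaneˣ) : EndPlane) u) (((ψ⁻¹ : EndPlaneˣ) : EndPlane) v)
    rw [← hJ', ← hJ', hs, hs] at this
    rw [this, map_add, add_assoc]

/-- Relative to a `K` that is infinitesimally area preserving (a complex-linear `K` of trace zero),
integrability is a linear condition on the Cayley transform `μ`, so it is inherited by `t μ`. -/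
theorem IntPair.cayley_of_trace_zero {K J J' μ : EndPlane} {c : EndLine}
    (hK : ∀ u v, area (K u) (K v) = area u v) (hK' : ∀ u v, area (K u) v + area u (K v) = 0)
    (hμ : μ * K = -(K * μ)) (h : IntPair J c) (hJ : J * (1 + μ) = (1 + μ) * K)
    (hu1 : IsUnit (1 + μ)) {t : ℝ}
    (hJ' : J' * (1 + t • μ) = (1 + t • μ) * K) (hu : IsUnit (1 + t • μ)) : IntPair J' c := by
  have key : ∀ (s : ℝ) (u v : Plane),
      (area ((1 + s • μ) (K u)) ((1 + s • μ) (K v)) = area ((1 + s • μ) u) ((1 + s • μ) v) +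
        c (area ((1 + s • μ) (K u)) ((1 + s • μ) v) + area ((1 + s • μ) u) ((1 + s • μ) (K v)))) ↔
      (s : ℂ) * (-2 * (area (μ u) v + area u (μ v))) = s * c (area (K u) (μ v) - area (K (μ u)) v -
        area u (K (μ v)) + area (μ u) (K v)) := by
    intro s u v
    rw [one_add_smul_mul_apply hμ, one_add_smul_mul_apply hμ, one_add_smul_apply,
      one_add_smul_apply]
    simp only [area_add_smul, hK]
    have h1 := hK' u v
    have h2 := hK' (μ u) (μ v)
    have h3 : (s : ℂ) * c (area (K u) (μ v) - area (K (μ u)) v - area u (K (μ v)) +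
        area (μ u) (K v)) = c (s • (area (K u) (μ v) - area (K (μ u)) v - area u (K (μ v)) +
        area (μ u) (K v))) := by
      rw [map_smul, Complex.real_smul]
    rw [h3]
    have h4 : area (K u) v + s * area (K u) (μ v) + ((-s : ℝ) : ℂ) * area (K (μ u)) v +
        ((-s : ℝ) : ℂ) * s * area (K (μ u)) (μ v) + (area u (K v) + ((-s : ℝ) : ℂ) *
        area u (K (μ v)) + s * area (μ u) (K v) + s * ((-s : ℝ) : ℂ) * area (μ u) (K (μ v))) =
        s • (area (K u) (μ v) - area (K (μ u)) v - area u (K (μ v)) + area (μ u) (K v)) := by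
      rw [Complex.real_smul]
      push_cast
      linear_combination h1 - s * s * h2
    rw [h4]
    push_cast
    constructor
    · intro h; linear_combination h
    · intro h; linear_combination h
  rw [intPair_iff_of_mul_eq hJ' hu]
  have h1 := (intPair_iff_of_mul_eq hJ hu1).1 h
  intro u v
  rw [key]
  have h2 := key 1 u v
  rw [one_smul] at h2
  have h3 := h2.1 (h1 u v)
  simp only [Complex.ofReal_one, one_mul] at h3
  rw [h3]

/-- Integrability relative to multiplication by `i`: the Cayley transform `ν` on the centre is
induced by the Cayley transform `μ` on the quotient, and this is inherited by `(t μ, t² ν)`. -/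
theorem IntPair.cayley_iPlane {J J' μ : EndPlane} {c c' ν : EndLine}
    (hμ : μ * iPlane = -(iPlane * μ)) (hν : ν * iLine = -(iLine * ν))
    (h : IntPair J c) (hJ : J * (1 + μ) = (1 + μ) * iPlane) (hu1 : IsUnit (1 + μ))
    (hc2 : c * c = -1)
    (hc : c * (1 + ν) = (1 + ν) * iLine) (hu' : IsUnit (c + iLine)) {t : ℝ}
    (hJ' : J' * (1 + t • μ) = (1 + t • μ) * iPlane)
    (hc' : c' * (1 + t ^ 2 • ν) = (1 + t ^ 2 • ν) * iLine)
    (hu : IsUnit (1 + t • μ)) : IntPair J' c' := by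
  have key : ∀ (c : EndLine) (s : ℝ) (u v : Plane),
      (area ((1 + s • μ) (iPlane u)) ((1 + s • μ) (iPlane v)) =
        area ((1 + s • μ) u) ((1 + s • μ) v) + c (area ((1 + s • μ) (iPlane u)) ((1 + s • μ) v) +
          area ((1 + s • μ) u) ((1 + s • μ) (iPlane v)))) ↔
      -2 * (area u v + s ^ 2 * area (μ u) (μ v)) =
        2 * c (Complex.I * (area u v - s ^ 2 * area (μ u) (μ v))) := by
    intro c s u v
    rw [one_add_smul_mul_apply hμ, one_add_smul_mul_apply hμ, one_add_smul_apply,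
      one_add_smul_apply]
    have h3 : (2 : ℂ) * c (Complex.I * (area u v - s ^ 2 * area (μ u) (μ v))) =
        c ((2 : ℝ) • (Complex.I * (area u v - s ^ 2 * area (μ u) (μ v)))) := by
      rw [map_smul, Complex.real_smul]; norm_num
    rw [h3, ← sub_eq_zero, ← sub_eq_zero (a := -2 * _)]
    have h4 : ∀ w w' z z' : ℂ, w = w' → z = z' → ((z - c w = 0) ↔ (z' - c w' = 0)) := by
      rintro w _ z _ rfl rfl; rfl
    have hI := Complex.I_sq
    rw [← sub_sub]
    refine h4 _ _ _ _ ?_ ?_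
    · rw [Complex.real_smul]
      simp only [area, iPlane_apply, Prod.fst_add, Prod.snd_add, Prod.smul_fst, Prod.smul_snd,
        Complex.real_smul]
      push_cast
      ring
    · simp only [area, iPlane_apply, Prod.fst_add, Prod.snd_add, Prod.smul_fst, Prod.smul_snd,
        Complex.real_smul]
      push_cast
      grind
  rw [intPair_iff_of_mul_eq hJ' hu]
  have h1 := (intPair_iff_of_mul_eq hJ hu1).1 h
  have hν' : ∀ w, ν (Complex.I * w) = -(Complex.I * ν w) := DFunLike.congr_fun hν
  have hcν : ∀ w, c (w + ν w) = Complex.I * w - Complex.I * ν w := by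
    intro w
    have : c (w + ν w) = Complex.I * w + ν (Complex.I * w) := DFunLike.congr_fun hc w
    rw [this, hν', sub_eq_add_neg]
  have hc'ν : ∀ w, c' (w + t ^ 2 • ν w) = Complex.I * w - t ^ 2 • (Complex.I * ν w) := by
    intro w
    have : c' (w + t ^ 2 • ν w) = Complex.I * w + t ^ 2 • ν (Complex.I * w) :=
      DFunLike.congr_fun hc' w
    rw [this, hν', smul_neg, sub_eq_add_neg]
  intro u v
  rw [key]
  have h2 := key c 1 u v
  rw [one_smul] at h2
  have h3 := h2.1 (h1 u v)
  -- the two Cayley transforms are related by `area (μ u) (μ v) = ν (area u v)`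
  have h5 : area (μ u) (μ v) = ν (area u v) := by
    have h6 := hcν (Complex.I * area u v)
    rw [hν', ← sub_eq_add_neg] at h6
    simp only [Complex.ofReal_one, one_pow, one_mul, mul_sub, map_sub] at h3 h6
    have h7 : c (Complex.I * (area (μ u) (μ v) - ν (area u v))) =
        area (μ u) (μ v) - ν (area u v) := by
      rw [mul_sub, map_sub]
      linear_combination h6 + (1/2) * h3 + (area u v + ν (area u v)) * Complex.I_sq
    set w := area (μ u) (μ v) - ν (area u v) with hw
    have h8 : (c + iLine) w = 0 := by
      have h9 : c (c (Complex.I * w)) = -(Complex.I * w) := DFunLike.congr_fun hc2 _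
      rw [h7] at h9
      simp [h9]
    obtain ⟨ψ, hψ⟩ := hu'
    have h9 : ((ψ⁻¹ : EndLineˣ) : EndLine) ((ψ : EndLine) w) = w :=
      DFunLike.congr_fun (Units.inv_mul ψ) w
    rw [hψ, h8, map_zero] at h9
    exact sub_eq_zero.1 (hw ▸ h9.symm)
  have h6 := hc'ν (Complex.I * area u v)
  rw [hν', smul_neg, ← sub_eq_add_neg, Complex.real_smul, Complex.real_smul] at h6
  rw [h5]
  have h7 : Complex.I * (area u v - t ^ 2 * ν (area u v)) =
    Complex.I * area u v - ((t ^ 2 : ℝ) : ℂ) * (Complex.I * ν (area u v)) := by push_cast; ring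
  rw [h7, h6]
  push_cast
  linear_combination (-2 * area u v - 2 * t ^ 2 * ν (area u v)) * Complex.I_sq

end Plane

/-! ### Invariants of the structure on the quotient -/

section Invariants

/-- The real number `ξ` for which the complex trace of `a` is `2 i ξ`, when `a² = -1`. -/
def xi (a : EndPlane) : ℝ := (trC a).im / 2

/-- The real number `x` for which the complex-linear part of `c` is `i x`, when `c² = -1`. Its sign
is the orientation of `c`. -/
def sgnLine (c : EndLine) : ℝ := (trLine c).im

theorem trC_eq {a : EndPlane} (ha : a * a = -1) : trC a = 2 * xi a * Complex.I := by
  apply Complex.ext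
  · simp [trC_re ha]
  · simp [xi]; ring

theorem IntPair.detC_eq_real {a : EndPlane} {c : EndLine} (ha : a * a = -1) (hc : c * c = -1)
    (h : IntPair a c) : detC a = ((1 - 2 * sgnLine c * xi a : ℝ) : ℂ) := by
  obtain ⟨x, β, hx, -, -⟩ := trLine_of_sq hc
  rw [h.detC_eq, trC_eq ha, sgnLine, hx]
  simp
  linear_combination (2 * x * xi a) * Complex.I_sq

theorem one_le_sgnLine_sq {c : EndLine} (hc : c * c = -1) : 1 ≤ sgnLine c ^ 2 := by
  obtain ⟨x, β, hx, h, -⟩ := trLine_of_sq hc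
  rw [sgnLine, hx]
  simp [h, Complex.normSq_nonneg]

theorem linPart_linPart (a : EndPlane) : linPart (linPart a) = linPart a :=
  linPart_of_commute (linPart_commute a)

theorem trC_linPart (a : EndPlane) : trC (linPart a) = trC a := by
  rw [trC, linPart_linPart, trC]

theorem detC_linPart (a : EndPlane) : detC (linPart a) = detC a := by
  rw [detC, linPart_linPart, detC]

theorem iPlane_mul_linPart (a : EndPlane) :
    (2 : ℝ) • (iPlane * linPart a) = iPlane * a + a * iPlane := by
  rw [linPart, mul_smul_comm, smul_smul, mul_sub, ← mul_assoc, ← mul_assoc, iPlane_sq,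
    neg_one_mul, neg_mul, sub_neg_eq_add]
  norm_num

theorem linPart_mul_add {a : EndPlane} (ha : a * a = -1) :
    linPart a * a + a * linPart a = (2 : ℝ) • (linPart a * linPart a) := by
  have h1 : a * iPlane * a * iPlane = a * (iPlane * a * iPlane) := by simp only [mul_assoc]
  have h2 : (iPlane * a * iPlane) * (iPlane * a * iPlane) = -1 := by
    calc (iPlane * a * iPlane) * (iPlane * a * iPlane)
        = iPlane * a * (iPlane * iPlane) * a * iPlane := by simp only [mul_assoc]
      _ = - (iPlane * (a * a) * iPlane) := by
        rw [iPlane_sq]; simp [mul_assoc]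
      _ = -1 := by rw [ha]; simp [iPlane_sq]
  simp only [linPart, smul_mul_assoc, mul_smul_comm, sub_mul, mul_sub, h2, ha, smul_smul]
  module

variable {a : EndPlane} {ξ η : ℝ}

/-- The Cayley-Hamilton equation of the complex-linear part, with `η` for `2 x ξ`. -/
theorem linPart_sq (htr : trC a = 2 * ξ * Complex.I) (hdet : detC a = ((1 - η : ℝ) : ℂ)) :
    linPart a * linPart a = (2 * ξ) • (iPlane * linPart a) - (1 - η) • 1 := by
  refine ContinuousLinearMap.ext fun u => ?_
  have h := apply_apply_of_commute (linPart_commute a) u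
  rw [trC_linPart, detC_linPart, htr, hdet] at h
  refine h.trans ?_
  refine Prod.ext ?_ ?_
  · simp [mul_assoc]
  · simp [mul_assoc]

/-- In the positive family, where `ξ > 0` and `η = 2 x ξ > 0`, the Cayley path from multiplication
by `i` to `a` exists. -/
theorem isUnit_interpolate_iPlane (ha : a * a = -1) (htr : trC a = 2 * ξ * Complex.I)
    (hdet : detC a = ((1 - η : ℝ) : ℂ)) (hξ : 0 < ξ) (hη : 0 < η) {t : ℝ}
    (ht : t ∈ Set.Icc (0 : ℝ) 1) : IsUnit ((1 + t) • iPlane + (1 - t) • a) := by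
  have hL := linPart_sq htr hdet
  refine isUnit_interpolate iPlane_sq ha (X := -(iPlane * linPart a)) (τ := 2 * ξ) (δ := η - 1)
    ?_ ?_ (by linarith) (by linarith) ht
  · rw [smul_neg, neg_neg, iPlane_mul_linPart]
  · have : -(iPlane * linPart a) * -(iPlane * linPart a) = -(linPart a * linPart a) := by
      rw [neg_mul_neg, mul_assoc, ← mul_assoc (linPart a), linPart_commute, mul_assoc,
        ← mul_assoc, iPlane_sq, neg_one_mul]
    rw [this, hL]
    module

/-- The trace-free part of the complex-linear part of `a`, which is a multiple of a complex
structure acting as `i` and `-i` on two complementary complex lines. -/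
def traceFree (a : EndPlane) : EndPlane := linPart a - xi a • iPlane

theorem traceFree_commute (a : EndPlane) : traceFree a * iPlane = iPlane * traceFree a := by
  rw [traceFree, sub_mul, mul_sub, linPart_commute, smul_mul_assoc, mul_smul_comm]

theorem traceFree_sq (ha : a * a = -1) (hdet : detC a = ((1 - η : ℝ) : ℂ)) :
    traceFree a * traceFree a = -((1 - η + xi a ^ 2) • 1) := by
  have hL := linPart_sq (trC_eq ha) hdet
  simp only [traceFree, sub_mul, mul_sub, smul_mul_assoc, mul_smul_comm, linPart_commute, hL,
    iPlane_sq]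
  module

theorem area_traceFree (ha : a * a = -1) (u v : Plane) :
    area (traceFree a u) v + area u (traceFree a v) = 0 := by
  have h := (area_apply_of_commute (linPart_commute a) u v).2
  rw [trC_linPart, trC_eq ha] at h
  have h1 : ∀ w, traceFree a w = linPart a w - xi a • iPlane w := fun w => rfl
  rw [h1, h1]
  simp only [area, Prod.fst_sub, Prod.snd_sub, Prod.smul_fst, Prod.smul_snd, iPlane_apply,
    Complex.real_smul] at h ⊢
  linear_combination h

/-- The complex structure commuting with `i` that is proportional to the trace-free part. -/
def splitPart (a : EndPlane) (s : ℝ) : EndPlane := s⁻¹ • traceFree a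

theorem splitPart_commute (a : EndPlane) (s : ℝ) :
    splitPart a s * iPlane = iPlane * splitPart a s := by
  rw [splitPart, smul_mul_assoc, mul_smul_comm, traceFree_commute]

variable {s : ℝ}

theorem splitPart_sq (ha : a * a = -1) (hdet : detC a = ((1 - η : ℝ) : ℂ))
    (hs : s ^ 2 = 1 - η + xi a ^ 2) (hs0 : 0 < s) :
    splitPart a s * splitPart a s = -1 := by
  rw [splitPart, smul_mul_smul_comm, traceFree_sq ha hdet, ← hs, smul_neg, smul_smul]
  have : s⁻¹ * s⁻¹ * s ^ 2 = 1 := by field_simp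
  rw [this, one_smul]

theorem area_splitPart (ha : a * a = -1) (u v : Plane) :
    area (splitPart a s u) v + area u (splitPart a s v) = 0 := by
  have h := area_traceFree ha u v
  have h1 : ∀ w, splitPart a s w = s⁻¹ • traceFree a w := fun w => rfl
  rw [h1, h1]
  simp only [area, Prod.smul_fst, Prod.smul_snd, Complex.real_smul] at h ⊢
  linear_combination (s⁻¹ : ℝ) * h

theorem area_apply_apply {K : EndPlane} (hK : K * K = -1)
    (h : ∀ u v, area (K u) v + area u (K v) = 0) (u v : Plane) :
    area (K u) (K v) = area u v := by
  have h1 := h u (K v)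
  have h2 : K (K v) = -v := DFunLike.congr_fun hK v
  rw [h2] at h1
  simp only [area, Prod.fst_neg, Prod.snd_neg] at h1 ⊢
  linear_combination h1

/-- In the negative family, where `η = 2 x ξ ≤ 0`, the Cayley path from the complex structure
proportional to the trace-free part to `a` exists. -/
theorem isUnit_interpolate_splitPart (ha : a * a = -1) (hdet : detC a = ((1 - η : ℝ) : ℂ))
    (hη : η ≤ 0) (hs : s ^ 2 = 1 - η + xi a ^ 2) (hs0 : 0 < s) {t : ℝ}
    (ht : t ∈ Set.Icc (0 : ℝ) 1) : IsUnit ((1 + t) • splitPart a s + (1 - t) • a) := by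
  have hK := splitPart_sq ha hdet hs hs0
  have hL : linPart a = s • splitPart a s + xi a • iPlane := by
    rw [splitPart, smul_smul, mul_inv_cancel₀ hs0.ne', one_smul, traceFree]
    abel
  have hc := splitPart_commute a s
  set K := splitPart a s with hKdef
  refine isUnit_interpolate hK ha (X := s • (1 : EndPlane) - xi a • (iPlane * K)) (τ := 2 * s)
    (δ := s ^ 2 - xi a ^ 2) ?_ ?_ (by linarith) (by linarith) ht
  · have h1 := linPart_mul_add ha
    have h2 := iPlane_mul_linPart a
    have h3 : K = s⁻¹ • (linPart a - xi a • iPlane) := rfl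
    have h4 : K * a + a * K = s⁻¹ • ((linPart a * a + a * linPart a) -
        xi a • (iPlane * a + a * iPlane)) := by
      rw [h3]
      simp only [smul_mul_assoc, mul_smul_comm, sub_mul, mul_sub]
      module
    rw [h4, h1, ← h2, hL]
    simp only [mul_add, add_mul, smul_mul_assoc, mul_smul_comm, hK, iPlane_sq, hc, smul_sub,
      smul_add, smul_smul, smul_neg]
    have hs1 : s⁻¹ * s = 1 := inv_mul_cancel₀ hs0.ne'
    match_scalars
    · linear_combination (-2 * s) * hs1
    · linear_combination (2 * xi a) * hs1
  · have h1 : iPlane * K * (iPlane * K) = 1 := by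
      rw [mul_assoc, ← mul_assoc K, hc, mul_assoc, hK, ← mul_assoc, iPlane_sq]
      simp
    simp only [sub_mul, mul_sub, smul_mul_assoc, mul_smul_comm, one_mul, mul_one, h1]
    module

end Invariants

section Line

theorem isUnit_interpolate_iLine {c : EndLine} (hc : c * c = -1) (hx : 0 < sgnLine c) {t : ℝ}
    (ht : t ∈ Set.Icc (0 : ℝ) 1) : IsUnit ((1 + t) • iLine + (1 - t) • c) := by
  obtain ⟨x, β, h, -, hcx⟩ := trLine_of_sq hc
  have hx' : sgnLine c = x := by rw [sgnLine, h]; simp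
  rw [hx'] at hx
  refine isUnit_interpolate iLine_sq hc (X := x • (1 : EndLine)) (τ := 2 * x) (δ := x ^ 2)
    ?_ ?_ (by linarith) (by positivity) ht
  · refine ContinuousLinearMap.ext fun w => ?_
    change Complex.I * c w + c (Complex.I * w) = -((2 : ℝ) • x • w)
    simp only [hcx, map_mul, Complex.conj_I, Complex.real_smul]
    push_cast
    linear_combination (2 * x * w) * Complex.I_sq
  · simp only [smul_mul_smul_comm, one_mul]
    module

end Line

/-! ### Orientation in terms of the invariants -/

section OrientationCriteria

/-- The complex structures `J` and `K` on a normed space induce the same orientation. -/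
abbrev SameOrL {E : Type} [NormedAddCommGroup E] [NormedSpace ℝ E] (J K : Endo E) : Prop :=
  SameOr (J : E →ₗ[ℝ] E) (K : E →ₗ[ℝ] E)

/-- The complex structures `J` and `K` on a normed space induce opposite orientations. -/
abbrev OppOrL {E : Type} [NormedAddCommGroup E] [NormedSpace ℝ E] (J K : Endo E) : Prop :=
  OppOr (J : E →ₗ[ℝ] E) (K : E →ₗ[ℝ] E)

section General

variable {E : Type} [NormedAddCommGroup E] [NormedSpace ℝ E]

theorem apply_apply_of_sq {J : Endo E} (h : J * J = -1) (v : E) : J (J v) = -v :=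
  DFunLike.congr_fun h v

theorem SameOrL.neg {J K : Endo E} (h : SameOrL J K) : SameOrL (-J) (-K) := by
  obtain ⟨φ, hφ, hd⟩ := h
  exact ⟨φ, fun v => by simpa using hφ v, hd⟩

/-- A conjugation commuting with some complex structure `I` has positive determinant. -/
theorem sameOrL_of_isUnit_commute {I J K φ : Endo E} (hI : I * I = -1) (hφI : φ * I = I * φ)
    (hu : IsUnit φ) (h : φ * J = K * φ) : SameOrL J K := by
  obtain ⟨ψ, rfl⟩ := hu
  let e : E ≃ₗ[ℝ] E := (ContinuousLinearEquiv.unitsEquiv ℝ E ψ).toLinearEquiv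
  have he : ∀ v, e v = (ψ : Endo E) v := fun v => rfl
  refine ⟨e, fun v => DFunLike.congr_fun h v, ?_⟩
  exact det_pos_of_commute (I : E →ₗ[ℝ] E) (apply_apply_of_sq hI) e
    fun v => DFunLike.congr_fun hφI v

/-- All members of a Cayley path induce the same orientation. -/
theorem sameOrL_cayleyPath [FiniteDimensional ℝ E] {J K : Endo E} (hK : K * K = -1)
    (h : ∀ t ∈ Set.Icc (0 : ℝ) 1, IsUnit ((1 + t) • K + (1 - t) • J)) {t : ℝ}
    (ht : t ∈ Set.Icc (0 : ℝ) 1) : SameOrL (cayleyPath K J t) K := by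
  have hcomp : CompleteSpace (Endo E) := by
    have : CompleteSpace E := FiniteDimensional.complete ℝ E
    infer_instance
  have h0 : IsUnit (J + K) := by
    have := h 0 ⟨le_rfl, zero_le_one⟩
    simpa [add_comm] using this
  have hu := fun t (ht : t ∈ Set.Icc (0 : ℝ) 1) => isUnit_one_add_smul_cayley h ht
  have hp := sameOr_of_path (f := fun t => cayleyPath K J t)
    (continuousOn_cayleyPath continuousOn_const continuousOn_const continuousOn_id
      (fun _ _ => h0) hu)
    (fun t ht => apply_apply_of_sq (cayleyPath_sq hK (hu t ht)))
    (s := t) (t := 0) ht ⟨le_rfl, zero_le_one⟩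
  rwa [cayleyPath_zero] at hp

theorem sameOrL_of_isUnit_interpolate [FiniteDimensional ℝ E] {J K : Endo E} (hK : K * K = -1)
    (hJ : J * J = -1) (h : ∀ t ∈ Set.Icc (0 : ℝ) 1, IsUnit ((1 + t) • K + (1 - t) • J)) :
    SameOrL J K := by
  have hp := sameOrL_cayleyPath hK h (t := 1) ⟨zero_le_one, le_rfl⟩
  have h0 : IsUnit (J + K) := by
    have := h 0 ⟨le_rfl, zero_le_one⟩
    simpa [add_comm] using this
  have h1 := isUnit_one_add_smul_cayley h (t := 1) ⟨zero_le_one, le_rfl⟩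
  rw [one_smul] at h1
  rwa [cayleyPath_one hK hJ h0 h1] at hp

end General

theorem sgnLine_neg (c : EndLine) : sgnLine (-c) = -sgnLine c := by
  simp only [sgnLine, trLine, neg_apply, ← Complex.neg_im]
  congr 1
  ring

theorem oppOrL_neg_iLine : OppOrL (-iLine) iLine := by
  refine ⟨Complex.conjAe.toLinearEquiv, fun w => ?_, ?_⟩
  · change (starRingEnd ℂ) (-(Complex.I * w)) = Complex.I * (starRingEnd ℂ) w
    simp
  · rw [Complex.det_conjAe]; norm_num

theorem sameOrL_iLine {c : EndLine} (hc : c * c = -1) (hx : 0 < sgnLine c) : SameOrL c iLine :=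
  sameOrL_of_isUnit_interpolate iLine_sq hc fun _ ht => isUnit_interpolate_iLine hc hx ht

theorem oppOrL_iLine {c : EndLine} (hc : c * c = -1) (hx : sgnLine c < 0) : OppOrL c iLine := by
  have h : SameOrL (-c) iLine := sameOrL_iLine (by rwa [neg_mul_neg])
    (by rw [sgnLine_neg]; linarith)
  have h' := SameOrL.neg h
  rw [neg_neg] at h'
  exact h'.trans_opp oppOrL_neg_iLine

/-- The complex structure on `ℂ²` with components `c` and `c'`. -/
def diagPlane (c c' : EndLine) : EndPlane := ContinuousLinearMap.prodMap c c'

theorem oppOrL_diagPlane : OppOrL (diagPlane iLine (-iLine)) iPlane :=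
  SameOr.prodMap_opp (SameOr.refl _) oppOrL_neg_iLine

theorem oppOrL_diagPlane' : OppOrL (diagPlane (-iLine) iLine) iPlane :=
  OppOr.prodMap_same oppOrL_neg_iLine (SameOr.refl _)

/-- On a space of even complex dimension, `-i` induces the same orientation as `i`. -/
theorem sameOrL_neg_iPlane : SameOrL (-iPlane) iPlane := by
  have h : -iPlane = diagPlane (-iLine) (-iLine) := rfl
  rw [h]
  exact OppOr.prodMap oppOrL_neg_iLine oppOrL_neg_iLine

theorem coeffs_of_commute {K : EndPlane} (h : K * iPlane = iPlane * K)
    (htr : ∀ u v, area (K u) v + area u (K v) = 0) :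
    ∃ p q r : ℂ, ∀ u, K u = (p * u.1 + q * u.2, r * u.1 - p * u.2) := by
  obtain ⟨a₁₁, a₁₂, a₂₁, a₂₂, b₁₁, b₁₂, b₂₁, b₂₂, hc⟩ := coeffs_plane K
  have hl := linPart_coeffs hc
  have ha : ∀ u, K u = _ := fun u => (DFunLike.congr_fun (linPart_of_commute h) u).symm.trans (hl u)
  have h1 := htr (1, 0) (0, 1)
  simp [ha, area] at h1
  refine ⟨a₁₁, a₁₂, a₂₁, fun u => ?_⟩
  rw [ha, eq_neg_of_add_eq_zero_right h1]
  ring_nf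

/-- A complex structure on `ℂ²` that is complex linear and trace free induces the orientation
opposite to that of multiplication by `i`. -/
theorem oppOrL_of_commute {K : EndPlane} (hK : K * K = -1) (h : K * iPlane = iPlane * K)
    (htr : ∀ u v, area (K u) v + area u (K v) = 0) : OppOrL K iPlane := by
  obtain ⟨p, q, r, hp⟩ := coeffs_of_commute h htr
  have hI := Complex.I_sq
  have hK' := apply_apply_of_sq hK
  -- `1 - D K` conjugates `K` into `D`, is complex linear, and is invertible for one of the two
  -- choices of `D`, which are `diag (i, -i)` and `diag (-i, i)`
  have key : ∀ (D : EndPlane) (σ : ℂ), σ * σ = 1 →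
      (∀ u, D u = (σ * (Complex.I * u.1), -(σ * (Complex.I * u.2)))) → OppOrL D iPlane →
      1 - σ * Complex.I * p ≠ 0 → OppOrL K iPlane := by
    intro D σ hσ hD hDo hz
    have hD2 : ∀ u, D (D u) = -u := fun u => by
      simp only [hD]
      refine Prod.ext ?_ ?_
      · simp only [Prod.fst_neg]; linear_combination (σ * σ * u.1) * hI - u.1 * hσ
      · simp only [Prod.snd_neg]; linear_combination (σ * σ * u.2) * hI - u.2 * hσ
    have hsum : ∀ u, D (K u) + K (D u) = (2 * (σ * Complex.I * p)) • u := fun u => by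
      simp only [hD, hp]
      refine Prod.ext ?_ ?_
      · simp only [Prod.fst_add, Prod.smul_fst, smul_eq_mul]; ring
      · simp only [Prod.snd_add, Prod.smul_snd, smul_eq_mul]; ring
    have hsmul : ∀ (z : ℂ) u, D (K (z • u)) = z • D (K u) := fun z u => by
      simp only [hD, hp, Prod.smul_fst, Prod.smul_snd, smul_eq_mul]
      refine Prod.ext ?_ ?_
      · simp only [Prod.smul_fst, smul_eq_mul]; ring
      · simp only [Prod.smul_snd, smul_eq_mul]; ring
    set z := 1 - σ * Complex.I * p with hzdef
    have h1 : ∀ u, (1 - D * K) ((1 - K * D) u) = (2 * z) • u := fun u => by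
      change (u - K (D u)) - D (K (u - K (D u))) = _
      rw [map_sub, map_sub, hK', map_neg, hD2, neg_neg, hzdef]
      have := eq_sub_of_add_eq (hsum u)
      rw [this]
      module
    have h2 : ∀ u, (1 - K * D) ((1 - D * K) u) = (2 * z) • u := fun u => by
      change (u - D (K u)) - K (D (u - D (K u))) = _
      rw [map_sub, map_sub, hD2, map_neg, hK', neg_neg, hzdef]
      have := eq_sub_of_add_eq (hsum u)
      rw [this]
      module
    refine SameOr.trans_opp (sameOrL_of_isUnit_commute (φ := 1 - D * K) iPlane_sq ?_ ?_ ?_) hDo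
    · refine ContinuousLinearMap.ext fun u => ?_
      have h3 : ∀ w, iPlane w = Complex.I • w := fun w => rfl
      change iPlane u - D (K (iPlane u)) = iPlane (u - D (K u))
      rw [h3, h3, hsmul, smul_sub]
    · refine ⟨⟨1 - D * K, (2 * z)⁻¹ • (1 - K * D), ?_, ?_⟩, rfl⟩
      · refine ContinuousLinearMap.ext fun u => ?_
        change (2 * z)⁻¹ • (1 - K * D) u - D (K ((2 * z)⁻¹ • (1 - K * D) u)) = u
        rw [hsmul, ← smul_sub]
        change (2 * z)⁻¹ • ((1 - D * K) ((1 - K * D) u)) = u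
        rw [h1, smul_smul, inv_mul_cancel₀ (mul_ne_zero two_ne_zero hz), one_smul]
      · refine ContinuousLinearMap.ext fun u => ?_
        change (2 * z)⁻¹ • ((1 - K * D) ((1 - D * K) u)) = u
        rw [h2, smul_smul, inv_mul_cancel₀ (mul_ne_zero two_ne_zero hz), one_smul]
    · refine ContinuousLinearMap.ext fun u => ?_
      change K u - D (K (K u)) = D (u - D (K u))
      rw [hK', map_neg, map_sub, hD2]
      abel
  by_cases hp0 : 1 - 1 * Complex.I * p = 0
  · refine key (diagPlane (-iLine) iLine) (-1) (by ring) (fun u => ?_) oppOrL_diagPlane' ?_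
    · change (-(Complex.I * u.1), Complex.I * u.2) = _
      simp
    · intro h0
      have : (2 : ℂ) = 0 := by linear_combination hp0 + h0
      norm_num at this
  · refine key (diagPlane iLine (-iLine)) 1 (by ring) (fun u => ?_) oppOrL_diagPlane hp0
    change (Complex.I * u.1, -(Complex.I * u.2)) = _
    simp

theorem sameOrL_iPlane {a : EndPlane} {η : ℝ} (ha : a * a = -1)
    (hdet : detC a = ((1 - η : ℝ) : ℂ)) (hξ : xi a ≠ 0) (hη : 0 < η) : SameOrL a iPlane := by
  rcases hξ.lt_or_gt with h | h
  · have hneg : linPart (-a) = -linPart a := by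
      simp [linPart, ← smul_neg, neg_add_eq_sub]
    have htr : trC (-a) = 2 * ((-xi a : ℝ) : ℂ) * Complex.I := by
      have := trC_eq ha
      rw [trC] at this ⊢
      rw [hneg]
      simp only [neg_apply, Prod.fst_neg, Prod.snd_neg]
      push_cast
      linear_combination -this
    have hdet' : detC (-a) = ((1 - η : ℝ) : ℂ) := by
      rw [← hdet, detC, detC, hneg]
      simp [area]
    have ha' : -a * -a = -1 := by rwa [neg_mul_neg]
    have h1 : SameOrL (-a) iPlane := sameOrL_of_isUnit_interpolate iPlane_sq ha'
      fun t ht => isUnit_interpolate_iPlane ha' htr hdet' (by linarith) hη ht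
    have h2 := SameOrL.neg h1
    rw [neg_neg] at h2
    exact h2.trans sameOrL_neg_iPlane
  · exact sameOrL_of_isUnit_interpolate iPlane_sq ha
      fun t ht => isUnit_interpolate_iPlane ha (trC_eq ha) hdet h hη ht

theorem oppOrL_iPlane {a : EndPlane} {η : ℝ} (ha : a * a = -1)
    (hdet : detC a = ((1 - η : ℝ) : ℂ)) (hη : η ≤ 0) : OppOrL a iPlane := by
  have hs0 : 0 < 1 - η + xi a ^ 2 := by nlinarith [sq_nonneg (xi a)]
  have hs : √(1 - η + xi a ^ 2) ^ 2 = 1 - η + xi a ^ 2 := Real.sq_sqrt hs0.le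
  have hs' := Real.sqrt_pos.2 hs0
  have hK := splitPart_sq ha hdet hs hs'
  refine SameOr.trans_opp (sameOrL_of_isUnit_interpolate hK ha fun t ht =>
    isUnit_interpolate_splitPart ha hdet hη hs hs' ht) ?_
  exact oppOrL_of_commute hK (splitPart_commute _ _) (area_splitPart ha)

/-- For an integrable pair, the orientation of `a` is the sign of `x ξ`. -/
theorem IntPair.orientation {a : EndPlane} {c : EndLine} (ha : a * a = -1) (hc : c * c = -1)
    (h : IntPair a c) : (0 < sgnLine c * xi a ∧ SameOrL a iPlane) ∨
      (sgnLine c * xi a ≤ 0 ∧ OppOrL a iPlane) := by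
  have hdet := h.detC_eq_real ha hc
  rcases lt_or_ge 0 (sgnLine c * xi a) with h1 | h1
  · refine Or.inl ⟨h1, sameOrL_iPlane ha hdet (fun h0 => ?_) (by linarith)⟩
    simp [h0] at h1
  · exact Or.inr ⟨h1, oppOrL_iPlane ha hdet (by linarith)⟩

end OrientationCriteria

/-! ### Coordinates and blocks -/

section Coordinates

attribute [local instance] LieRing.ofAssociativeRing

/-- Real-linear maps between real normed spaces, with the instances pinned down as in `Endo`. -/
abbrev Homo (E F : Type) [NormedAddCommGroup E] [NormedSpace ℝ E] [NormedAddCommGroup F]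
    [NormedSpace ℝ F] : Type := E →L[ℝ] F

/-- The coordinates `((A₁₂, A₂₃), A₁₃)` on `heis`. -/
def heisLinearEquiv : heis ≃ₗ[ℝ] Plane × ℂ where
  toFun A := ((A.1 0 1, A.1 1 2), A.1 0 2)
  map_add' _ _ := rfl
  map_smul' _ _ := rfl
  invFun p := ⟨!![0, p.1.1, p.2; 0, 0, p.1.2; 0, 0, 0], fun i j h => by
    fin_cases i <;> fin_cases j <;> simp_all⟩
  left_inv A := by
    apply Subtype.ext
    ext i j
    have h : ∀ i j : Fin 3, j ≤ i → A.1 i j = 0 := A.2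
    fin_cases i <;> fin_cases j <;> simp [h]
  right_inv p := by simp

/-- The coordinates on `heis` as a homeomorphism onto `ℂ² × ℂ`. -/
def coord : heis ≃L[ℝ] Plane × ℂ where
  toLinearEquiv := heisLinearEquiv
  continuous_toFun := by
    have h : ∀ i j, Continuous fun A : heis => A.1 i j := fun i j =>
      (continuous_apply_apply i j).comp continuous_subtype_val
    exact ((h 0 1).prodMk (h 1 2)).prodMk (h 0 2)
  continuous_invFun := by
    refine Continuous.subtype_mk ?_ _
    refine continuous_matrix fun i j => ?_
    fin_cases i <;> fin_cases j <;> simp <;> fun_prop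

theorem coord_lie (A B : heis) : coord ⁅A, B⁆ = (0, area (coord A).1 (coord B).1) := by
  have hA : ∀ i j : Fin 3, j ≤ i → A.1 i j = 0 := A.2
  have hB : ∀ i j : Fin 3, j ≤ i → B.1 i j = 0 := B.2
  have h : ∀ i j, (⁅A, B⁆ : heis).1 i j = (A.1 * B.1 - B.1 * A.1) i j := fun i j => rfl
  refine Prod.ext (Prod.ext ?_ ?_) ?_
  · change (⁅A, B⁆ : heis).1 0 1 = 0
    rw [h]; simp [Matrix.mul_apply, Fin.sum_univ_three, hA, hB]
  · change (⁅A, B⁆ : heis).1 1 2 = 0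
    rw [h]; simp [Matrix.mul_apply, Fin.sum_univ_three, hA, hB]
  · change (⁅A, B⁆ : heis).1 0 2 = A.1 0 1 * B.1 1 2 - B.1 0 1 * A.1 1 2
    rw [h]; simp [Matrix.mul_apply, Fin.sum_univ_three, hA, hB]

theorem coord_J₀ (A : heis) :
    coord (J₀ A) = (iPlane (coord A).1, iLine (coord A).2) := rfl

/-- The blocks `(a, r, c)` of an endomorphism of `heis` that preserves the centre: it acts as `a`
on the quotient by the centre, as `c` on the centre, and `r` is the remaining component. -/
abbrev Blocks : Type := EndPlane × Homo Plane ℂ × EndLine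

/-- The endomorphism of `heis` with given blocks. -/
def ofBlocks (p : Blocks) : EndHeis :=
  (coord.symm : (Plane × ℂ) →L[ℝ] heis).comp
    (((p.1.comp (ContinuousLinearMap.fst ℝ Plane ℂ)).prod
      (p.2.1.comp (ContinuousLinearMap.fst ℝ Plane ℂ) +
        p.2.2.comp (ContinuousLinearMap.snd ℝ Plane ℂ))).comp
      (coord : heis →L[ℝ] Plane × ℂ))

/-- The blocks of an endomorphism of `heis`. -/
def toBlocks (J : EndHeis) : Blocks :=
  let T : Endo (Plane × ℂ) := (coord : heis →L[ℝ] Plane × ℂ).comp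
    (J.comp (coord.symm : (Plane × ℂ) →L[ℝ] heis))
  ((ContinuousLinearMap.fst ℝ Plane ℂ).comp (T.comp (ContinuousLinearMap.inl ℝ Plane ℂ)),
    (ContinuousLinearMap.snd ℝ Plane ℂ).comp (T.comp (ContinuousLinearMap.inl ℝ Plane ℂ)),
    (ContinuousLinearMap.snd ℝ Plane ℂ).comp (T.comp (ContinuousLinearMap.inr ℝ Plane ℂ)))

theorem coord_ofBlocks (p : Blocks) (A : heis) :
    coord (ofBlocks p A) =
      (p.1 (coord A).1, p.2.1 (coord A).1 + p.2.2 (coord A).2) := by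
  simp [ofBlocks]

theorem toBlocks_ofBlocks (p : Blocks) : toBlocks (ofBlocks p) = p := by
  refine Prod.ext ?_ (Prod.ext ?_ ?_)
  · refine ContinuousLinearMap.ext fun u => ?_
    simp [toBlocks, coord_ofBlocks]
  · refine ContinuousLinearMap.ext fun u => ?_
    simp [toBlocks, coord_ofBlocks]
  · refine ContinuousLinearMap.ext fun u => ?_
    simp [toBlocks, coord_ofBlocks]

theorem continuous_toBlocks : Continuous toBlocks := by
  have h : Continuous fun J : EndHeis => ((coord : heis →L[ℝ] Plane × ℂ).comp
    (J.comp (coord.symm : (Plane × ℂ) →L[ℝ] heis)) : Endo (Plane × ℂ)) :=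
    ((ContinuousLinearMap.postcomp _ (coord : heis →L[ℝ] Plane × ℂ)).continuous).comp
      ((ContinuousLinearMap.precomp _ (coord.symm : (Plane × ℂ) →L[ℝ] heis)).continuous)
  exact (continuous_const.clm_comp (h.clm_comp continuous_const)).prodMk
    ((continuous_const.clm_comp (h.clm_comp continuous_const)).prodMk
      (continuous_const.clm_comp (h.clm_comp continuous_const)))

theorem continuous_ofBlocks : Continuous ofBlocks := by
  have h : Continuous fun p : Blocks => ((p.1.comp (ContinuousLinearMap.fst ℝ Plane ℂ)).prod
      (p.2.1.comp (ContinuousLinearMap.fst ℝ Plane ℂ) +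
        p.2.2.comp (ContinuousLinearMap.snd ℝ Plane ℂ)) : Endo (Plane × ℂ)) := by
    have h1 : Continuous fun p : Blocks =>
        ((ContinuousLinearMap.inl ℝ Plane ℂ).comp (p.1.comp (ContinuousLinearMap.fst ℝ Plane ℂ)) +
        (ContinuousLinearMap.inr ℝ Plane ℂ).comp
          (p.2.1.comp (ContinuousLinearMap.fst ℝ Plane ℂ) +
            p.2.2.comp (ContinuousLinearMap.snd ℝ Plane ℂ)) : Endo (Plane × ℂ)) :=
      (continuous_const.clm_comp (continuous_fst.clm_comp continuous_const)).add
        (continuous_const.clm_comp ((continuous_snd.fst.clm_comp continuous_const).add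
          (continuous_snd.snd.clm_comp continuous_const)))
    convert h1 using 2 with p
    exact ContinuousLinearMap.ext fun q => by simp
  exact ((ContinuousLinearMap.postcomp _ (coord.symm : (Plane × ℂ) →L[ℝ] heis)).continuous).comp
      (((ContinuousLinearMap.precomp _ (coord : heis →L[ℝ] Plane × ℂ)).continuous).comp h)

/-- `J` preserves the centre of `heis`. -/
def PreservesCentre (J : EndHeis) : Prop := ∀ A, (coord A).1 = 0 → (coord (J A)).1 = 0

theorem PreservesCentre.ofBlocks_toBlocks {J : EndHeis} (h : PreservesCentre J) :
    ofBlocks (toBlocks J) = J := by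
  refine ContinuousLinearMap.ext fun A => coord.injective ?_
  have hA : A = coord.symm ((coord A).1, 0) + coord.symm (0, (coord A).2) := by
    rw [← map_add]; simp
  have h0 : (coord (J (coord.symm (0, (coord A).2)))).1 = 0 := h _ (by simp)
  rw [coord_ofBlocks]
  conv_rhs => rw [hA, map_add, map_add]
  refine Prod.ext ?_ ?_
  · simp [toBlocks, h0]
  · simp [toBlocks]

/-- If `A` is central and `J A` is not, then `A = ⁅J A, B⁆` for some `B`, and integrability, applied
to `A` and `B`, says `J A = 0` modulo the centre. -/
theorem preservesCentre_of_isIntegrable {J : EndHeis} (h : IsIntegrable J) :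
    PreservesCentre J := by
  intro A hA
  by_contra hu
  set u := (coord (J A)).1 with hu'
  have hex : ∃ v : Plane, area u v = (coord A).2 := by
    by_cases h1 : u.1 = 0
    · have h2 : u.2 ≠ 0 := fun h2 => hu (Prod.ext h1 h2)
      exact ⟨(-(coord A).2 / u.2, 0), by simp [area]; field_simp⟩
    · exact ⟨(0, (coord A).2 / u.1), by simp [area]; field_simp⟩
  obtain ⟨v, hv⟩ := hex
  have h1 : ⁅A, J (coord.symm (v, 0))⁆ = 0 := coord.injective (by
    rw [coord_lie, hA, map_zero]; simp [area])
  have h2 : ⁅A, (coord.symm (v, 0) : heis)⁆ = 0 := coord.injective (by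
    rw [coord_lie, hA, map_zero]; simp [area])
  have h3 : ⁅J A, (coord.symm (v, 0) : heis)⁆ = A := coord.injective (by
    rw [coord_lie, ← hu', ContinuousLinearEquiv.apply_symm_apply, hv, ← hA])
  have h4 := congrArg (fun X => (coord X).1) (h A (coord.symm (v, 0)))
  rw [h1, h2, h3] at h4
  simp [coord_lie] at h4
  exact hu h4.symm

theorem isAlmostComplex_ofBlocks_iff (p : Blocks) : IsAlmostComplex (ofBlocks p) ↔
    p.1 * p.1 = -1 ∧ p.2.2 * p.2.2 = -1 ∧ ∀ u, p.2.1 (p.1 u) + p.2.2 (p.2.1 u) = 0 := by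
  constructor
  · intro h
    have h' : ∀ q : Plane × ℂ, (p.1 (p.1 q.1), p.2.1 (p.1 q.1) + p.2.2 (p.2.1 q.1 + p.2.2 q.2)) =
        -q := by
      intro q
      have := congrArg coord (h (coord.symm q))
      simpa [coord_ofBlocks] using this
    refine ⟨?_, ?_, fun u => ?_⟩
    · exact ContinuousLinearMap.ext fun u => congrArg Prod.fst (h' (u, 0))
    · refine ContinuousLinearMap.ext fun w => ?_
      have := congrArg Prod.snd (h' (0, w))
      simpa using this
    · have := congrArg Prod.snd (h' (u, 0))
      simpa using this
  · rintro ⟨h1, h2, h3⟩ A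
    apply coord.injective
    have h1' := apply_apply_of_sq h1 (coord A).1
    have h2' := apply_apply_of_sq h2 (coord A).2
    rw [coord_ofBlocks, coord_ofBlocks, map_neg]
    refine Prod.ext h1' ?_
    change _ + p.2.2 (_ + _) = _
    rw [map_add, ← add_assoc, h3, zero_add, h2']
    rfl

theorem isIntegrable_ofBlocks_iff (p : Blocks) :
    IsIntegrable (ofBlocks p) ↔ IntPair p.1 p.2.2 := by
  have key : ∀ A B, (⁅ofBlocks p A, ofBlocks p B⁆ = ⁅A, B⁆ + ofBlocks p ⁅ofBlocks p A, B⁆ +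
      ofBlocks p ⁅A, ofBlocks p B⁆) ↔ area (p.1 (coord A).1) (p.1 (coord B).1) =
      area (coord A).1 (coord B).1 + p.2.2 (area (p.1 (coord A).1) (coord B).1) +
        p.2.2 (area (coord A).1 (p.1 (coord B).1)) := by
    intro A B
    rw [← coord.injective.eq_iff]
    simp [coord_lie, coord_ofBlocks]
  constructor
  · intro h u v
    simpa using (key (coord.symm (u, 0)) (coord.symm (v, 0))).1 (h _ _)
  · intro h A B
    exact (key A B).2 (h _ _)

end Coordinates

/-! ### The positive and negative structures in terms of blocks -/

section Translation

attribute [local instance] LieRing.ofAssociativeRing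

theorem finrank_plane : Module.finrank ℝ Plane = 2 * 2 := by simp [Complex.finrank_real_complex]

theorem finrank_heis : Module.finrank ℝ heis = 3 * 2 := by
  rw [coord.toLinearEquiv.finrank_eq]
  simp [Complex.finrank_real_complex]

instance : FiniteDimensional ℝ heis :=
  LinearEquiv.finiteDimensional coord.toLinearEquiv.symm

theorem J₀_eq : J₀ = ofBlocks (iPlane, 0, iLine) := by
  refine ContinuousLinearMap.ext fun A => coord.injective ?_
  rw [coord_J₀, coord_ofBlocks]
  simp

theorem isAlmostComplex_J₀ : IsAlmostComplex J₀ := by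
  rw [J₀_eq, isAlmostComplex_ofBlocks_iff]
  exact ⟨iPlane_sq, iLine_sq, fun u => by simp⟩

/-- The orientation of `J` is the product of the orientations of the structures induced on the
quotient by the centre and on the centre. -/
theorem sameOrientation_ofBlocks_iff {p : Blocks} (h : IsAlmostComplex (ofBlocks p)) :
    SameOrientation 3 (ofBlocks p : heis →ₗ[ℝ] heis) J₀ ↔
      (SameOrL p.1 iPlane ∧ SameOrL p.2.2 iLine) ∨ (OppOrL p.1 iPlane ∧ OppOrL p.2.2 iLine) := by
  obtain ⟨a, r, c⟩ := p
  have h0 := h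
  rw [isAlmostComplex_ofBlocks_iff] at h
  obtain ⟨ha, hc, hr⟩ := h
  dsimp only at ha hc hr
  rw [sameOrientation_iff finrank_heis h0 isAlmostComplex_J₀]
  -- the off-diagonal block is deformed to zero
  let f : ℝ → Endo (Plane × ℂ) := fun t =>
    (ContinuousLinearMap.inl ℝ Plane ℂ).comp (a.comp (ContinuousLinearMap.fst ℝ Plane ℂ)) +
        (ContinuousLinearMap.inr ℝ Plane ℂ).comp
          (t • r.comp (ContinuousLinearMap.fst ℝ Plane ℂ) +
            c.comp (ContinuousLinearMap.snd ℝ Plane ℂ))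
  have hf : ∀ t q, f t q = (a q.1, t • r q.1 + c q.2) := fun t q => by
    simp [f]
  have hfc : Continuous f := by
    refine continuous_const.add (continuous_const.clm_comp (Continuous.add ?_ continuous_const))
    exact continuous_id.smul continuous_const
  have hp : SameOrL (f 1) (f 0) := by
    refine sameOr_of_path hfc.continuousOn (fun t _ q => ?_) ⟨zero_le_one, le_rfl⟩
      ⟨le_rfl, zero_le_one⟩
    have h1 := apply_apply_of_sq ha q.1
    have h2 := apply_apply_of_sq hc q.2
    have h3 := hr q.1
    rw [hf, hf, map_add, map_smul, h1, h2, ← add_assoc, ← smul_add, h3, smul_zero, zero_add]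
    rfl
  have h1 : SameOr (ofBlocks (a, r, c) : heis →ₗ[ℝ] heis) J₀ ↔
      SameOr ((f 1 : Endo (Plane × ℂ)) : (Plane × ℂ) →ₗ[ℝ] (Plane × ℂ))
        ((iPlane : Plane →ₗ[ℝ] Plane).prodMap (iLine : ℂ →ₗ[ℝ] ℂ)) := by
    have e1 : ∀ A, coord.toLinearEquiv ((ofBlocks (a, r, c) : heis →ₗ[ℝ] heis) A) =
        ((f 1 : Endo (Plane × ℂ)) : (Plane × ℂ) →ₗ[ℝ] (Plane × ℂ)) (coord.toLinearEquiv A) := by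
      intro A
      change coord _ = f 1 (coord A)
      rw [hf]
      simp [coord_ofBlocks]
    have e2 : ∀ A, coord.toLinearEquiv ((J₀ : heis →ₗ[ℝ] heis) A) =
        ((iPlane : Plane →ₗ[ℝ] Plane).prodMap (iLine : ℂ →ₗ[ℝ] ℂ)) (coord.toLinearEquiv A) :=
      coord_J₀
    constructor
    · exact fun h => h.map coord.toLinearEquiv e1 e2
    · refine fun h => h.map coord.toLinearEquiv.symm (fun q => ?_) (fun q => ?_)
      · rw [LinearEquiv.symm_apply_eq, e1, LinearEquiv.apply_symm_apply]
      · rw [LinearEquiv.symm_apply_eq, e2, LinearEquiv.apply_symm_apply]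
  have h2 : ((f 0 : Endo (Plane × ℂ)) : (Plane × ℂ) →ₗ[ℝ] (Plane × ℂ)) =
      (a : Plane →ₗ[ℝ] Plane).prodMap (c : ℂ →ₗ[ℝ] ℂ) := by
    refine LinearMap.ext fun q => ?_
    change f 0 q = _
    rw [hf]
    simp
  rw [h1]
  rw [SameOrL, h2] at hp
  have hac : ∀ q, (a : Plane →ₗ[ℝ] Plane).prodMap (c : ℂ →ₗ[ℝ] ℂ)
      ((a : Plane →ₗ[ℝ] Plane).prodMap (c : ℂ →ₗ[ℝ] ℂ) q) = -q := fun q =>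
    Prod.ext (apply_apply_of_sq ha q.1) (apply_apply_of_sq hc q.2)
  constructor
  · intro hs
    have hs' := hp.symm.trans hs
    rcases sameOr_or_oppOr finrank_plane (apply_apply_of_sq ha) (apply_apply_of_sq iPlane_sq)
      with h3 | h3 <;>
    rcases sameOr_or_oppOr (n := 1) (by simp [Complex.finrank_real_complex])
      (apply_apply_of_sq hc) (apply_apply_of_sq iLine_sq) with h4 | h4
    · exact Or.inl ⟨h3, h4⟩
    · exact absurd (h3.prodMap_opp h4) (hs'.not_oppOr hac)
    · exact absurd (h3.prodMap_same h4) (hs'.not_oppOr hac)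
    · exact Or.inr ⟨h3, h4⟩
  · rintro (⟨h3, h4⟩ | ⟨h3, h4⟩)
    · exact hp.trans (h3.prodMap h4)
    · exact hp.trans (h3.prodMap h4)

/-- The closed forms are the real-linear forms on the quotient of `heis` by its centre. -/
def closedFormsEquiv : closedForms ≃ₗ[ℝ] Module.Dual ℝ Plane where
  toFun α := α.1 ∘ₗ (coord.symm.toLinearEquiv : (Plane × ℂ) →ₗ[ℝ] heis) ∘ₗ LinearMap.inl ℝ Plane ℂ
  map_add' _ _ := rfl
  map_smul' _ _ := rfl
  invFun β := ⟨β ∘ₗ LinearMap.fst ℝ Plane ℂ ∘ₗ (coord.toLinearEquiv : heis →ₗ[ℝ] Plane × ℂ),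
    fun A B => by
      change β (coord ⁅A, B⁆).1 = 0
      rw [coord_lie, map_zero]⟩
  left_inv α := by
    apply Subtype.ext
    refine LinearMap.ext fun A => ?_
    change α.1 (coord.symm ((coord A).1, 0)) = α.1 A
    have h1 : ⁅(coord.symm ((1, 0), 0) : heis), (coord.symm ((0, (coord A).2), 0) : heis)⁆ =
        coord.symm (0, (coord A).2) := coord.injective (by simp [coord_lie, area])
    have h2 : α.1 (coord.symm (0, (coord A).2)) = 0 := by rw [← h1]; exact α.2 _ _
    have h3 : A = coord.symm ((coord A).1, 0) + coord.symm (0, (coord A).2) := by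
      rw [← map_add]; simp
    conv_rhs => rw [h3, map_add, h2, add_zero]
  right_inv β := by
    refine LinearMap.ext fun v => ?_
    change β (coord (coord.symm (v, 0))).1 = β v
    rw [ContinuousLinearEquiv.apply_symm_apply]

theorem closedFormsEquiv_apply (α : closedForms) (v : Plane) :
    closedFormsEquiv α v = α.1 (coord.symm (v, 0)) := rfl

theorem closedForms_apply (α : closedForms) (A : heis) :
    α.1 A = closedFormsEquiv α (coord A).1 := by
  conv_lhs => rw [← closedFormsEquiv.symm_apply_apply α]
  rfl

/-- `J` acts on the closed forms only if it preserves the centre. -/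
theorem IsHat.preservesCentre {J : EndHeis} {K : closedForms →ₗ[ℝ] closedForms}
    (h : IsHat J K) : PreservesCentre J := by
  intro A hA
  have h1 : ∀ β : Module.Dual ℝ Plane, β (coord (J A)).1 = 0 := by
    intro β
    have := h (closedFormsEquiv.symm β) A
    rw [closedForms_apply, closedForms_apply, hA, map_zero, LinearEquiv.apply_symm_apply] at this
    exact this.symm
  exact (Module.forall_dual_apply_eq_zero_iff ℝ _).1 h1

theorem isHat_ofBlocks_iff (p : Blocks) (K : closedForms →ₗ[ℝ] closedForms) :
    IsHat (ofBlocks p) K ↔ ∀ α, closedFormsEquiv (K α) =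
      (p.1 : Plane →ₗ[ℝ] Plane).dualMap (closedFormsEquiv α) := by
  constructor
  · intro h α
    refine LinearMap.ext fun v => ?_
    rw [closedFormsEquiv_apply, h, closedForms_apply, coord_ofBlocks]
    simp
  · intro h α A
    rw [closedForms_apply, h, closedForms_apply, coord_ofBlocks]
    rfl

/-- The endomorphism of the closed forms induced by the block `a`. -/
def hat (a : EndPlane) : closedForms →ₗ[ℝ] closedForms :=
  (closedFormsEquiv.symm : Module.Dual ℝ Plane →ₗ[ℝ] closedForms) ∘ₗ
    (a : Plane →ₗ[ℝ] Plane).dualMap ∘ₗ (closedFormsEquiv : closedForms →ₗ[ℝ] Module.Dual ℝ Plane)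

theorem closedFormsEquiv_hat (a : EndPlane) (α : closedForms) : closedFormsEquiv (hat a α) =
    (a : Plane →ₗ[ℝ] Plane).dualMap (closedFormsEquiv α) := by
  simp [hat]

theorem IsHat.eq_hat {p : Blocks} {K : closedForms →ₗ[ℝ] closedForms}
    (h : IsHat (ofBlocks p) K) : K = hat p.1 := by
  refine LinearMap.ext fun α => closedFormsEquiv.injective ?_
  rw [(isHat_ofBlocks_iff p K).1 h, closedFormsEquiv_hat]

theorem isHat_hat (p : Blocks) : IsHat (ofBlocks p) (hat p.1) :=
  (isHat_ofBlocks_iff p _).2 (closedFormsEquiv_hat p.1)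

theorem hat_sq {a : EndPlane} (ha : a * a = -1) (α : closedForms) : hat a (hat a α) = -α := by
  apply closedFormsEquiv.injective
  rw [closedFormsEquiv_hat, closedFormsEquiv_hat]
  refine LinearMap.ext fun v => ?_
  have h := apply_apply_of_sq ha v
  change closedFormsEquiv α (a (a v)) = _
  rw [h]
  exact map_neg (closedFormsEquiv α) v

instance : FiniteDimensional ℝ closedForms :=
  LinearEquiv.finiteDimensional closedFormsEquiv.symm

theorem finrank_closedForms : Module.finrank ℝ closedForms = 2 * 2 := by
  rw [closedFormsEquiv.finrank_eq, Subspace.dual_finrank_eq, finrank_plane]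

theorem sameOr_hat {a b : EndPlane} (h : SameOrL a b) : SameOr (E := closedForms) (hat a) (hat b) :=
  h.dualMap.map (F := closedForms) closedFormsEquiv.symm (fun β => by simp [hat])
    (fun β => by simp [hat])

theorem oppOr_hat {a b : EndPlane} (h : OppOrL a b) : OppOr (E := closedForms) (hat a) (hat b) :=
  h.dualMap.map (F := closedForms) closedFormsEquiv.symm (fun β => by simp [hat])
    (fun β => by simp [hat])

theorem sameOr_hat_iff {a b : EndPlane} (ha : a * a = -1) (hb : b * b = -1) :
    SameOr (E := closedForms) (hat a) (hat b) ↔ SameOrL a b := by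
  refine ⟨fun h => ?_, sameOr_hat⟩
  exact (sameOr_or_oppOr finrank_plane (apply_apply_of_sq ha) (apply_apply_of_sq hb)).resolve_right
    fun h' => h.not_oppOr (hat_sq ha) (oppOr_hat h')

theorem oppOr_hat_iff {a b : EndPlane} (ha : a * a = -1) (hb : b * b = -1) :
    OppOr (E := closedForms) (hat a) (hat b) ↔ OppOrL a b := by
  refine ⟨fun h => ?_, oppOr_hat⟩
  exact (sameOr_or_oppOr finrank_plane (apply_apply_of_sq ha) (apply_apply_of_sq hb)).resolve_left
    fun h' => (sameOr_hat h').not_oppOr (hat_sq ha) h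

theorem hatPositive_ofBlocks_iff {p : Blocks} (ha : p.1 * p.1 = -1) :
    HatPositive (ofBlocks p) ↔ SameOrL p.1 iPlane := by
  rw [← sameOr_hat_iff ha iPlane_sq,
    ← sameOrientation_iff finrank_closedForms (hat_sq ha) (hat_sq iPlane_sq)]
  constructor
  · rintro ⟨K, K₀, hK, hK₀, h⟩
    rw [J₀_eq] at hK₀
    rwa [hK.eq_hat, hK₀.eq_hat] at h
  · exact fun h => ⟨_, _, isHat_hat p, by rw [J₀_eq]; exact isHat_hat _, h⟩

theorem hatNegative_ofBlocks_iff {p : Blocks} (ha : p.1 * p.1 = -1) :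
    HatNegative (ofBlocks p) ↔ OppOrL p.1 iPlane := by
  rw [← oppOr_hat_iff ha iPlane_sq,
    ← oppositeOrientation_iff finrank_closedForms (hat_sq ha) (hat_sq iPlane_sq)]
  constructor
  · rintro ⟨K, K₀, hK, hK₀, h⟩
    rw [J₀_eq] at hK₀
    rwa [hK.eq_hat, hK₀.eq_hat] at h
  · exact fun h => ⟨_, _, isHat_hat p, by rw [J₀_eq]; exact isHat_hat _, h⟩

/-- The algebraic conditions on the blocks of a complex structure. -/
def IsStructure (p : Blocks) : Prop :=
  p.1 * p.1 = -1 ∧ p.2.2 * p.2.2 = -1 ∧ (∀ u, p.2.1 (p.1 u) + p.2.2 (p.2.1 u) = 0) ∧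
    IntPair p.1 p.2.2

/-- The blocks of the elements of `cPlus`. -/
def plusBlocks : Set Blocks := {p | IsStructure p ∧ 0 < sgnLine p.2.2 ∧ 0 < xi p.1}

/-- The blocks of the elements of `cMinus`. -/
def minusBlocks : Set Blocks := {p | IsStructure p ∧ sgnLine p.2.2 < 0 ∧ 0 ≤ xi p.1}

theorem sgnLine_ne_zero {c : EndLine} (hc : c * c = -1) : sgnLine c ≠ 0 := by
  intro h
  have := one_le_sgnLine_sq hc
  rw [h] at this
  norm_num at this

theorem sameOrL_iLine_iff {c : EndLine} (hc : c * c = -1) :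
    SameOrL c iLine ↔ 0 < sgnLine c := by
  refine ⟨fun h => ?_, sameOrL_iLine hc⟩
  rcases (sgnLine_ne_zero hc).lt_or_gt with h' | h'
  · exact absurd (oppOrL_iLine hc h') (h.not_oppOr (apply_apply_of_sq hc))
  · exact h'

theorem oppOrL_iLine_iff {c : EndLine} (hc : c * c = -1) :
    OppOrL c iLine ↔ sgnLine c < 0 := by
  refine ⟨fun h => ?_, oppOrL_iLine hc⟩
  rcases (sgnLine_ne_zero hc).lt_or_gt with h' | h'
  · exact h'
  · exact absurd h ((sameOrL_iLine hc h').not_oppOr (apply_apply_of_sq hc))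

theorem IntPair.sameOrL_iff {a : EndPlane} {c : EndLine} (ha : a * a = -1) (hc : c * c = -1)
    (h : IntPair a c) : SameOrL a iPlane ↔ 0 < sgnLine c * xi a := by
  rcases h.orientation ha hc with ⟨h1, h2⟩ | ⟨h1, h2⟩
  · exact ⟨fun _ => h1, fun _ => h2⟩
  · exact ⟨fun h3 => absurd h2 (h3.not_oppOr (apply_apply_of_sq ha)), fun h3 => absurd h3 h1.not_gt⟩

theorem IntPair.oppOrL_iff {a : EndPlane} {c : EndLine} (ha : a * a = -1) (hc : c * c = -1)
    (h : IntPair a c) : OppOrL a iPlane ↔ sgnLine c * xi a ≤ 0 := by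
  rcases h.orientation ha hc with ⟨h1, h2⟩ | ⟨h1, h2⟩
  · exact ⟨fun h3 => absurd h3 (h2.not_oppOr (apply_apply_of_sq ha)), fun h3 => absurd h1 h3.not_gt⟩
  · exact ⟨fun _ => h1, fun _ => h2⟩

theorem ofBlocks_mem_iff (p : Blocks) : ofBlocks p ∈ complexStructures ↔
    p ∈ plusBlocks ∨ p ∈ minusBlocks := by
  have key : IsStructure p → ((SameOrL p.1 iPlane ∧ SameOrL p.2.2 iLine) ∨
      (OppOrL p.1 iPlane ∧ OppOrL p.2.2 iLine) ↔ (0 < sgnLine p.2.2 ∧ 0 < xi p.1) ∨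
        (sgnLine p.2.2 < 0 ∧ 0 ≤ xi p.1)) := by
    rintro ⟨ha, hc, -, h⟩
    rw [h.sameOrL_iff ha hc, h.oppOrL_iff ha hc, sameOrL_iLine_iff hc, oppOrL_iLine_iff hc]
    constructor
    · rintro (⟨h1, h2⟩ | ⟨h1, h2⟩)
      · exact Or.inl ⟨h2, pos_of_mul_pos_right h1 h2.le⟩
      · exact Or.inr ⟨h2, by nlinarith⟩
    · rintro (⟨h1, h2⟩ | ⟨h1, h2⟩)
      · exact Or.inl ⟨mul_pos h1 h2, h1⟩
      · exact Or.inr ⟨mul_nonpos_of_nonpos_of_nonneg h1.le h2, h1⟩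
  constructor
  · rintro ⟨h1, h2, h3⟩
    have hs : IsStructure p := by
      have := (isAlmostComplex_ofBlocks_iff p).1 h1
      exact ⟨this.1, this.2.1, this.2.2, (isIntegrable_ofBlocks_iff p).1 h2⟩
    rw [sameOrientation_ofBlocks_iff h1, key hs] at h3
    exact h3.imp (fun h => ⟨hs, h⟩) fun h => ⟨hs, h⟩
  · intro h
    have hs : IsStructure p := h.elim And.left And.left
    have h1 := (isAlmostComplex_ofBlocks_iff p).2 ⟨hs.1, hs.2.1, hs.2.2.1⟩
    refine ⟨h1, (isIntegrable_ofBlocks_iff p).2 hs.2.2.2, ?_⟩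
    rw [sameOrientation_ofBlocks_iff h1, key hs]
    exact h.imp And.right And.right

theorem ofBlocks_mem_cPlus_iff (p : Blocks) : ofBlocks p ∈ cPlus ↔ p ∈ plusBlocks := by
  change (ofBlocks p ∈ complexStructures ∧ HatPositive (ofBlocks p)) ↔ _
  rw [ofBlocks_mem_iff]
  constructor
  · rintro ⟨h | h, h'⟩
    · exact h
    · obtain ⟨⟨ha, hc, -, hi⟩, h1, h2⟩ := h
      rw [hatPositive_ofBlocks_iff ha, hi.sameOrL_iff ha hc] at h'
      exact absurd h' (mul_nonpos_of_nonpos_of_nonneg h1.le h2).not_gt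
  · intro h
    obtain ⟨⟨ha, hc, -, hi⟩, h1, h2⟩ := id h
    refine ⟨Or.inl h, ?_⟩
    rw [hatPositive_ofBlocks_iff ha, hi.sameOrL_iff ha hc]
    exact mul_pos h1 h2

theorem ofBlocks_mem_cMinus_iff (p : Blocks) : ofBlocks p ∈ cMinus ↔ p ∈ minusBlocks := by
  change (ofBlocks p ∈ complexStructures ∧ HatNegative (ofBlocks p)) ↔ _
  rw [ofBlocks_mem_iff]
  constructor
  · rintro ⟨h | h, h'⟩
    · obtain ⟨⟨ha, hc, -, hi⟩, h1, h2⟩ := h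
      rw [hatNegative_ofBlocks_iff ha, hi.oppOrL_iff ha hc] at h'
      exact absurd (mul_pos h1 h2) h'.not_gt
    · exact h
  · intro h
    obtain ⟨⟨ha, hc, -, hi⟩, h1, h2⟩ := id h
    refine ⟨Or.inr h, ?_⟩
    rw [hatNegative_ofBlocks_iff ha, hi.oppOrL_iff ha hc]
    exact mul_nonpos_of_nonpos_of_nonneg h1.le h2

theorem ofBlocks_toBlocks_of_mem {J : EndHeis} (h : J ∈ complexStructures) :
    ofBlocks (toBlocks J) = J :=
  (preservesCentre_of_isIntegrable h.2.1).ofBlocks_toBlocks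

theorem complexStructures_eq : complexStructures = cPlus ∪ cMinus := by
  ext J
  constructor
  · intro h
    have hJ := ofBlocks_toBlocks_of_mem h
    rw [← hJ, ofBlocks_mem_iff] at h
    rw [← hJ]
    exact h.imp (ofBlocks_mem_cPlus_iff _).2 (ofBlocks_mem_cMinus_iff _).2
  · rintro (h | h)
    · exact h.1
    · exact h.1

/-- A set of endomorphisms preserving the centre is homeomorphic to the set of their blocks. -/
def blocksHomeomorph {S : Set EndHeis} {S' : Set Blocks} (h : ∀ p, ofBlocks p ∈ S ↔ p ∈ S')
    (hS : ∀ J ∈ S, ofBlocks (toBlocks J) = J) : S ≃ₜ S' where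
  toFun J := ⟨toBlocks J, by rw [← h, hS J J.2]; exact J.2⟩
  invFun p := ⟨ofBlocks p, (h p).2 p.2⟩
  left_inv J := Subtype.ext (hS J J.2)
  right_inv p := Subtype.ext (toBlocks_ofBlocks p)
  continuous_toFun := (continuous_toBlocks.comp continuous_subtype_val).subtype_mk _
  continuous_invFun := (continuous_ofBlocks.comp continuous_subtype_val).subtype_mk _

end Translation

/-! ### Deformations of the two components -/

section Deformations

open Set

theorem IsStructure.mem_plusBlocks_iff {p : Blocks} (h : IsStructure p) :
    p ∈ plusBlocks ↔ SameOrL p.1 iPlane ∧ SameOrL p.2.2 iLine := by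
  obtain ⟨ha, hc, -, hi⟩ := id h
  rw [hi.sameOrL_iff ha hc, sameOrL_iLine_iff hc]
  exact ⟨fun h' => ⟨mul_pos h'.2.1 h'.2.2, h'.2.1⟩,
    fun h' => ⟨h, h'.2, pos_of_mul_pos_right h'.1 h'.2.le⟩⟩

theorem IsStructure.mem_minusBlocks_iff {p : Blocks} (h : IsStructure p) :
    p ∈ minusBlocks ↔ OppOrL p.1 iPlane ∧ OppOrL p.2.2 iLine := by
  obtain ⟨ha, hc, -, hi⟩ := id h
  rw [hi.oppOrL_iff ha hc, oppOrL_iLine_iff hc]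
  exact ⟨fun h' => ⟨mul_nonpos_of_nonpos_of_nonneg h'.2.1.le h'.2.2, h'.2.1⟩,
    fun h' => ⟨h, h'.2, by nlinarith [h'.1, h'.2]⟩⟩

/-- The off-diagonal block can be scaled to zero. -/
theorem IsStructure.smul {p : Blocks} (h : IsStructure p) (t : ℝ) :
    IsStructure (p.1, t • p.2.1, p.2.2) := by
  refine ⟨h.1, h.2.1, fun u => ?_, h.2.2.2⟩
  have := h.2.2.1 u
  change t • p.2.1 (p.1 u) + p.2.2 (t • p.2.1 u) = 0
  rw [map_smul, ← smul_add, this, smul_zero]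

theorem nonempty_homotopyEquiv_diagonal {S : Set Blocks}
    (hS : ∀ p ∈ S, ∀ t : ℝ, (p.1, t • p.2.1, p.2.2) ∈ S) :
    Nonempty (S ≃ₕ {p ∈ S | p.2.1 = 0}) := by
  refine homotopyEquiv_of_deformation (fun p hp => hp.1)
    (fun q => (q.2.1, q.1 • q.2.2.1, q.2.2.2)) ?_ (fun t _ p hp => hS p hp t) ?_ ?_ ?_
  · exact (continuous_snd.fst.prodMk ((continuous_fst.smul continuous_snd.snd.fst).prodMk
      continuous_snd.snd.snd)).continuousOn
  · exact fun p _ => Prod.ext rfl (Prod.ext (one_smul _ _) rfl)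
  · exact fun p hp => ⟨hS p hp 0, zero_smul _ _⟩
  · rintro p ⟨hp, h0⟩
    exact Prod.ext rfl (Prod.ext (by simp [h0]) rfl)

theorem unit_of_interpolate {R : Type} [NormedRing R] [NormedAlgebra ℝ R] {J K : R}
    (h : ∀ t ∈ Icc (0 : ℝ) 1, IsUnit ((1 + t) • K + (1 - t) • J)) : IsUnit (J + K) := by
  have := h 0 ⟨le_rfl, zero_le_one⟩
  simpa [add_comm] using this

theorem unit_one_add_of_interpolate {R : Type} [NormedRing R] [NormedAlgebra ℝ R] {J K : R}
    (h : ∀ t ∈ Icc (0 : ℝ) 1, IsUnit ((1 + t) • K + (1 - t) • J)) :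
    IsUnit (1 + cayley K J) := by
  have := isUnit_one_add_smul_cayley h (t := 1) ⟨zero_le_one, le_rfl⟩
  rwa [one_smul] at this

theorem sq_mem_Icc {t : ℝ} (ht : t ∈ Icc (0 : ℝ) 1) : t ^ 2 ∈ Icc (0 : ℝ) 1 :=
  ⟨sq_nonneg t, pow_le_one₀ ht.1 ht.2⟩

theorem isStructure_of_diagonal {a : EndPlane} {c : EndLine} (ha : a * a = -1) (hc : c * c = -1)
    (h : IntPair a c) : IsStructure (a, 0, c) := ⟨ha, hc, fun u => by simp, h⟩

theorem plusBlocks_interpolate {p : Blocks} (hp : p ∈ plusBlocks) :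
    (∀ t ∈ Icc (0 : ℝ) 1, IsUnit ((1 + t) • iPlane + (1 - t) • p.1)) ∧
      ∀ t ∈ Icc (0 : ℝ) 1, IsUnit ((1 + t) • iLine + (1 - t) • p.2.2) := by
  obtain ⟨⟨ha, hc, -, hi⟩, hx, hξ⟩ := hp
  refine ⟨fun t ht => ?_, fun t ht => isUnit_interpolate_iLine hc hx ht⟩
  have := mul_pos hx hξ
  exact isUnit_interpolate_iPlane ha (trC_eq ha) (hi.detC_eq_real ha hc) hξ (by linarith) ht

theorem J₀_blocks_mem : ((iPlane, 0, iLine) : Blocks) ∈ plusBlocks := by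
  have h : IsStructure (iPlane, 0, iLine) := by
    refine isStructure_of_diagonal iPlane_sq iLine_sq fun u v => ?_
    simp only [area, iPlane_apply, iLine_apply]
    have hI := Complex.I_sq
    grind
  rw [h.mem_plusBlocks_iff]
  exact ⟨SameOr.refl _, SameOr.refl _⟩

/-- The positive component is contracted by scaling both Cayley transforms relative to `i`, the one
on the centre with the square of the factor. -/
theorem nonempty_homotopyEquiv_plus :
    Nonempty ({p ∈ plusBlocks | p.2.1 = 0} ≃ₕ ({(iPlane, 0, iLine)} : Set Blocks)) := by
  have hmem : ∀ t ∈ Icc (0 : ℝ) 1, ∀ p ∈ plusBlocks,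
      ((cayleyPath iPlane p.1 t, 0, cayleyPath iLine p.2.2 (t ^ 2)) : Blocks) ∈ plusBlocks := by
    intro t ht p hp
    obtain ⟨h1, h2⟩ := plusBlocks_interpolate hp
    obtain ⟨⟨ha, hc, -, hi⟩, -, -⟩ := hp
    have hu1 := isUnit_one_add_smul_cayley h1 ht
    have hu2 := isUnit_one_add_smul_cayley h2 (sq_mem_Icc ht)
    have hI : IntPair (cayleyPath iPlane p.1 t) (cayleyPath iLine p.2.2 (t ^ 2)) :=
      hi.cayley_iPlane (cayley_mul iPlane_sq ha (unit_of_interpolate h1))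
        (cayley_mul iLine_sq hc (unit_of_interpolate h2))
        (mul_one_add_cayley iPlane_sq ha (unit_of_interpolate h1))
        (unit_one_add_of_interpolate h1) hc
        (mul_one_add_cayley iLine_sq hc (unit_of_interpolate h2)) (unit_of_interpolate h2)
        (cayleyPath_mul hu1) (cayleyPath_mul hu2) hu1
    refine (isStructure_of_diagonal (cayleyPath_sq iPlane_sq hu1) (cayleyPath_sq iLine_sq hu2)
      hI).mem_plusBlocks_iff.2 ⟨sameOrL_cayleyPath iPlane_sq h1 ht,
        sameOrL_cayleyPath iLine_sq h2 (sq_mem_Icc ht)⟩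
  refine homotopyEquiv_of_deformation ?_
    (fun q => (cayleyPath iPlane q.2.1 q.1, 0, cayleyPath iLine q.2.2.2 (q.1 ^ 2))) ?_ ?_ ?_ ?_ ?_
  · rintro _ rfl
    exact ⟨J₀_blocks_mem, rfl⟩
  · refine ContinuousOn.prodMk ?_ (continuousOn_const.prodMk ?_)
    · refine continuousOn_cayleyPath continuousOn_const continuous_snd.fst.continuousOn
        continuous_fst.continuousOn ?_ ?_
      · exact fun q hq => unit_of_interpolate (plusBlocks_interpolate hq.2.1).1
      · exact fun q hq => isUnit_one_add_smul_cayley (plusBlocks_interpolate hq.2.1).1 hq.1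
    · refine continuousOn_cayleyPath continuousOn_const continuous_snd.snd.snd.continuousOn
        (continuous_fst.pow 2).continuousOn ?_ ?_
      · exact fun q hq => unit_of_interpolate (plusBlocks_interpolate hq.2.1).2
      · exact fun q hq => isUnit_one_add_smul_cayley (plusBlocks_interpolate hq.2.1).2
          (sq_mem_Icc hq.1)
  · exact fun t ht p hp => ⟨hmem t ht p hp.1, rfl⟩
  · intro p hp
    obtain ⟨h1, h2⟩ := plusBlocks_interpolate hp.1
    obtain ⟨⟨⟨ha, hc, -, hi⟩, -, -⟩, h0⟩ := hp
    refine Prod.ext ?_ (Prod.ext h0.symm ?_)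
    · exact cayleyPath_one iPlane_sq ha (unit_of_interpolate h1) (unit_one_add_of_interpolate h1)
    · change cayleyPath iLine p.2.2 (1 ^ 2) = _
      rw [one_pow]
      exact cayleyPath_one iLine_sq hc (unit_of_interpolate h2) (unit_one_add_of_interpolate h2)
  · intro p _
    refine Prod.ext cayleyPath_zero (Prod.ext rfl ?_)
    change cayleyPath iLine p.2.2 (0 ^ 2) = _
    rw [zero_pow two_ne_zero, cayleyPath_zero]
  · rintro _ rfl
    exact Prod.ext cayleyPath_zero (Prod.ext rfl cayleyPath_self)

/-- The scalar `s` for which the trace-free part of `a` is `s` times a complex structure. -/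
def splitScale (p : Blocks) : ℝ := √(1 - 2 * sgnLine p.2.2 * xi p.1 + xi p.1 ^ 2)

/-- The trace-free complex-linear complex structure towards which `a` is deformed. -/
def splitBlock (p : Blocks) : EndPlane := splitPart p.1 (splitScale p)

theorem continuous_linPart : Continuous linPart := by
  unfold linPart
  fun_prop

theorem continuous_xi : Continuous xi := by
  have h : Continuous trC :=
    (continuous_linPart.clm_apply continuous_const).fst.add
      (continuous_linPart.clm_apply continuous_const).snd
  exact (Complex.continuous_im.comp h).div_const 2

theorem continuous_sgnLine : Continuous sgnLine := by
  have h : Continuous trLine :=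
    ((continuous_id.clm_apply continuous_const).sub
      (continuous_const.mul (continuous_id.clm_apply continuous_const))).div_const 2
  exact Complex.continuous_im.comp h

theorem continuous_splitScale : Continuous splitScale := by
  have h1 : Continuous fun p : Blocks => xi p.1 := continuous_xi.comp continuous_fst
  have h2 : Continuous fun p : Blocks => sgnLine p.2.2 := continuous_sgnLine.comp
    continuous_snd.snd
  unfold splitScale
  fun_prop

section SplitBlock

open Set

variable {p : Blocks}

theorem splitScale_pos (hp : p ∈ minusBlocks) : 0 < splitScale p ∧
    splitScale p ^ 2 = 1 - 2 * sgnLine p.2.2 * xi p.1 + xi p.1 ^ 2 := by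
  have h : 0 < 1 - 2 * sgnLine p.2.2 * xi p.1 + xi p.1 ^ 2 := by
    nlinarith [hp.2.1, hp.2.2, sq_nonneg (xi p.1)]
  exact ⟨Real.sqrt_pos.2 h, Real.sq_sqrt h.le⟩

theorem splitBlock_sq (hp : p ∈ minusBlocks) : splitBlock p * splitBlock p = -1 := by
  obtain ⟨ha, hc, -, hi⟩ := hp.1
  exact splitPart_sq ha (hi.detC_eq_real ha hc) (splitScale_pos hp).2 (splitScale_pos hp).1

theorem minusBlocks_interpolate (hp : p ∈ minusBlocks) {t : ℝ} (ht : t ∈ Icc (0 : ℝ) 1) :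
    IsUnit ((1 + t) • splitBlock p + (1 - t) • p.1) := by
  obtain ⟨⟨ha, hc, -, hi⟩, h1, h2⟩ := id hp
  exact isUnit_interpolate_splitPart ha (hi.detC_eq_real ha hc) (by nlinarith)
    (splitScale_pos hp).2 (splitScale_pos hp).1 ht

theorem cayleyPath_splitBlock_one (hp : p ∈ minusBlocks) :
    cayleyPath (splitBlock p) p.1 1 = p.1 := by
  have h1 := fun t ht => minusBlocks_interpolate hp (t := t) ht
  have ha : p.1 * p.1 = -1 := hp.1.1
  have hK := splitBlock_sq hp
  exact cayleyPath_one hK ha (unit_of_interpolate h1) (unit_one_add_of_interpolate h1)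

end SplitBlock

/-- The structures in `minusBlocks` that are block diagonal and complex linear and trace free on
the quotient by the centre. -/
def splitBlocks : Set Blocks := {p | (p ∈ minusBlocks ∧ p.2.1 = 0) ∧ p.1 * iPlane = iPlane * p.1 ∧
  ∀ u v, area (p.1 u) v + area u (p.1 v) = 0}

theorem splitBlock_eq_self {p : Blocks} (hp : p ∈ splitBlocks) : splitBlock p = p.1 := by
  obtain ⟨⟨hp1, -⟩, hc, htr⟩ := hp
  have h0 : trC p.1 = 0 := by
    have h1 := htr (1, 0) (0, 1)
    rw [(area_apply_of_commute hc _ _).2] at h1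
    simpa [area] using h1
  have hξ : xi p.1 = 0 := by simp [xi, h0]
  have hs : splitScale p = 1 := by simp [splitScale, hξ]
  rw [splitBlock, hs, splitPart, traceFree, hξ, linPart_of_commute hc]
  simp

theorem intPair_of_commute {a : EndPlane} {c : EndLine} (ha : a * a = -1)
    (htr : ∀ u v, area (a u) v + area u (a v) = 0) : IntPair a c := by
  intro u v
  rw [add_assoc, ← map_add, htr, map_zero, add_zero, area_apply_apply ha htr]

/-- In the negative component, the Cayley transform relative to the split structure is scaled to
zero; the structure on the centre does not change. -/
theorem nonempty_homotopyEquiv_split :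
    Nonempty ({p ∈ minusBlocks | p.2.1 = 0} ≃ₕ splitBlocks) := by
  have hmem : ∀ t ∈ Icc (0 : ℝ) 1, ∀ p ∈ minusBlocks,
      ((cayleyPath (splitBlock p) p.1 t, 0, p.2.2) : Blocks) ∈ minusBlocks := by
    intro t ht p hp
    have h1 := fun t ht => minusBlocks_interpolate hp (t := t) ht
    have hK := splitBlock_sq hp
    obtain ⟨⟨ha, hc, -, hi⟩, hx, -⟩ := id hp
    have hu1 := isUnit_one_add_smul_cayley h1 ht
    have htr : ∀ u v, area (splitBlock p u) v + area u (splitBlock p v) = 0 := area_splitPart ha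
    have hI : IntPair (cayleyPath (splitBlock p) p.1 t) p.2.2 :=
      hi.cayley_of_trace_zero (area_apply_apply hK htr) htr
        (cayley_mul hK ha (unit_of_interpolate h1))
        (mul_one_add_cayley hK ha (unit_of_interpolate h1))
        (unit_one_add_of_interpolate h1) (cayleyPath_mul hu1) hu1
    refine (isStructure_of_diagonal (cayleyPath_sq hK hu1) hc hI).mem_minusBlocks_iff.2
      ⟨?_, (oppOrL_iLine_iff hc).2 hx⟩
    exact (sameOrL_cayleyPath hK h1 ht).trans_opp
      (oppOrL_of_commute hK (splitPart_commute _ _) htr)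
  refine homotopyEquiv_of_deformation (fun p hp => hp.1)
    (fun q => (cayleyPath (splitBlock q.2) q.2.1 q.1, 0, q.2.2.2)) ?_ ?_ ?_ ?_ ?_
  · refine ContinuousOn.prodMk ?_ (continuousOn_const.prodMk continuous_snd.snd.snd.continuousOn)
    refine continuousOn_cayleyPath ?_ continuous_snd.fst.continuousOn
        continuous_fst.continuousOn ?_ ?_
    · have h1 : Continuous fun p : Blocks => traceFree p.1 :=
        (continuous_linPart.comp continuous_fst).sub
          ((continuous_xi.comp continuous_fst).smul continuous_const)
      refine ContinuousOn.smul (ContinuousOn.inv₀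
        (continuous_splitScale.comp continuous_snd).continuousOn ?_)
        (h1.comp continuous_snd).continuousOn
      exact fun q hq => (splitScale_pos hq.2.1).1.ne'
    · exact fun q hq => unit_of_interpolate fun t ht => minusBlocks_interpolate hq.2.1 ht
    · exact fun q hq => isUnit_one_add_smul_cayley
        (fun t ht => minusBlocks_interpolate hq.2.1 ht) hq.1
  · exact fun t ht p hp => ⟨hmem t ht p hp.1, rfl⟩
  · intro p hp
    exact Prod.ext (cayleyPath_splitBlock_one hp.1) (Prod.ext hp.2.symm rfl)
  · intro p hp
    have ha : p.1 * p.1 = -1 := hp.1.1.1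
    have h0 := hmem 0 ⟨le_rfl, zero_le_one⟩ p hp.1
    rw [cayleyPath_zero] at h0
    have hs : ((splitBlock p, 0, p.2.2) : Blocks) ∈ splitBlocks :=
      ⟨⟨h0, rfl⟩, splitPart_commute _ _, area_splitPart ha⟩
    rwa [← cayleyPath_zero (K := splitBlock p) (J := p.1)] at hs
  · intro p hp
    refine Prod.ext ?_ (Prod.ext hp.1.2.symm rfl)
    exact cayleyPath_zero.trans (splitBlock_eq_self hp)

end Deformations

/-! ### Deformation to the unitary structures -/

section Unitary

open Set

/-- The antilinear quaternionic structure on `ℂ²`. For a trace-free complex-linear `a`, the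
operator `quat * a * quat` is the adjoint of `a`. -/
def quat : EndPlane :=
  (-((Complex.conjCLE : EndLine).comp (ContinuousLinearMap.snd ℝ ℂ ℂ))).prod
    ((Complex.conjCLE : EndLine).comp (ContinuousLinearMap.fst ℝ ℂ ℂ))

@[simp] theorem quat_apply (u : Plane) :
    quat u = (-(starRingEnd ℂ) u.2, (starRingEnd ℂ) u.1) := rfl

theorem quat_sq : quat * quat = -1 := by
  refine ContinuousLinearMap.ext fun u => ?_
  simp [Prod.ext_iff]

/-- The structures in `splitBlocks` with skew-adjoint `a` and with `c = -i`, which are those in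
`negativeOrthogonal`. -/
def unitaryBlocks : Set Blocks :=
  {p | p ∈ splitBlocks ∧ quat * p.1 * quat = -p.1 ∧ p.2.2 = -iLine}

/-- The squared Frobenius norm of a complex-linear endomorphism. -/
def frobenius (a : EndPlane) : ℝ :=
  Complex.normSq (a (1, 0)).1 + Complex.normSq (a (1, 0)).2 + Complex.normSq (a (0, 1)).1 +
    Complex.normSq (a (0, 1)).2

/-- The path from the skew-adjoint part of `a` to `a`, before normalization. -/
def skewPath (a : EndPlane) (t : ℝ) : EndPlane :=
  ((1 + t) / 2) • a - ((1 - t) / 2) • (quat * a * quat)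

/-- Minus the square of `skewPath a t`. -/
def skewScale (a : EndPlane) (t : ℝ) : ℝ := (1 + t ^ 2) / 2 + (1 - t ^ 2) / 4 * frobenius a

/-- The normalized path from a unitary complex structure to `a`. -/
def unitaryPath (a : EndPlane) (t : ℝ) : EndPlane := (√(skewScale a t))⁻¹ • skewPath a t

theorem skewScale_pos (a : EndPlane) {t : ℝ} (ht : t ∈ Icc (0 : ℝ) 1) : 0 < skewScale a t := by
  have h1 : 0 ≤ frobenius a := by
    unfold frobenius
    have := fun z => Complex.normSq_nonneg z
    linarith [this (a (1, 0)).1, this (a (1, 0)).2, this (a (0, 1)).1, this (a (0, 1)).2]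
  have h2 : 0 ≤ 1 - t ^ 2 := by nlinarith [ht.1, ht.2]
  have := mul_nonneg h2 h1
  unfold skewScale
  nlinarith [sq_nonneg t]

theorem quat_mul_mul_quat {a : EndPlane} {p q r : ℂ}
    (h : ∀ u, a u = (p * u.1 + q * u.2, r * u.1 - p * u.2)) (u : Plane) :
    (quat * a * quat) u = ((starRingEnd ℂ) p * u.1 + (starRingEnd ℂ) r * u.2,
      (starRingEnd ℂ) q * u.1 - (starRingEnd ℂ) p * u.2) := by
  change quat (a (quat u)) = _
  simp only [quat_apply, h, map_add, map_sub, map_mul, map_neg, Complex.conj_conj]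
  refine Prod.ext ?_ ?_ <;> ring

theorem skewPath_apply {a : EndPlane} {p q r : ℂ}
    (h : ∀ u, a u = (p * u.1 + q * u.2, r * u.1 - p * u.2)) (t : ℝ) (u : Plane) :
    skewPath a t u =
      (((1 + t) / 2 * p - (1 - t) / 2 * (starRingEnd ℂ) p) * u.1 +
        ((1 + t) / 2 * q - (1 - t) / 2 * (starRingEnd ℂ) r) * u.2,
      ((1 + t) / 2 * r - (1 - t) / 2 * (starRingEnd ℂ) q) * u.1 -
        ((1 + t) / 2 * p - (1 - t) / 2 * (starRingEnd ℂ) p) * u.2) := by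
  change ((1 + t) / 2) • a u - ((1 - t) / 2) • (quat * a * quat) u = _
  rw [quat_mul_mul_quat h, h]
  refine Prod.ext ?_ ?_
  · simp only [Prod.fst_sub, Prod.smul_fst, Complex.real_smul]; push_cast; ring
  · simp only [Prod.snd_sub, Prod.smul_snd, Complex.real_smul]; push_cast; ring

section

variable {a : EndPlane}

/-- As `a` is trace free with square `-1`, the square of every real combination of `a` and its
adjoint is a real scalar. -/
theorem skewPath_sq (ha : a * a = -1) (hc : a * iPlane = iPlane * a)
    (htr : ∀ u v, area (a u) v + area u (a v) = 0) (t : ℝ) :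
    skewPath a t * skewPath a t = -(skewScale a t • 1) := by
  obtain ⟨p, q, r, h⟩ := coeffs_of_commute hc htr
  have h1 : p * p + q * r = -1 := by
    have := congrArg Prod.fst (apply_apply_of_sq ha (1, 0))
    simpa [h] using this
  have h2 := congrArg (starRingEnd ℂ) h1
  simp only [map_add, map_mul, map_neg, map_one] at h2
  have hf : (frobenius a : ℂ) = 2 * (p * (starRingEnd ℂ) p) + r * (starRingEnd ℂ) r +
      q * (starRingEnd ℂ) q := by
    simp only [frobenius, h, Complex.mul_conj]
    simp
    ring
  refine ContinuousLinearMap.ext fun u => ?_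
  change skewPath a t (skewPath a t u) = -(skewScale a t • u)
  rw [skewPath_apply h, skewPath_apply h]
  refine Prod.ext ?_ ?_
  · simp only [Prod.fst_neg, Prod.smul_fst, Complex.real_smul, skewScale]
    push_cast
    rw [hf]
    linear_combination ((1 + t) ^ 2 / 4 * u.1) * h1 + ((1 - t) ^ 2 / 4 * u.1) * h2
  · simp only [Prod.snd_neg, Prod.smul_snd, Complex.real_smul, skewScale]
    push_cast
    rw [hf]
    linear_combination ((1 + t) ^ 2 / 4 * u.2) * h1 + ((1 - t) ^ 2 / 4 * u.2) * h2

theorem unitaryPath_sq (ha : a * a = -1) (hc : a * iPlane = iPlane * a)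
    (htr : ∀ u v, area (a u) v + area u (a v) = 0) {t : ℝ} (ht : t ∈ Icc (0 : ℝ) 1) :
    unitaryPath a t * unitaryPath a t = -1 := by
  have h0 := skewScale_pos a ht
  have h1 : (√(skewScale a t))⁻¹ * (√(skewScale a t))⁻¹ * skewScale a t = 1 := by
    rw [← mul_inv, Real.mul_self_sqrt h0.le, inv_mul_cancel₀ h0.ne']
  rw [unitaryPath, smul_mul_smul_comm, skewPath_sq ha hc htr, smul_neg, smul_smul, h1, one_smul]

theorem quat_mul_iPlane : quat * iPlane = -(iPlane * quat) := by
  refine ContinuousLinearMap.ext fun u => ?_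
  change quat (iPlane u) = -iPlane (quat u)
  simp

theorem unitaryPath_commute (hc : a * iPlane = iPlane * a) (t : ℝ) :
    unitaryPath a t * iPlane = iPlane * unitaryPath a t := by
  have h1 : quat * a * quat * iPlane = iPlane * (quat * a * quat) := by
    have h2 : iPlane * quat = -(quat * iPlane) := by rw [quat_mul_iPlane, neg_neg]
    rw [mul_assoc, quat_mul_iPlane, mul_neg, ← mul_assoc, mul_assoc quat, hc, ← mul_assoc,
      quat_mul_iPlane]
    simp [mul_assoc]
  rw [unitaryPath, skewPath, smul_mul_assoc, mul_smul_comm, sub_mul, mul_sub, smul_mul_assoc,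
    mul_smul_comm, smul_mul_assoc, mul_smul_comm, hc, h1]

theorem area_unitaryPath (hc : a * iPlane = iPlane * a)
    (htr : ∀ u v, area (a u) v + area u (a v) = 0) (t : ℝ) (u v : Plane) :
    area (unitaryPath a t u) v + area u (unitaryPath a t v) = 0 := by
  obtain ⟨p, q, r, h⟩ := coeffs_of_commute hc htr
  have h1 : ∀ w, unitaryPath a t w = (√(skewScale a t))⁻¹ • skewPath a t w := fun w => rfl
  rw [h1, h1, skewPath_apply h, skewPath_apply h]
  simp only [area, Prod.smul_fst, Prod.smul_snd, Complex.real_smul]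
  ring

theorem unitaryPath_one (a : EndPlane) : unitaryPath a 1 = a := by
  simp [unitaryPath, skewPath, skewScale]

theorem quat_unitaryPath_zero (a : EndPlane) :
    quat * unitaryPath a 0 * quat = -unitaryPath a 0 := by
  have h : quat * (quat * a * quat) * quat = a := by
    have : quat * (quat * a * quat) * quat = (quat * quat) * a * (quat * quat) := by
      simp only [mul_assoc]
    rw [this, quat_sq]
    simp
  rw [unitaryPath, mul_smul_comm, smul_mul_assoc, skewPath, mul_sub, sub_mul, mul_smul_comm,
    mul_smul_comm, smul_mul_assoc, smul_mul_assoc, h, ← smul_neg]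
  congr 1
  simp

theorem frobenius_of_unitary (ha : a * a = -1) (hc : a * iPlane = iPlane * a)
    (htr : ∀ u v, area (a u) v + area u (a v) = 0) (hq : quat * a * quat = -a) :
    frobenius a = 2 := by
  have h1 := skewPath_sq ha hc htr 0
  have h2 : skewPath a 0 = a := by
    rw [skewPath, hq]
    module
  rw [h2, ha, neg_inj] at h1
  have h3 := congrArg Prod.fst (DFunLike.congr_fun h1 (1, 0))
  simp [skewScale] at h3
  have h4 : (1 : ℝ) = 2⁻¹ + 4⁻¹ * frobenius a := by
    apply Complex.ofReal_injective
    push_cast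
    exact h3
  linarith

theorem unitaryPath_of_unitary (ha : a * a = -1) (hc : a * iPlane = iPlane * a)
    (htr : ∀ u v, area (a u) v + area u (a v) = 0) (hq : quat * a * quat = -a) (t : ℝ) :
    unitaryPath a t = a := by
  have h1 : skewScale a t = 1 := by
    rw [skewScale, frobenius_of_unitary ha hc htr hq]; ring
  have h2 : skewPath a t = a := by
    rw [skewPath, hq]
    module
  rw [unitaryPath, h1, h2]
  simp

end

theorem neg_sq_line {c : EndLine} (hc : c * c = -1) : -c * -c = -1 := by rwa [neg_mul_neg]

theorem neg_interpolate {c : EndLine} (hc : c * c = -1) (hx : sgnLine c < 0) {t : ℝ}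
    (ht : t ∈ Icc (0 : ℝ) 1) : IsUnit ((1 + t) • iLine + (1 - t) • (-c)) :=
  isUnit_interpolate_iLine (neg_sq_line hc) (by rw [sgnLine_neg]; linarith) ht

theorem mem_splitBlocks_of_commute {a : EndPlane} {c : EndLine} (ha : a * a = -1)
    (hc : a * iPlane = iPlane * a) (htr : ∀ u v, area (a u) v + area u (a v) = 0)
    (hc2 : c * c = -1) (hcO : OppOrL c iLine) : ((a, 0, c) : Blocks) ∈ splitBlocks := by
  refine ⟨⟨?_, rfl⟩, hc, htr⟩
  exact (isStructure_of_diagonal ha hc2 (intPair_of_commute ha htr)).mem_minusBlocks_iff.2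
    ⟨oppOrL_of_commute ha hc htr, hcO⟩

theorem continuous_frobenius : Continuous frobenius := by
  have h : ∀ u : Plane, Continuous fun a : EndPlane => a u := fun u =>
    continuous_id.clm_apply continuous_const
  exact (((Complex.continuous_normSq.comp (h _).fst).add (Complex.continuous_normSq.comp
    (h _).snd)).add (Complex.continuous_normSq.comp (h _).fst)).add
      (Complex.continuous_normSq.comp (h _).snd)

/-- The complex structures commuting with `i` are deformed to the unitary ones by scaling down
their self-adjoint part, and the structure on the centre is deformed to `-i`. -/
theorem nonempty_homotopyEquiv_unitary : Nonempty (splitBlocks ≃ₕ unitaryBlocks) := by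
  have hmem : ∀ t ∈ Icc (0 : ℝ) 1, ∀ p ∈ splitBlocks,
      ((unitaryPath p.1 t, 0, -cayleyPath iLine (-p.2.2) t) : Blocks) ∈ splitBlocks := by
    rintro t ht p ⟨⟨⟨⟨ha, hc, -, -⟩, hx, -⟩, -⟩, hcm, htr⟩
    have h1 := fun t ht => neg_interpolate hc hx (t := t) ht
    have hu := isUnit_one_add_smul_cayley h1 ht
    refine mem_splitBlocks_of_commute (unitaryPath_sq ha hcm htr ht) (unitaryPath_commute hcm t)
      (area_unitaryPath hcm htr t) (neg_sq_line (cayleyPath_sq iLine_sq hu)) ?_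
    exact (SameOrL.neg (sameOrL_cayleyPath iLine_sq h1 ht)).trans_opp oppOrL_neg_iLine
  refine homotopyEquiv_of_deformation (fun p hp => hp.1)
    (fun q => (unitaryPath q.2.1 q.1, 0, -cayleyPath iLine (-q.2.2.2) q.1)) ?_ ?_ ?_ ?_ ?_
  · refine ContinuousOn.prodMk ?_ (continuousOn_const.prodMk (ContinuousOn.neg ?_))
    · have h1 : Continuous fun q : ℝ × Blocks => frobenius q.2.1 :=
        continuous_frobenius.comp continuous_snd.fst
      have h2 : Continuous fun q : ℝ × Blocks => skewScale q.2.1 q.1 := by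
        unfold skewScale
        fun_prop
      have h3 : Continuous fun q : ℝ × Blocks => skewPath q.2.1 q.1 :=
        (((continuous_const.add continuous_fst).div_const 2).smul continuous_snd.fst).sub
          (((continuous_const.sub continuous_fst).div_const 2).smul
            ((continuous_const.mul continuous_snd.fst).mul continuous_const))
      refine ContinuousOn.smul (ContinuousOn.inv₀ h2.sqrt.continuousOn ?_) h3.continuousOn
      exact fun q hq => (Real.sqrt_pos.2 (skewScale_pos _ hq.1)).ne'
    · refine continuousOn_cayleyPath continuousOn_const continuous_snd.snd.snd.neg.continuousOn
        continuous_fst.continuousOn ?_ ?_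
      · rintro q ⟨-, ⟨⟨⟨-, hc, -, -⟩, hx, -⟩, -⟩, -⟩
        exact unit_of_interpolate fun t ht => neg_interpolate hc hx ht
      · rintro q ⟨ht, ⟨⟨⟨-, hc, -, -⟩, hx, -⟩, -⟩, -⟩
        exact isUnit_one_add_smul_cayley (fun t ht => neg_interpolate hc hx ht) ht
  · exact hmem
  · rintro p ⟨⟨⟨⟨ha, hc, -, -⟩, hx, -⟩, h0⟩, -, -⟩
    have h1 := fun t ht => neg_interpolate hc hx (t := t) ht
    refine Prod.ext (unitaryPath_one _) (Prod.ext h0.symm ?_)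
    have h2 : cayleyPath iLine (-p.2.2) 1 = -p.2.2 := cayleyPath_one iLine_sq (neg_sq_line hc)
      (unit_of_interpolate h1) (unit_one_add_of_interpolate h1)
    exact (congrArg Neg.neg h2).trans (neg_neg _)
  · intro p hp
    refine ⟨hmem 0 ⟨le_rfl, zero_le_one⟩ p hp, quat_unitaryPath_zero _, ?_⟩
    exact congrArg Neg.neg cayleyPath_zero
  · rintro p ⟨⟨⟨⟨⟨ha, hc, -, -⟩, hx, -⟩, h0⟩, hcm, htr⟩, hq, hi⟩
    refine Prod.ext (unitaryPath_of_unitary ha hcm htr hq _) (Prod.ext h0.symm ?_)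
    exact (congrArg Neg.neg cayleyPath_zero).trans hi.symm

end Unitary

/-! ### The unitary structures form a sphere -/

section Sphere

open Set

/-- The trace-free skew-Hermitian endomorphism of `ℂ²` with given coordinates. -/
def pauli (x y z : ℝ) : EndPlane :=
  x • diagPlane iLine (-iLine) + y • (ContinuousLinearMap.snd ℝ ℂ ℂ).prod
    (-ContinuousLinearMap.fst ℝ ℂ ℂ) + z • (iPlane * (ContinuousLinearMap.snd ℝ ℂ ℂ).prod
    (ContinuousLinearMap.fst ℝ ℂ ℂ))

theorem pauli_apply (x y z : ℝ) (u : Plane) : pauli x y z u =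
    (x * Complex.I * u.1 + (y + z * Complex.I) * u.2,
      (-y + z * Complex.I) * u.1 - x * Complex.I * u.2) := by
  have h : pauli x y z u = x • (Complex.I * u.1, -(Complex.I * u.2)) + y • (u.2, -u.1) +
    z • (Complex.I * u.2, Complex.I * u.1) := rfl
  rw [h]
  refine Prod.ext ?_ ?_
  · simp only [Prod.fst_add, Prod.smul_fst, Complex.real_smul]; ring
  · simp only [Prod.snd_add, Prod.smul_snd, Complex.real_smul]; ring

theorem pauli_sq (x y z : ℝ) : pauli x y z * pauli x y z = -((x ^ 2 + y ^ 2 + z ^ 2) • 1) := by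
  refine ContinuousLinearMap.ext fun u => ?_
  change pauli x y z (pauli x y z u) = -((x ^ 2 + y ^ 2 + z ^ 2) • u)
  rw [pauli_apply, pauli_apply]
  have hI := Complex.I_sq
  refine Prod.ext ?_ ?_
  · simp only [Prod.fst_neg, Prod.smul_fst, Complex.real_smul]
    push_cast
    linear_combination ((x ^ 2 + z ^ 2) * u.1) * hI
  · simp only [Prod.snd_neg, Prod.smul_snd, Complex.real_smul]
    push_cast
    linear_combination ((x ^ 2 + z ^ 2) * u.2) * hI

theorem pauli_mem {x y z : ℝ} (h : x ^ 2 + y ^ 2 + z ^ 2 = 1) :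
    ((pauli x y z, 0, -iLine) : Blocks) ∈ unitaryBlocks := by
  have h1 : ∀ u, pauli x y z u = (x * Complex.I * u.1 + (y + z * Complex.I) * u.2,
      (-y + z * Complex.I) * u.1 - x * Complex.I * u.2) := pauli_apply x y z
  refine ⟨mem_splitBlocks_of_commute ?_ ?_ ?_ (neg_sq_line iLine_sq) oppOrL_neg_iLine, ?_, rfl⟩
  · rw [pauli_sq, h, one_smul]
  · refine ContinuousLinearMap.ext fun u => ?_
    change pauli x y z (iPlane u) = iPlane (pauli x y z u)
    rw [h1, h1]
    refine Prod.ext ?_ ?_ <;> simp only [iPlane_apply] <;> ring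
  · intro u v
    rw [h1, h1]
    simp only [area]
    ring
  · refine ContinuousLinearMap.ext fun u => ?_
    change (quat * pauli x y z * quat) u = -pauli x y z u
    rw [quat_mul_mul_quat h1, h1]
    simp only [map_mul, map_add, map_neg, Complex.conj_I, Complex.conj_ofReal]
    refine Prod.ext ?_ ?_
    · simp only [Prod.fst_neg]; ring
    · simp only [Prod.snd_neg]; ring

/-- Every trace-free skew-Hermitian endomorphism is of this form. -/
theorem eq_pauli {a : EndPlane} (hc : a * iPlane = iPlane * a)
    (htr : ∀ u v, area (a u) v + area u (a v) = 0) (hq : quat * a * quat = -a) :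
    a = pauli (a (1, 0)).1.im (a (0, 1)).1.re (a (0, 1)).1.im := by
  obtain ⟨p, q, r, h⟩ := coeffs_of_commute hc htr
  have h1 : (starRingEnd ℂ) p = -p ∧ (starRingEnd ℂ) q = -r := by
    have h2 : (quat * a * quat) (1, 0) = -a (1, 0) := DFunLike.congr_fun hq _
    rw [quat_mul_mul_quat h, h] at h2
    simpa using h2
  have hp : p = p.im * Complex.I := by
    have := congrArg Complex.re h1.1
    simp at this
    apply Complex.ext <;> simp
    linarith
  have hr : r = -q.re + q.im * Complex.I := by
    rw [← neg_eq_iff_eq_neg.2 h1.2]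
    apply Complex.ext <;> simp
  refine ContinuousLinearMap.ext fun u => ?_
  rw [pauli_apply]
  simp only [h, mul_one, mul_zero, add_zero, zero_add]
  rw [← hp, ← hr, Complex.re_add_im]

theorem pauli_coords (x y z : ℝ) : (pauli x y z (1, 0)).1.im = x ∧
    (pauli x y z (0, 1)).1.re = y ∧ (pauli x y z (0, 1)).1.im = z := by
  simp [pauli_apply]

theorem mem_twoSphere_iff (v : EuclideanSpace ℝ (Fin 3)) :
    v ∈ Metric.sphere (0 : EuclideanSpace ℝ (Fin 3)) 1 ↔ v 0 ^ 2 + v 1 ^ 2 + v 2 ^ 2 = 1 := by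
  rw [mem_sphere_zero_iff_norm, EuclideanSpace.norm_eq, Real.sqrt_eq_one, Fin.sum_univ_three]
  simp

/-- The unitary structures form a two-sphere, with the coordinates of `pauli`. -/
def unitaryBlocksHomeomorph : unitaryBlocks ≃ₜ TwoSphere where
  toFun p := ⟨!₂[(p.1.1 (1, 0)).1.im, (p.1.1 (0, 1)).1.re, (p.1.1 (0, 1)).1.im], by
    obtain ⟨p, ⟨⟨⟨⟨ha, -, -, -⟩, -, -⟩, -⟩, hcm, htr⟩, hq, -⟩ := p
    rw [mem_twoSphere_iff]
    have h := eq_pauli hcm htr hq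
    dsimp only at ha h ⊢
    rw [h, pauli_sq, neg_inj] at ha
    have h1 := congrArg Prod.fst (DFunLike.congr_fun ha (1, 0))
    simp at h1
    have h2 : (p.1 (1, 0)).1.im ^ 2 + (p.1 (0, 1)).1.re ^ 2 + (p.1 (0, 1)).1.im ^ 2 = (1 : ℝ) := by
      exact_mod_cast h1
    exact h2⟩
  invFun v := ⟨(pauli (v.1 0) (v.1 1) (v.1 2), 0, -iLine),
    pauli_mem ((mem_twoSphere_iff _).1 v.2)⟩
  left_inv p := by
    obtain ⟨p, ⟨⟨-, h0⟩, hcm, htr⟩, hq, hi⟩ := p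
    exact Subtype.ext (Prod.ext (eq_pauli hcm htr hq).symm (Prod.ext h0.symm hi.symm))
  right_inv v := by
    apply Subtype.ext
    have h := pauli_coords (v.1 0) (v.1 1) (v.1 2)
    ext i
    fin_cases i
    · exact h.1
    · exact h.2.1
    · exact h.2.2
  continuous_toFun := by
    have h : ∀ u : Plane, Continuous fun p : unitaryBlocks => (p.1.1 u).1 := fun u =>
      (continuous_subtype_val.fst.clm_apply continuous_const).fst
    refine Continuous.subtype_mk ?_ _
    refine (PiLp.continuous_toLp 2 _).comp (continuous_pi fun i => ?_)
    fin_cases i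
    · exact Complex.continuous_im.comp (h _)
    · exact Complex.continuous_re.comp (h _)
    · exact Complex.continuous_im.comp (h _)
  continuous_invFun := by
    have h : ∀ i, Continuous fun v : TwoSphere => v.1 i := fun i => by fun_prop
    refine Continuous.subtype_mk (Continuous.prodMk ?_ continuous_const) _
    exact (((h 0).smul continuous_const).add ((h 1).smul continuous_const)).add
      ((h 2).smul continuous_const)

end Sphere

/-! ### Orthogonal structures -/

section Orthogonal

open Set

/-- The standard real inner product on `ℂ²`. -/
def planeInner (u v : Plane) : ℝ :=
  (u.1 * (starRingEnd ℂ) v.1 + u.2 * (starRingEnd ℂ) v.2).re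

theorem metric_eq (A B : heis) : metric A B = planeInner (coord A).1 (coord B).1 +
    ((coord A).2 * (starRingEnd ℂ) (coord B).2).re := by
  change metric A B = planeInner (A.1 0 1, A.1 1 2) (B.1 0 1, B.1 1 2) +
    (A.1 0 2 * (starRingEnd ℂ) (B.1 0 2)).re
  simp [metric, coframe, planeInner, Fin.sum_univ_six]
  ring

theorem isOrthogonal_ofBlocks_iff (p : Blocks) : IsOrthogonal (ofBlocks p) ↔
    ∀ u v w z, planeInner (p.1 u) (p.1 v) +
      ((p.2.1 u + p.2.2 w) * (starRingEnd ℂ) (p.2.1 v + p.2.2 z)).re =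
        planeInner u v + (w * (starRingEnd ℂ) z).re := by
  constructor
  · intro h u v w z
    have := h (coord.symm (u, w)) (coord.symm (v, z))
    simpa only [metric_eq, coord_ofBlocks, ContinuousLinearEquiv.apply_symm_apply] using this
  · intro h A B
    simpa only [metric_eq, coord_ofBlocks] using h (coord A).1 (coord B).1 (coord A).2 (coord B).2

theorem isOrthogonal_diagonal {a : EndPlane} {c : EndLine}
    (ha : ∀ u v, planeInner (a u) (a v) = planeInner u v)
    (hc : ∀ w z, (c w * (starRingEnd ℂ) (c z)).re = (w * (starRingEnd ℂ) z).re) :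
    IsOrthogonal (ofBlocks (a, 0, c)) := by
  rw [isOrthogonal_ofBlocks_iff]
  intro u v w z
  simp only [zero_apply, zero_add, ha, hc]

/-- The centre is invariant under an orthogonal complex structure preserving it, and so is its
orthogonal complement. -/
theorem eq_diagonal_of_isOrthogonal {p : Blocks} (hc : p.2.2 * p.2.2 = -1)
    (h : IsOrthogonal (ofBlocks p)) : p.2.1 = 0 ∧
      (∀ u v, planeInner (p.1 u) (p.1 v) = planeInner u v) ∧
        ∀ w z, (p.2.2 w * (starRingEnd ℂ) (p.2.2 z)).re = (w * (starRingEnd ℂ) z).re := by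
  rw [isOrthogonal_ofBlocks_iff] at h
  have h0 : p.2.1 = 0 := by
    refine ContinuousLinearMap.ext fun u => ?_
    have h1 := h u 0 0 (-p.2.2 (p.2.1 u))
    rw [map_neg, apply_apply_of_sq hc] at h1
    simp [planeInner] at h1
    apply Complex.ext <;> simp <;> nlinarith [mul_self_nonneg (p.2.1 u).re,
      mul_self_nonneg (p.2.1 u).im]
  refine ⟨h0, fun u v => ?_, fun w z => ?_⟩
  · simpa [h0] using h u v 0 0
  · simpa [h0, planeInner] using h 0 0 w z

theorem eq_iLine_or_of_isometry {c : EndLine} (hc : c * c = -1)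
    (h : ∀ w z, (c w * (starRingEnd ℂ) (c z)).re = (w * (starRingEnd ℂ) z).re) :
    c = iLine ∨ c = -iLine := by
  obtain ⟨x, β, -, -, hcx⟩ := trLine_of_sq hc
  have h1 := h 1 1
  have h2 := h Complex.I Complex.I
  have h4 := congrArg Complex.re (apply_apply_of_sq hc 1)
  simp [hcx] at h1 h2 h4
  have h3 : β.re ^ 2 + β.im ^ 2 = 0 := by nlinarith
  have hre : β.re = 0 := by nlinarith [sq_nonneg β.im]
  have him : β.im = 0 := by nlinarith [sq_nonneg β.re]
  have hx : x * x = 1 := by nlinarith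
  have hβ : β = 0 := Complex.ext hre him
  rcases mul_self_eq_one_iff.1 hx with h5 | h5
  · left
    refine ContinuousLinearMap.ext fun w => ?_
    simp [hcx, h5, hβ]
  · right
    refine ContinuousLinearMap.ext fun w => ?_
    simp [hcx, h5, hβ]

/-- An orthogonal complex structure is skew-adjoint, which determines the shape of its
coefficients. -/
theorem coeffs_of_isometry {a : EndPlane} (ha : a * a = -1)
    (h : ∀ u v, planeInner (a u) (a v) = planeInner u v) : ∃ (s s' : ℝ) (q b : ℂ),
      ∀ u, a u = (s * Complex.I * u.1 + q * u.2 + b * (starRingEnd ℂ) u.2,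
        -(starRingEnd ℂ) q * u.1 + s' * Complex.I * u.2 - b * (starRingEnd ℂ) u.1) := by
  obtain ⟨a₁₁, a₁₂, a₂₁, a₂₂, b₁₁, b₁₂, b₂₁, b₂₂, hu⟩ := coeffs_plane a
  have hs : ∀ u v, planeInner (a u) v + planeInner u (a v) = 0 := by
    intro u v
    have h1 := h u (a v)
    rw [apply_apply_of_sq ha] at h1
    simp only [planeInner, Prod.fst_neg, Prod.snd_neg, map_neg, mul_neg, Complex.add_re,
      Complex.neg_re] at h1 ⊢
    linarith
  have e1 := hs (1, 0) (1, 0)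
  have e2 := hs (Complex.I, 0) (Complex.I, 0)
  have e3 := hs (1, 0) (Complex.I, 0)
  have e4 := hs (0, 1) (0, 1)
  have e5 := hs (0, Complex.I) (0, Complex.I)
  have e6 := hs (0, 1) (0, Complex.I)
  have e7 := hs (1, 0) (0, 1)
  have e8 := hs (1, 0) (0, Complex.I)
  have e9 := hs (Complex.I, 0) (0, 1)
  have e10 := hs (Complex.I, 0) (0, Complex.I)
  simp [hu, planeInner] at e1 e2 e3 e4 e5 e6 e7 e8 e9 e10
  have f1 : b₁₁ = 0 := by apply Complex.ext <;> simp <;> linarith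
  have f2 : b₂₂ = 0 := by apply Complex.ext <;> simp <;> linarith
  have f3 : a₁₁ = a₁₁.im * Complex.I := by apply Complex.ext <;> simp; linarith
  have f4 : a₂₂ = a₂₂.im * Complex.I := by apply Complex.ext <;> simp; linarith
  have f5 : a₂₁ = -(starRingEnd ℂ) a₁₂ := by apply Complex.ext <;> simp <;> linarith
  have f6 : b₂₁ = -b₁₂ := by apply Complex.ext <;> simp <;> linarith
  refine ⟨a₁₁.im, a₂₂.im, a₁₂, b₁₂, fun u => ?_⟩
  rw [hu, ← f3, ← f4, f1, f2, f5, f6]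
  refine Prod.ext ?_ ?_ <;> ring

/-- The orthogonal complex structures of `ℂ²` form two spheres, given by the imaginary unit
quaternions acting from the left and from the right. One sphere contains `i`; the other one consists
of the trace-free structures commuting with `i`. -/
theorem isometry_cases {a : EndPlane} (ha : a * a = -1)
    (h : ∀ u v, planeInner (a u) (a v) = planeInner u v) :
    (∃ (s : ℝ) (b : ℂ), ∀ u, a u = (s * Complex.I * u.1 + b * (starRingEnd ℂ) u.2,
      s * Complex.I * u.2 - b * (starRingEnd ℂ) u.1)) ∨
    (a * iPlane = iPlane * a ∧ (∀ u v, area (a u) v + area u (a v) = 0) ∧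
      quat * a * quat = -a) := by
  obtain ⟨s, s', q, b, hu⟩ := coeffs_of_isometry ha h
  have hI := Complex.I_sq
  have e1 := apply_apply_of_sq ha (1, 0)
  have e2 := apply_apply_of_sq ha (Complex.I, 0)
  have e3 := apply_apply_of_sq ha (0, 1)
  simp only [hu, Prod.ext_iff, map_mul, map_add, map_sub, map_neg, map_one, map_zero,
    Complex.conj_I, Complex.conj_conj, Complex.conj_ofReal, Prod.fst_neg, Prod.snd_neg] at e1 e2 e3
  -- the three equations are the off-diagonal part of `a² = -1`
  have f1 : q * b = 0 := by grind
  have f2 : (starRingEnd ℂ) q * (s + s') = 0 := by grind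
  have f3 : b * (s' - s) = 0 := by grind
  by_cases hb : b = 0
  · have hcase : s' = -s ∨ (q = 0 ∧ s' = s) := by
      rcases mul_eq_zero.1 f2 with hq | hs
      · have hq : q = 0 := (map_eq_zero _).1 hq
        have g1 : (s : ℂ) * s = 1 := by grind
        have g2 : (s' : ℂ) * s' = 1 := by grind
        have g3 : ((s' : ℂ) - s) * (s' + s) = 0 := by linear_combination g2 - g1
        rcases mul_eq_zero.1 g3 with g | g
        · exact Or.inr ⟨hq, by exact_mod_cast sub_eq_zero.1 g⟩
        · exact Or.inl (by exact_mod_cast eq_neg_of_add_eq_zero_left g)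
      · exact Or.inl (by exact_mod_cast eq_neg_of_add_eq_zero_right hs)
    rcases hcase with hs | ⟨hq, hs⟩
    · right
      have hv : ∀ u, a u = (s * Complex.I * u.1 + q * u.2,
          -(starRingEnd ℂ) q * u.1 - s * Complex.I * u.2) := fun u => by
        rw [hu, hb, hs]
        push_cast
        refine Prod.ext ?_ ?_ <;> ring
      refine ⟨ContinuousLinearMap.ext fun u => ?_, fun u v => ?_,
        ContinuousLinearMap.ext fun u => ?_⟩
      · change a (iPlane u) = iPlane (a u)
        rw [hv, hv]
        refine Prod.ext ?_ ?_ <;> simp only [iPlane_apply] <;> ring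
      · rw [hv, hv]
        simp only [area]
        ring
      · rw [quat_mul_mul_quat hv]
        change _ = -a u
        rw [hv]
        simp only [map_mul, map_neg, Complex.conj_I, Complex.conj_ofReal, Complex.conj_conj]
        refine Prod.ext ?_ ?_
        · simp only [Prod.fst_neg]; ring
        · simp only [Prod.snd_neg]; ring
    · left
      refine ⟨s, b, fun u => ?_⟩
      rw [hu, hs, hq]
      refine Prod.ext ?_ ?_ <;> simp
  · left
    have hq : q = 0 := (mul_eq_zero.1 f1).resolve_right hb
    have hs : s' = s := by
      exact_mod_cast sub_eq_zero.1 ((mul_eq_zero.1 f3).resolve_left hb)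
    refine ⟨s, b, fun u => ?_⟩
    rw [hu, hs, hq]
    refine Prod.ext ?_ ?_ <;> simp

/-- The structures on the sphere containing `i` induce the same orientation as `i`: a structure `K`
with `i K + K i = -2 s` can be joined to `i` if `s ≥ 0`, and otherwise this applies to `-K`. -/
theorem sameOrL_iPlane_of_coeffs {a : EndPlane} (ha : a * a = -1) {s : ℝ} {b : ℂ}
    (h : ∀ u, a u = (s * Complex.I * u.1 + b * (starRingEnd ℂ) u.2,
      s * Complex.I * u.2 - b * (starRingEnd ℂ) u.1)) : SameOrL a iPlane := by
  have key : ∀ {K : EndPlane} {σ : ℝ}, K * K = -1 → 0 ≤ σ →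
      iPlane * K + K * iPlane = -((2 : ℝ) • (σ • (1 : EndPlane))) → SameOrL K iPlane := by
    intro K σ hK hσ hX
    refine sameOrL_of_isUnit_interpolate iPlane_sq hK fun t ht => ?_
    refine isUnit_interpolate iPlane_sq hK (X := σ • (1 : EndPlane)) (τ := σ + 1) (δ := σ) hX ?_
      (by linarith) (by linarith) ht
    rw [smul_mul_smul_comm, one_mul]
    module
  have hs : iPlane * a + a * iPlane = -((2 : ℝ) • (s • (1 : EndPlane))) := by
    refine ContinuousLinearMap.ext fun u => ?_
    change iPlane (a u) + a (iPlane u) = -((2 : ℝ) • (s • u))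
    simp only [h, iPlane_apply, map_mul, Complex.conj_I]
    refine Prod.ext ?_ ?_
    · simp only [Prod.fst_add, Prod.fst_neg, Prod.smul_fst, Complex.real_smul]
      push_cast
      linear_combination (2 * s * u.1) * Complex.I_sq
    · simp only [Prod.snd_add, Prod.snd_neg, Prod.smul_snd, Complex.real_smul]
      push_cast
      linear_combination (2 * s * u.2) * Complex.I_sq
  rcases le_total 0 s with h0 | h0
  · exact key ha h0 hs
  · have h1 : SameOrL (-a) iPlane := by
      refine key (σ := -s) (by rwa [neg_mul_neg]) (by linarith) ?_
      rw [mul_neg, neg_mul, ← neg_add, hs]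
      module
    have h2 := SameOrL.neg h1
    rw [neg_neg] at h2
    exact h2.trans sameOrL_neg_iPlane

theorem ofBlocks_mem_negativeOrthogonal_iff (p : Blocks) :
    ofBlocks p ∈ negativeOrthogonal ↔ p ∈ unitaryBlocks := by
  constructor
  · rintro ⟨h1, h2, h3, h4⟩
    obtain ⟨ha, hc, -⟩ := (isAlmostComplex_ofBlocks_iff p).1 h1
    rw [hatNegative_ofBlocks_iff ha] at h4
    rw [sameOrientation_ofBlocks_iff h1] at h2
    have hcO : OppOrL p.2.2 iLine := by
      rcases h2 with h2 | h2
      · exact absurd h4 (h2.1.not_oppOr (apply_apply_of_sq ha))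
      · exact h2.2
    obtain ⟨h0, hia, hic⟩ := eq_diagonal_of_isOrthogonal hc h3
    have hi : p.2.2 = -iLine := by
      refine (eq_iLine_or_of_isometry hc hic).resolve_left fun hi => ?_
      rw [hi] at hcO
      exact (SameOr.refl _).not_oppOr (apply_apply_of_sq iLine_sq) hcO
    rcases isometry_cases ha hia with ⟨s, b, hu⟩ | ⟨hcm, htr, hq⟩
    · exact absurd h4 ((sameOrL_iPlane_of_coeffs ha hu).not_oppOr (apply_apply_of_sq ha))
    · have := mem_splitBlocks_of_commute ha hcm htr hc hcO
      rw [← h0] at this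
      exact ⟨this, hq, hi⟩
  · rintro ⟨⟨⟨hm, h0⟩, hcm, htr⟩, hq, hi⟩
    have hJ := (ofBlocks_mem_cMinus_iff p).2 hm
    refine ⟨hJ.1.1, hJ.1.2.2, ?_, hJ.2⟩
    obtain ⟨a, r, c⟩ := p
    dsimp only at h0 hcm htr hq hi
    subst h0 hi
    have ha : a * a = -1 := hm.1.1
    have he := eq_pauli hcm htr hq
    generalize (a (1, 0)).1.im = x at he
    generalize (a (0, 1)).1.re = y at he
    generalize (a (0, 1)).1.im = z at he
    subst he
    rw [pauli_sq, neg_inj] at ha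
    have h1 := congrArg Prod.fst (DFunLike.congr_fun ha (1, 0))
    simp at h1
    have h2 : x ^ 2 + y ^ 2 + z ^ 2 = (1 : ℝ) := by exact_mod_cast h1
    refine isOrthogonal_diagonal (fun u v => ?_) fun w z => ?_
    · simp only [planeInner, pauli_apply]
      simp
      linear_combination (u.1.re * v.1.re + u.1.im * v.1.im + u.2.re * v.2.re +
        u.2.im * v.2.im) * h2
    · simp

theorem ofBlocks_toBlocks_of_mem_negativeOrthogonal {J : EndHeis} (h : J ∈ negativeOrthogonal) :
    ofBlocks (toBlocks J) = J := by
  obtain ⟨K, -, hK, -⟩ := h.2.2.2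
  exact hK.preservesCentre.ofBlocks_toBlocks

theorem isOrthogonal_J₀ : IsOrthogonal J₀ := by
  rw [J₀_eq]
  refine isOrthogonal_diagonal (fun u v => ?_) fun w z => ?_
  · simp [planeInner]
  · simp

theorem J₀_mem_cPlus : J₀ ∈ cPlus := by
  rw [J₀_eq]
  exact (ofBlocks_mem_cPlus_iff _).2 J₀_blocks_mem

/-- On the sphere containing `i`, integrability with `c = i` forces `b = 0` and `s = 1`. -/
theorem eq_J₀_of_isOrthogonal {J : EndHeis} (hJ : J ∈ cPlus) (ho : IsOrthogonal J) : J = J₀ := by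
  have he := ofBlocks_toBlocks_of_mem hJ.1
  rw [← he, ofBlocks_mem_cPlus_iff] at hJ
  rw [← he] at ho ⊢
  generalize toBlocks J = p at hJ ho
  obtain ⟨⟨ha, hc, -, hi⟩, hx, hξ⟩ := id hJ
  obtain ⟨hO, hcO⟩ := hJ.1.mem_plusBlocks_iff.1 hJ
  obtain ⟨h0, hia, hic⟩ := eq_diagonal_of_isOrthogonal hc ho
  have hcI : p.2.2 = iLine := by
    refine (eq_iLine_or_of_isometry hc hic).resolve_right fun h => ?_
    rw [h] at hcO
    exact hcO.not_oppOr (apply_apply_of_sq (neg_sq_line iLine_sq)) oppOrL_neg_iLine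
  rw [J₀_eq]
  refine congrArg ofBlocks (Prod.ext ?_ (Prod.ext h0 hcI))
  rcases isometry_cases ha hia with ⟨s, b, hu⟩ | ⟨hcm, htr, -⟩
  · have h1 := hi (1, 0) (0, 1)
    have h2 := hi (1, 0) (0, Complex.I)
    simp only [hcI, hu, area, iLine_apply, map_one, map_zero, Complex.conj_I] at h1 h2
    have hI := Complex.I_sq
    have hb : b ^ 2 = 0 := by grind
    have hs : ((s : ℂ) - 1) ^ 2 = 0 := by grind
    have hb : b = 0 := pow_eq_zero_iff two_ne_zero |>.1 hb
    have hs : (s : ℂ) = 1 := sub_eq_zero.1 (pow_eq_zero_iff two_ne_zero |>.1 hs)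
    refine ContinuousLinearMap.ext fun u => ?_
    simp [hu, hb, hs]
  · exact absurd (oppOrL_of_commute ha hcm htr) (hO.not_oppOr (apply_apply_of_sq ha))

theorem negativeOrthogonal_subset_cMinus : negativeOrthogonal ⊆ cMinus := by
  intro J hJ
  have he := ofBlocks_toBlocks_of_mem_negativeOrthogonal hJ
  rw [← he] at hJ
  rw [← he]
  exact (ofBlocks_mem_cMinus_iff _).2 ((ofBlocks_mem_negativeOrthogonal_iff _).1 hJ).1.1.1

theorem orthogonalStructures_eq : orthogonalStructures = {J₀} ∪ negativeOrthogonal := by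
  ext J
  constructor
  · rintro ⟨h, ho⟩
    rw [complexStructures_eq] at h
    rcases h with h | h
    · exact Or.inl (eq_J₀_of_isOrthogonal h ho)
    · exact Or.inr ⟨h.1.1, h.1.2.2, ho, h.2⟩
  · rintro (rfl | h)
    · exact ⟨J₀_mem_cPlus.1, isOrthogonal_J₀⟩
    · exact ⟨(negativeOrthogonal_subset_cMinus h).1, h.2.2.1⟩

end Orthogonal

/-! ### Homotopy types and connected components -/

section Components

open Set

/-- A function whose sign is the orientation of the structure induced on the centre, which tells the
two components apart. -/
def centreSign (J : EndHeis) : ℝ := sgnLine (toBlocks J).2.2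

theorem continuous_centreSign : Continuous centreSign :=
  continuous_sgnLine.comp continuous_toBlocks.snd.snd

theorem centreSign_pos {J : EndHeis} (h : J ∈ cPlus) : 0 < centreSign J := by
  rw [← ofBlocks_toBlocks_of_mem h.1, ofBlocks_mem_cPlus_iff] at h
  exact h.2.1

theorem centreSign_neg {J : EndHeis} (h : J ∈ cMinus) : centreSign J < 0 := by
  rw [← ofBlocks_toBlocks_of_mem h.1, ofBlocks_mem_cMinus_iff] at h
  exact h.2.1

theorem disjoint_cPlus_cMinus : Disjoint cPlus cMinus :=
  Set.disjoint_left.2 fun _ h h' => (centreSign_pos h).not_gt (centreSign_neg h')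

theorem nonempty_homotopyEquiv_cPlus : Nonempty (cPlus ≃ₕ Unit) := by
  obtain ⟨e⟩ := nonempty_homotopyEquiv_diagonal (S := plusBlocks)
    fun p hp t => ⟨hp.1.smul t, hp.2⟩
  obtain ⟨e'⟩ := nonempty_homotopyEquiv_plus
  exact ⟨(((blocksHomeomorph ofBlocks_mem_cPlus_iff fun J hJ =>
    ofBlocks_toBlocks_of_mem hJ.1).toHomotopyEquiv.trans e).trans e').trans
      (Homeomorph.homeomorphOfUnique _ _).toHomotopyEquiv⟩

theorem nonempty_homotopyEquiv_cMinus : Nonempty (cMinus ≃ₕ TwoSphere) := by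
  obtain ⟨e⟩ := nonempty_homotopyEquiv_diagonal (S := minusBlocks)
    fun p hp t => ⟨hp.1.smul t, hp.2⟩
  obtain ⟨e₁⟩ := nonempty_homotopyEquiv_split
  obtain ⟨e₂⟩ := nonempty_homotopyEquiv_unitary
  exact ⟨((((blocksHomeomorph ofBlocks_mem_cMinus_iff fun J hJ =>
    ofBlocks_toBlocks_of_mem hJ.1).toHomotopyEquiv.trans e).trans e₁).trans e₂).trans
      unitaryBlocksHomeomorph.toHomotopyEquiv⟩

/-- The negative orthogonal structures form a two-sphere. -/
def negativeOrthogonalHomeomorph : negativeOrthogonal ≃ₜ TwoSphere :=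
  (blocksHomeomorph ofBlocks_mem_negativeOrthogonal_iff fun _ =>
    ofBlocks_toBlocks_of_mem_negativeOrthogonal).trans unitaryBlocksHomeomorph

theorem nonempty_homotopyEquiv_complexStructures :
    Nonempty (complexStructures ≃ₕ Unit ⊕ TwoSphere) := by
  obtain ⟨e⟩ := nonempty_homeomorph_sum (A := cPlus) (B := cMinus) centreSign
    continuous_centreSign (fun _ => centreSign_pos) fun _ => centreSign_neg
  obtain ⟨e₁⟩ := nonempty_homotopyEquiv_cPlus
  obtain ⟨e₂⟩ := nonempty_homotopyEquiv_cMinus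
  rw [complexStructures_eq]
  exact ⟨e.symm.toHomotopyEquiv.trans (sumHomotopyEquiv e₁ e₂)⟩

theorem nonempty_homeomorph_orthogonalStructures :
    Nonempty (orthogonalStructures ≃ₜ Unit ⊕ TwoSphere) := by
  obtain ⟨e⟩ := nonempty_homeomorph_sum (A := {J₀}) (B := negativeOrthogonal) centreSign
    continuous_centreSign (fun _ h => centreSign_pos (h ▸ J₀_mem_cPlus))
    fun _ h => centreSign_neg (negativeOrthogonal_subset_cMinus h)
  rw [orthogonalStructures_eq]
  exact ⟨e.symm.trans ((Homeomorph.homeomorphOfUnique _ _).sumCongr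
    negativeOrthogonalHomeomorph)⟩

instance : PathConnectedSpace TwoSphere := by
  refine isPathConnected_iff_pathConnectedSpace.1 (isPathConnected_sphere ?_ _ zero_le_one)
  rw [← Module.finrank_eq_rank]
  simp

instance : ContractibleSpace cPlus :=
  (Classical.choice nonempty_homotopyEquiv_cPlus).contractibleSpace

theorem connectedComponentIn_of_mem_cPlus {J : EndHeis} (h : J ∈ cPlus) :
    connectedComponentIn complexStructures J = cPlus := by
  have hc : IsPreconnected cPlus := isPreconnected_iff_preconnectedSpace.2 inferInstance
  rw [complexStructures_eq]
  exact connectedComponentIn_union centreSign continuous_centreSign (fun _ => centreSign_pos)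
    (fun _ => centreSign_neg) hc h

theorem connectedComponentIn_of_mem_cMinus {J : EndHeis} (h : J ∈ cMinus) :
    connectedComponentIn complexStructures J = cMinus := by
  have := pathConnectedSpace_of_homotopyEquiv (Classical.choice nonempty_homotopyEquiv_cMinus)
  have hc : IsPreconnected cMinus := isPreconnected_iff_preconnectedSpace.2 inferInstance
  rw [complexStructures_eq, union_comm]
  exact connectedComponentIn_union (fun J => -centreSign J) continuous_centreSign.neg
    (fun _ h => neg_pos.2 (centreSign_neg h)) (fun _ h => neg_neg_iff_pos.2 (centreSign_pos h))
    hc h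

end Components

end Iwasawa

end

theorem theorem4p6 :
    -- the space has the homotopy type of its orthogonal part
    Nonempty (Iwasawa.complexStructures ≃ₕ Iwasawa.orthogonalStructures) ∧
    -- the orthogonal part is the disjoint union of a point and a 2-sphere
    Iwasawa.orthogonalStructures = {Iwasawa.J₀} ∪ Iwasawa.negativeOrthogonal ∧
    Iwasawa.J₀ ∉ Iwasawa.negativeOrthogonal ∧
    Nonempty (Iwasawa.negativeOrthogonal ≃ₜ Iwasawa.TwoSphere) ∧
    Nonempty (Iwasawa.complexStructures ≃ₕ Unit ⊕ Iwasawa.TwoSphere) ∧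
    -- the two connected components and their homotopy types
    Iwasawa.complexStructures = Iwasawa.cPlus ∪ Iwasawa.cMinus ∧
    Disjoint Iwasawa.cPlus Iwasawa.cMinus ∧
    Iwasawa.J₀ ∈ Iwasawa.cPlus ∧
    (∀ J ∈ Iwasawa.cPlus,
      connectedComponentIn Iwasawa.complexStructures J = Iwasawa.cPlus) ∧
    (∀ J ∈ Iwasawa.cMinus,
      connectedComponentIn Iwasawa.complexStructures J = Iwasawa.cMinus) ∧
    ContractibleSpace Iwasawa.cPlus ∧
    Nonempty (Iwasawa.cMinus ≃ₕ Iwasawa.TwoSphere) := by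
  obtain ⟨e⟩ := Iwasawa.nonempty_homotopyEquiv_complexStructures
  obtain ⟨e'⟩ := Iwasawa.nonempty_homeomorph_orthogonalStructures
  exact ⟨⟨e.trans e'.symm.toHomotopyEquiv⟩, Iwasawa.orthogonalStructures_eq,
    fun h => Set.disjoint_left.1 Iwasawa.disjoint_cPlus_cMinus Iwasawa.J₀_mem_cPlus
      (Iwasawa.negativeOrthogonal_subset_cMinus h),
    ⟨Iwasawa.negativeOrthogonalHomeomorph⟩, ⟨e⟩, Iwasawa.complexStructures_eq,
    Iwasawa.disjoint_cPlus_cMinus, Iwasawa.J₀_mem_cPlus,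
    fun _ => Iwasawa.connectedComponentIn_of_mem_cPlus,
    fun _ => Iwasawa.connectedComponentIn_of_mem_cMinus, inferInstance,
    Iwasawa.nonempty_homotopyEquiv_cMinus⟩
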